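/- Conventions. Manifolds are smooth, finite-dimensional, Hausdorff and second countable. A $(1,1)$ tensor field $\Theta$ on $M$ (a smooth field of endomorphisms of the tangent spaces) is *algebraically constant* if for all $x,y\in M$ some linear isomorphism $T_xM\to T_yM$ sends $\Theta_x$ to $\Theta_y$; it is *integrable* if some smooth torsion-free connection $\nabla$ satisfies $\nabla\Theta=0$. Its Nijenhuis tensor is $N(v,w)=\Theta[\Theta v,w]+\Theta[v,\Theta w]-[\Theta v,\Theta w]-\Theta^2[v,w]$. A distribution (a smooth vector subbundle of the tangent bundle) is *integrable* if it is tangent to a foliation, that is, if around each point some coordinate chart carries it to a constant distribution. Affine-bundle construction. Let $D$ be a distribution on a manifold $\Sigma$, and let $\pi:P\to\Sigma$ be a smooth affine bundle associated with the quotient vector bundle $T\Sigma/D$, so that every fibre $P_y=\pi^{-1}(y)$ is an affine space with translation space $T_y\Sigma/D_y$. Then $P$ carries the $(1,1)$ tensor field $\Theta^P$ given by $$\Theta^P_p\,\xi=[d\pi_p\,\xi]\in T_y\Sigma/D_y=T_p(P_y)\subseteq T_pP,\qquad p\in P_y,\ \xi\in T_pP .$$ A *local realization* of a $(1,1)$ tensor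 field $\Theta$ on $M$ over an open set $U\subseteq M$ consists of $\Sigma,D,P$ as above and a diffeomorphism $\varphi$ of $U$ onto an open subset of $P$ that meets every fibre of $P$, such that $\varphi$ sends $\Theta|_U$ to $\Theta^P|_{\varphi(U)}$. Theorem. Let $\Theta$ be an algebraically constant $(1,1)$ tensor field on a manifold $M$ such that $\Theta^2=0$ and $N=0$. Then: 1. Every point of $M$ lies in a connected open set over which $\Theta$ has a local realization. 2. In every local realization of $\Theta$, over any open set $U$, the fibre dimension of $D$ equals the codimension of $\operatorname{Im}\Theta$ in $\operatorname{Ker}\Theta$, and $\Theta|_U$ is integrable if and only if the distribution $D$ is integrable. 3. For any family of local realizations of $\Theta$ over open sets covering $M$, $\Theta$ is integrable on $M$ if and only if all the corresponding distributions $D$ are integrable. -/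

import Mathlib

open scoped Manifold ContDiff Bundle

universe u v w

noncomputable section

/-- A smooth tensor field of type `(1,1)` on an `n`-dimensional manifold `M`. -/
abbrev Tensor11 (n : ℕ) (M : Type u) [TopologicalSpace M]
    [ChartedSpace (EuclideanSpace ℝ (Fin n)) M] [IsManifold (𝓡 n) ∞ M] : Type u :=
  ContMDiffSection (𝓡 n) (EuclideanSpace ℝ (Fin n) →L[ℝ] EuclideanSpace ℝ (Fin n)) ∞
    (fun x : M => TangentSpace (𝓡 n) x →L[ℝ] TangentSpace (𝓡 n) x)

/-- Smoothness of a vector field on a set. -/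
def SmoothFieldOn {n : ℕ} {M : Type u} [TopologicalSpace M]
    [ChartedSpace (EuclideanSpace ℝ (Fin n)) M] [IsManifold (𝓡 n) ∞ M]
    (X : ∀ x : M, TangentSpace (𝓡 n) x) (W : Set M) : Prop :=
  ContMDiffOn (𝓡 n) (𝓡 n).tangent ∞ (fun x => (⟨x, X x⟩ : TangentBundle (𝓡 n) M)) W

/-- Differentiability of a vector field at a point. -/
def FieldDifferentiableAt {n : ℕ} {M : Type u} [TopologicalSpace M]
    [ChartedSpace (EuclideanSpace ℝ (Fin n)) M] [IsManifold (𝓡 n) ∞ M]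
    (X : ∀ x : M, TangentSpace (𝓡 n) x) (x : M) : Prop :=
  MDifferentiableAt (𝓡 n) (𝓡 n).tangent (fun z => (⟨z, X z⟩ : TangentBundle (𝓡 n) M)) x

namespace Tensor11

variable {n : ℕ} {M : Type u} [TopologicalSpace M]
  [ChartedSpace (EuclideanSpace ℝ (Fin n)) M] [IsManifold (𝓡 n) ∞ M]

/-- Between any two tangent spaces there is a linear isomorphism sending `Θ` to `Θ`. -/
def AlgebraicallyConstant (Θ : Tensor11 n M) : Prop :=
  ∀ x y : M, ∃ A : TangentSpace (𝓡 n) x ≃ₗ[ℝ] TangentSpace (𝓡 n) y,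
    ∀ ξ : TangentSpace (𝓡 n) x, A (Θ x ξ) = Θ y (A ξ)

/-- The Nijenhuis tensor
`N(X, Y) = Θ[ΘX, Y] + Θ[X, ΘY] - [ΘX, ΘY] - Θ²[X, Y]`, evaluated on vector fields. -/
def nijenhuis (Θ : Tensor11 n M) (X Y : ∀ x : M, TangentSpace (𝓡 n) x) (x : M) :
    TangentSpace (𝓡 n) x :=
  Θ x (VectorField.mlieBracket (𝓡 n) (fun z => Θ z (X z)) Y x)
    + Θ x (VectorField.mlieBracket (𝓡 n) X (fun z => Θ z (Y z)) x)
    - VectorField.mlieBracket (𝓡 n) (fun z => Θ z (X z)) (fun z => Θ z (Y z)) x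
    - Θ x (Θ x (VectorField.mlieBracket (𝓡 n) X Y x))

/-- The Nijenhuis tensor vanishes identically. -/
def NijenhuisVanishes (Θ : Tensor11 n M) : Prop :=
  ∀ X Y : ∀ x : M, TangentSpace (𝓡 n) x,
    SmoothFieldOn X Set.univ → SmoothFieldOn Y Set.univ → ∀ x : M, Θ.nijenhuis X Y x = 0

/-- `Θ` restricted to the open set `U` is integrable: some smooth torsion-free connection on (the
tangent bundle of) `U` makes it parallel. Here `conn Y x (X x)` is `∇_X Y` at `x`. -/
def IsIntegrableOn (Θ : Tensor11 n M) (U : Set M) : Prop :=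
  ∃ conn : (∀ x : M, TangentSpace (𝓡 n) x) →
      (∀ x : M, TangentSpace (𝓡 n) x →L[ℝ] TangentSpace (𝓡 n) x),
    IsCovariantDerivativeOn (EuclideanSpace ℝ (Fin n)) conn U ∧
    ContMDiffCovariantDerivativeOn (EuclideanSpace ℝ (Fin n)) ∞ conn U ∧
    -- the torsion vanishes
    (∀ x ∈ U, ∀ X Y : ∀ z : M, TangentSpace (𝓡 n) z,
      FieldDifferentiableAt X x → FieldDifferentiableAt Y x →
        conn Y x (X x) - conn X x (Y x) = VectorField.mlieBracket (𝓡 n) X Y x) ∧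
    -- `∇Θ = 0`
    (∀ x ∈ U, ∀ Y : ∀ z : M, TangentSpace (𝓡 n) z, FieldDifferentiableAt Y x →
      ∀ ξ : TangentSpace (𝓡 n) x, conn (fun z => Θ z (Y z)) x ξ = Θ x (conn Y x ξ))

/-- `Θ` is integrable: some smooth torsion-free connection on `M` makes it parallel. -/
def IsIntegrable (Θ : Tensor11 n M) : Prop :=
  Θ.IsIntegrableOn Set.univ

/-- The codimension of `Im Θ` in `Ker Θ` at `x`, for `Θ` with `Im Θ ⊆ Ker Θ`. -/
def codimImKer (Θ : Tensor11 n M) (x : M) : ℕ :=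
  Module.finrank ℝ
    ((Θ x).toLinearMap.ker ⧸ (Θ x).toLinearMap.range.submoduleOf (Θ x).toLinearMap.ker)

end Tensor11

/-- The differential at `y` of a coordinate chart, with values in the model space. -/
def chartDifferential {E : Type} [NormedAddCommGroup E] [NormedSpace ℝ E] {B : Type v}
    [TopologicalSpace B] [ChartedSpace E B] (e : OpenPartialHomeomorph B E) (y : B) :
    TangentSpace 𝓘(ℝ, E) y →L[ℝ] E :=
  mfderiv 𝓘(ℝ, E) 𝓘(ℝ, E) e y

/-- A (smooth) distribution on `B`: a vector subbundle of the tangent bundle, that is, a family of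
subspaces having, near each point, a basis of smooth vector fields. -/
structure SmoothDistribution (m : ℕ) (B : Type v) [TopologicalSpace B]
    [ChartedSpace (EuclideanSpace ℝ (Fin m)) B] [IsManifold (𝓡 m) ∞ B] where
  space : ∀ y : B, Submodule ℝ (TangentSpace (𝓡 m) y)
  exists_local_frame : ∀ y₀ : B, ∃ (k : ℕ) (W : Set B)
    (X : Fin k → ∀ y : B, TangentSpace (𝓡 m) y), IsOpen W ∧ y₀ ∈ W ∧
      (∀ i, SmoothFieldOn (X i) W) ∧
      ∀ y ∈ W, LinearIndependent ℝ (fun i => X i y) ∧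
        Submodule.span ℝ (Set.range fun i => X i y) = space y

namespace SmoothDistribution

variable {m : ℕ} {B : Type v} [TopologicalSpace B]
  [ChartedSpace (EuclideanSpace ℝ (Fin m)) B] [IsManifold (𝓡 m) ∞ B]

/-- The fibre at `y` of the quotient bundle `TB / D`. -/
abbrev Quot (D : SmoothDistribution m B) (y : B) : Type :=
  TangentSpace (𝓡 m) y ⧸ D.space y

/-- Integrability of a distribution: around each point there is a coordinate chart carrying the
distribution to a constant one, so that it is tangent to a foliation. -/
def IsIntegrable (D : SmoothDistribution m B) : Prop :=
  ∀ y₀ : B, ∃ e ∈ IsManifold.maximalAtlas (𝓡 m) ∞ B, y₀ ∈ e.source ∧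
    ∃ F : Submodule ℝ (EuclideanSpace ℝ (Fin m)), ∀ y ∈ e.source,
      ∀ η : TangentSpace (𝓡 m) y, η ∈ D.space y ↔ chartDifferential e y η ∈ F

end SmoothDistribution

/-- An affine bundle over `B`, with `n`-dimensional total space, associated with the quotient
vector bundle `TB / D`: every fibre is an affine space with translation space `T_y B / D_y`, and
locally, over open sets `W`, a section `s` and smooth vector fields `X i` inducing a frame of
`TB / D` turn `(y, c) ↦ s y + ∑ i, c i • [X i y]` into a diffeomorphism from `W × ℝ ^ r` onto the
part of the total space lying over `W`. -/
structure AffineQuotientBundle (n : ℕ) {m : ℕ} {B : Type v} [TopologicalSpace B]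
    [ChartedSpace (EuclideanSpace ℝ (Fin m)) B] [IsManifold (𝓡 m) ∞ B]
    (D : SmoothDistribution m B) where
  Total : Type v
  [topTotal : TopologicalSpace Total]
  [chartedTotal : ChartedSpace (EuclideanSpace ℝ (Fin n)) Total]
  [manifoldTotal : IsManifold (𝓡 n) ∞ Total]
  [t2Total : T2Space Total]
  [secondCountableTotal : SecondCountableTopology Total]
  proj : Total → B
  [torsor : ∀ y : B, AddTorsor (D.Quot y) {p : Total // proj p = y}]
  locally_trivial : ∀ y₀ : B, ∃ (r : ℕ) (W : Set B) (s : ∀ y : B, {p : Total // proj p = y})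
    (X : Fin r → ∀ y : B, TangentSpace (𝓡 m) y)
    (e : OpenPartialHomeomorph Total (B × EuclideanSpace ℝ (Fin r))),
      IsOpen W ∧ y₀ ∈ W ∧
      (∀ i, SmoothFieldOn (X i) W) ∧
      (∀ y ∈ W, LinearIndependent ℝ (fun i => (D.space y).mkQ (X i y)) ∧
        Submodule.span ℝ (Set.range fun i => (D.space y).mkQ (X i y)) = ⊤) ∧
      e.source = proj ⁻¹' W ∧ e.target = W ×ˢ Set.univ ∧
      ContMDiffOn (𝓡 n) ((𝓡 m).prod (𝓡 r)) ∞ e e.source ∧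
      ContMDiffOn ((𝓡 m).prod (𝓡 r)) (𝓡 n) ∞ e.symm e.target ∧
      ∀ y ∈ W, ∀ c : EuclideanSpace ℝ (Fin r),
        e.symm (y, c) = ((∑ i, c i • (D.space y).mkQ (X i y)) +ᵥ s y : {p : Total // proj p = y})

attribute [instance] AffineQuotientBundle.topTotal AffineQuotientBundle.chartedTotal
  AffineQuotientBundle.manifoldTotal AffineQuotientBundle.t2Total
  AffineQuotientBundle.secondCountableTotal AffineQuotientBundle.torsor

namespace AffineQuotientBundle

variable {n m : ℕ} {B : Type v} [TopologicalSpace B]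
  [ChartedSpace (EuclideanSpace ℝ (Fin m)) B] [IsManifold (𝓡 m) ∞ B]
  {D : SmoothDistribution m B}

/-- The line `t ↦ p + t q` in the fibre through `p`. -/
def fibreLine (A : AffineQuotientBundle n D) (p : A.Total) (q : D.Quot (A.proj p)) (t : ℝ) :
    A.Total :=
  ((t • q) +ᵥ (⟨p, rfl⟩ : {p' : A.Total // A.proj p' = A.proj p}) :
    {p' : A.Total // A.proj p' = A.proj p})

/-- The identification of `T_y B / D_y` with the tangent space at `p` of the affine space which is
the fibre over `y = π p`: a translation vector `q` goes to the velocity at `t = 0` of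
`t ↦ p + t q`. -/
def vertical (A : AffineQuotientBundle n D) (p : A.Total) (q : D.Quot (A.proj p)) :
    TangentSpace (𝓡 n) p :=
  mfderiv 𝓘(ℝ, ℝ) (𝓡 n) (A.fibreLine p q) 0 (1 : ℝ)

/-- The canonical `(1,1)` tensor of the affine bundle: `Θ_p ξ = [dπ_p ξ] ∈ T_y B / D_y`, which is
the tangent space at `p` of the fibre over `y = π p`. -/
def tensor (A : AffineQuotientBundle n D) (p : A.Total) (ξ : TangentSpace (𝓡 n) p) :
    TangentSpace (𝓡 n) p :=
  A.vertical p ((D.space (A.proj p)).mkQ (mfderiv (𝓡 n) (𝓡 m) A.proj p ξ))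

end AffineQuotientBundle

/-- A realization, over an open set `U = φ.source` of `M`, of the tensor `Θ` through the
affine-bundle construction: a manifold `Base` with a distribution `dist`, an affine bundle over
`Base` associated with `T Base / dist`, and a diffeomorphism `φ` of `U` onto an open subset of the
total space, meeting every fibre, that sends `Θ` to the canonical tensor of the affine bundle. -/
structure LocalRealization {n : ℕ} {M : Type u} [TopologicalSpace M]
    [ChartedSpace (EuclideanSpace ℝ (Fin n)) M] [IsManifold (𝓡 n) ∞ M] (Θ : Tensor11 n M) where
  baseDim : ℕ
  Base : Type v
  [topBase : TopologicalSpace Base]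
  [chartedBase : ChartedSpace (EuclideanSpace ℝ (Fin baseDim)) Base]
  [manifoldBase : IsManifold (𝓡 baseDim) ∞ Base]
  [t2Base : T2Space Base]
  [secondCountableBase : SecondCountableTopology Base]
  dist : SmoothDistribution baseDim Base
  bundle : AffineQuotientBundle n dist
  φ : OpenPartialHomeomorph M bundle.Total
  smooth_φ : ContMDiffOn (𝓡 n) (𝓡 n) ∞ φ φ.source
  smooth_φ_symm : ContMDiffOn (𝓡 n) (𝓡 n) ∞ φ.symm φ.target
  meets_fibres : ∀ y : Base, ∃ x ∈ φ.source, bundle.proj (φ x) = y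
  map_tensor : ∀ x ∈ φ.source, ∀ ξ : TangentSpace (𝓡 n) x,
    mfderiv (𝓡 n) (𝓡 n) φ x (Θ x ξ) = bundle.tensor (φ x) (mfderiv (𝓡 n) (𝓡 n) φ x ξ)

attribute [instance] LocalRealization.topBase LocalRealization.chartedBase
  LocalRealization.manifoldBase LocalRealization.t2Base LocalRealization.secondCountableBase

end

/-!
Since `N = 0` gives `[Θ X, Θ Y] = Θ ([Θ X, Y] + [X, Θ Y])`, the distribution `Im Θ`, of constant
rank, is involutive. In coordinates `(f, e)` straightening it, `Θ² = 0` reads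
`Θ (f, e) = (0, H f)`, where `H` depends on the point, and `N = 0` says that the vertical fields
`(0, H a)`, for constant `a`, commute. Straightening some of them makes `H S = 1` for a constant
`S`; the symmetry of `∂_{H a} (H b)` in `a` and `b` then forces `H` to depend on `f` alone. This is
the tensor of a trivial affine bundle with `D = Ker H`.

Every local realization has coordinates of this form, with `H` surjective and `D = Ker H`. If a
torsion-free connection makes `Θ` parallel, the bracket of two sections of `Ker Θ` is a section of
`Ker Θ`, so `D` is involutive. Conversely, where `D` is a constant distribution, a fibrewise linear
change of the coordinate `e` makes `H`, hence `Θ`, constant, and the flat connection of the new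
coordinates works. Local connections are glued by a partition of unity, as being torsion-free and
making `Θ` parallel are affine conditions.

Commuting vector fields are straightened by the local action that they generate; its smoothness
comes from the implicit function theorem, applied to an integral equation in a space of curves.
-/

noncomputable section

open scoped Topology
open Set Filter

section CoordinateChanges

variable {V W : Type*} [NormedAddCommGroup V] [NormedSpace ℝ V] [NormedAddCommGroup W]
  [NormedSpace ℝ W]

/-- A smooth change of coordinates between open subsets of two normed spaces. -/
structure IsSmoothCoordChange (Φ : OpenPartialHomeomorph V W) : Prop where
  contDiffOn : ContDiffOn ℝ ∞ Φ Φ.source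
  contDiffOn_symm : ContDiffOn ℝ ∞ Φ.symm Φ.target

namespace IsSmoothCoordChange

variable {Φ : OpenPartialHomeomorph V W}

lemma symm (hΦ : IsSmoothCoordChange Φ) : IsSmoothCoordChange Φ.symm :=
  ⟨hΦ.contDiffOn_symm, hΦ.contDiffOn⟩

lemma hasFDerivAt (hΦ : IsSmoothCoordChange Φ) {p : V} (hp : p ∈ Φ.source) :
    HasFDerivAt Φ (fderiv ℝ Φ p) p :=
  ((hΦ.contDiffOn.contDiffAt (Φ.open_source.mem_nhds hp)).differentiableAt (by simp)).hasFDerivAt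

lemma fderiv_symm_comp_fderiv (hΦ : IsSmoothCoordChange Φ) {p : V} (hp : p ∈ Φ.source) :
    (fderiv ℝ Φ.symm (Φ p)).comp (fderiv ℝ Φ p) = ContinuousLinearMap.id ℝ V := by
  have hsymm := hΦ.symm.hasFDerivAt (Φ.map_source hp)
  have hid : Φ.symm ∘ Φ =ᶠ[𝓝 p] id := by
    filter_upwards [Φ.open_source.mem_nhds hp] with w hw using Φ.left_inv hw
  exact (hsymm.comp p (hΦ.hasFDerivAt hp)).unique ((hasFDerivAt_id p).congr_of_eventuallyEq hid)

lemma fderiv_symm_fderiv_apply (hΦ : IsSmoothCoordChange Φ) {p : V} (hp : p ∈ Φ.source) (v : V) :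
    fderiv ℝ Φ.symm (Φ p) (fderiv ℝ Φ p v) = v :=
  congrArg (fun A : V →L[ℝ] V => A v) (hΦ.fderiv_symm_comp_fderiv hp)

lemma fderiv_injective (hΦ : IsSmoothCoordChange Φ) {p : V} (hp : p ∈ Φ.source) :
    Function.Injective (fderiv ℝ Φ p) :=
  Function.LeftInverse.injective (hΦ.fderiv_symm_fderiv_apply hp)

end IsSmoothCoordChange

lemma exists_isSmoothCoordChange_of_hasFDerivAt [CompleteSpace V] {f : V → W} {s : Set V}
    (hs : IsOpen s) {x : V} (hx : x ∈ s) (hf : ContDiffOn ℝ ∞ f s) (f' : V ≃L[ℝ] W)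
    (hf' : HasFDerivAt f (f' : V →L[ℝ] W) x) :
    ∃ Φ : OpenPartialHomeomorph V W, IsSmoothCoordChange Φ ∧ x ∈ Φ.source ∧ Φ.source ⊆ s ∧
      ∀ y, Φ y = f y := by
  have hfx : ContDiffAt ℝ ∞ f x := hf.contDiffAt (hs.mem_nhds hx)
  let Φ₀ := hfx.toOpenPartialHomeomorph f hf' (by simp)
  let t : Set V := s ∩ fderiv ℝ f ⁻¹' range ((↑) : (V ≃L[ℝ] W) → V →L[ℝ] W)
  have ht : IsOpen t := (hf.continuousOn_fderiv_of_isOpen hs (by simp)).isOpen_inter_preimage hs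
    ContinuousLinearEquiv.isOpen
  let Φ := Φ₀.restrOpen t ht
  have hΦs : ∀ y ∈ Φ.source, y ∈ s := fun y hy => hy.2.1
  refine ⟨Φ, ⟨hf.mono hΦs, fun w hw => ?_⟩,
    ⟨hfx.mem_toOpenPartialHomeomorph_source hf' (by simp), hx, f', hf'.fderiv.symm⟩, hΦs,
    fun y => rfl⟩
  obtain ⟨-, hys, e, he⟩ := Φ.map_target hw
  have hfy : ContDiffAt ℝ ∞ f (Φ.symm w) := hf.contDiffAt (hs.mem_nhds hys)
  have hfe : HasFDerivAt f (e : V →L[ℝ] W) (Φ.symm w) :=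
    he ▸ (hfy.differentiableAt (by simp)).hasFDerivAt
  exact (Φ.contDiffAt_symm hw hfe hfy).contDiffWithinAt

lemma exists_contDiffOn_implicitFunction {F : Type*} [NormedAddCommGroup F] [NormedSpace ℝ F]
    [CompleteSpace V] [CompleteSpace W] {G : V × W → F} {s : Set (V × W)} (hs : IsOpen s)
    (hG : ContDiffOn ℝ ∞ G s) {x : V × W} (hx : x ∈ s) (A : V →L[ℝ] F) (e : W ≃L[ℝ] F)
    (hG' : HasFDerivAt G (A.coprod (e : W →L[ℝ] F)) x) :
    ∃ (g : V → W) (O : Set V), IsOpen O ∧ x.1 ∈ O ∧ ContDiffOn ℝ ∞ g O ∧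
      ∀ v ∈ O, (v, g v) ∈ s ∧ G (v, g v) = G x := by
  let Ψ' : (V × W) ≃L[ℝ] V × F := ContinuousLinearEquiv.equivOfInverse
    ((ContinuousLinearMap.fst ℝ V W).prod (A.coprod (e : W →L[ℝ] F)))
    ((ContinuousLinearMap.fst ℝ V F).prod ((e.symm : F →L[ℝ] W).comp
      (ContinuousLinearMap.snd ℝ V F - A.comp (ContinuousLinearMap.fst ℝ V F))))
    (fun x => by simp) (fun x => by simp)
  obtain ⟨Φ, hΦ, hxΦ, hΦs, hΦG⟩ := exists_isSmoothCoordChange_of_hasFDerivAt hs hx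
    (contDiffOn_fst.prodMk hG) Ψ' (hasFDerivAt_fst.prodMk hG')
  let b : V → V × F := fun v => (v, G x)
  have hb : ContDiff ℝ ∞ b := contDiff_prodMk_left (G x)
  refine ⟨fun v => (Φ.symm (b v)).2, b ⁻¹' Φ.target, Φ.open_target.preimage hb.continuous, ?_,
    contDiff_snd.comp_contDiffOn (hΦ.contDiffOn_symm.comp hb.contDiffOn fun v hv => hv),
    fun v hv => ?_⟩
  · rw [mem_preimage, show b x.1 = Φ x from (hΦG x).symm]
    exact Φ.map_source hxΦ
  · have hinv : ((Φ.symm (b v)).1, G (Φ.symm (b v))) = b v := by rw [← hΦG, Φ.right_inv hv]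
    have hpair : Φ.symm (b v) = (v, (Φ.symm (b v)).2) :=
      Prod.ext (congrArg (fun y : V × F => y.1) hinv) rfl
    rw [← hpair]
    exact ⟨hΦs (Φ.map_target hv), congrArg Prod.snd hinv⟩

end CoordinateChanges

section CurveSpace

variable {X : Type*} [TopologicalSpace X]

/-- The pairing of a constant vector with a continuous function. -/
def constPair (X E V : Type*) [TopologicalSpace X] [NormedAddCommGroup E] [NormedSpace ℝ E]
    [NormedAddCommGroup V] [NormedSpace ℝ V] : E × C(X, V) →L[ℝ] C(X, E × V) :=
  ((ContinuousLinearMap.inl ℝ E V).compLeftContinuous ℝ X ∘L ContinuousLinearMap.const ℝ X) ∘L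
      ContinuousLinearMap.fst ℝ E C(X, V)
    + (ContinuousLinearMap.inr ℝ E V).compLeftContinuous ℝ X ∘L
      ContinuousLinearMap.snd ℝ E C(X, V)

@[simp]
lemma constPair_apply {E V : Type*} [NormedAddCommGroup E] [NormedSpace ℝ E]
    [NormedAddCommGroup V] [NormedSpace ℝ V] (q : E × C(X, V)) (x : X) :
    constPair X E V q x = (q.1, q.2 x) := by
  simp [constPair]

variable [CompactSpace X]

-- Without this shortcut the instance search exceeds the default heartbeat limit.
local instance {V W : Type*} [NormedAddCommGroup V] [NormedSpace ℝ V] [NormedAddCommGroup W]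
    [NormedSpace ℝ W] : NormedAddCommGroup C(X, V →L[ℝ] W) :=
  ContinuousMap.instNormedAddCommGroup

/-- Pointwise application `(A, β) ↦ (x ↦ A x (β x))` on spaces of continuous functions, as a
bounded bilinear map. It is the derivative of composition, see `hasFDerivAt_comp_left`. -/
def pointwiseApply (X V W : Type*) [TopologicalSpace X] [CompactSpace X] [NormedAddCommGroup V]
    [NormedSpace ℝ V] [NormedAddCommGroup W] [NormedSpace ℝ W] :
    C(X, V →L[ℝ] W) →L[ℝ] C(X, V) →L[ℝ] C(X, W) :=
  LinearMap.mkContinuous₂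
    (LinearMap.mk₂ ℝ (fun (A : C(X, V →L[ℝ] W)) (β : C(X, V)) =>
        (⟨fun x => A x (β x), A.continuous.clm_apply β.continuous⟩ : C(X, W)))
      (fun A A' β => by ext; simp) (fun c A β => by ext; simp)
      (fun A β β' => by ext; simp) (fun c A β => by ext; simp)) 1
    (fun A β => by
      refine (ContinuousMap.norm_le _ (by positivity)).2 fun x => ?_
      rw [one_mul]
      exact (A x).le_of_opNorm_le_of_le (A.norm_coe_le_norm x) (β.norm_coe_le_norm x))

lemma hasFDerivAt_comp_left {V W : Type*} [NormedAddCommGroup V] [NormedSpace ℝ V]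
    [NormedAddCommGroup W] [NormedSpace ℝ W] (f : C(V, W)) (f' : C(V, V →L[ℝ] W))
    (hf : ∀ v, HasFDerivAt f (f' v) v) (α : C(X, V)) :
    HasFDerivAt (fun α : C(X, V) => f.comp α) (pointwiseApply X V W (f'.comp α)) α := by
  rw [hasFDerivAt_iff_isLittleO_nhds_zero, Asymptotics.isLittleO_iff]
  intro ε hε
  obtain ⟨δ, hδ, hδε⟩ := (Metric.continuousAt_iff (α := C(X, V)) (β := C(X, V →L[ℝ] W))
    (f := fun β => f'.comp β) (a := α)).1 f'.continuous_postcomp.continuousAt ε hε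
  filter_upwards [Metric.ball_mem_nhds (0 : C(X, V)) hδ] with β hβ
  rw [mem_ball_zero_iff] at hβ
  refine (ContinuousMap.norm_le _ (by positivity)).2 fun x => ?_
  have hosc : ∀ v ∈ segment ℝ (α x) (α x + β x), ‖f' v - f' (α x)‖ ≤ ε := by
    rw [segment_eq_image']
    rintro _ ⟨s, hs, rfl⟩
    have hdist : dist (α + s • β) α < δ := by
      rw [dist_eq_norm, add_sub_cancel_left, norm_smul, Real.norm_of_nonneg hs.1]
      exact lt_of_le_of_lt (mul_le_of_le_one_left (norm_nonneg _) hs.2) hβ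
    simpa using ((f'.comp (α + s • β) - f'.comp α).norm_coe_le_norm x).trans
      ((dist_eq_norm _ _).symm.trans_le (hδε hdist).le)
  have hmean := Convex.norm_image_sub_le_of_norm_hasFDerivWithin_le' (𝕜 := ℝ) (f := f) (f' := f')
    (φ := f' (α x)) (fun v _ => (hf v).hasFDerivWithinAt) hosc (convex_segment _ _)
    (left_mem_segment ℝ _ _) (right_mem_segment ℝ _ _)
  rw [add_sub_cancel_left] at hmean
  exact hmean.trans (mul_le_mul_of_nonneg_left (β.norm_coe_le_norm x) hε.le)

lemma contDiff_comp_left {V W : Type u} [NormedAddCommGroup V] [NormedSpace ℝ V]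
    [NormedAddCommGroup W] [NormedSpace ℝ W] (n : ℕ) (f : C(V, W)) (hf : ContDiff ℝ n f) :
    ContDiff ℝ n (fun α : C(X, V) => f.comp α) := by
  induction n generalizing W with
  | zero => exact contDiff_zero.2 f.continuous_postcomp
  | succ n ih =>
    rw [Nat.cast_succ, contDiff_succ_iff_fderiv] at hf ⊢
    obtain ⟨hdiff, -, hderiv⟩ := hf
    let f' : C(V, V →L[ℝ] W) := ⟨fderiv ℝ f, hderiv.continuous⟩
    have hcomp : ∀ α : C(X, V),
        HasFDerivAt (fun α : C(X, V) => f.comp α) (pointwiseApply X V W (f'.comp α)) α :=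
      hasFDerivAt_comp_left f f' fun v => (hdiff v).hasFDerivAt
    refine ⟨fun α => (hcomp α).differentiableAt, by simp, ?_⟩
    rw [funext fun α => (hcomp α).fderiv]
    exact (pointwiseApply X V W).contDiff.comp (ih f' hderiv)

end CurveSpace

section Primitive

lemma intervalIntegrable_IccExtend {V : Type*} [NormedAddCommGroup V] (α : C(unitInterval, V))
    (a b : ℝ) : IntervalIntegrable (IccExtend zero_le_one α) MeasureTheory.volume a b :=
  (α.continuous.Icc_extend' (h := zero_le_one)).intervalIntegrable a b

variable {V : Type*} [NormedAddCommGroup V] [NormedSpace ℝ V]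

/-- The primitive vanishing at `0` of a continuous curve parametrized by the unit interval. -/
def primitive (V : Type*) [NormedAddCommGroup V] [NormedSpace ℝ V] :
    C(unitInterval, V) →L[ℝ] C(unitInterval, V) :=
  LinearMap.mkContinuous
    { toFun := fun α => ⟨fun t => ∫ s in (0 : ℝ)..t, IccExtend zero_le_one α s,
        (intervalIntegral.continuous_primitive (intervalIntegrable_IccExtend α) 0).comp
          continuous_subtype_val⟩
      map_add' := fun α β => by
        ext t
        simpa [IccExtend, Function.comp_def] using intervalIntegral.integral_add
          (intervalIntegrable_IccExtend α 0 t) (intervalIntegrable_IccExtend β 0 t)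
      map_smul' := fun c α => by
        ext t
        simp [IccExtend] } 1
    (fun α => by
      rw [one_mul]
      refine (ContinuousMap.norm_le _ (norm_nonneg _)).2 fun t => ?_
      refine (intervalIntegral.norm_integral_le_of_norm_le_const
        fun s _ => α.norm_coe_le_norm _).trans ?_
      rw [sub_zero, abs_of_nonneg t.2.1]
      exact mul_le_of_le_one_right (norm_nonneg _) t.2.2)

lemma primitive_apply (α : C(unitInterval, V)) (t : unitInterval) :
    primitive V α t = ∫ s in (0 : ℝ)..t, IccExtend zero_le_one α s := rfl

lemma norm_primitive_apply_le (α : C(unitInterval, V)) : ‖primitive V α‖ ≤ ‖α‖ := by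
  simpa using (primitive V).le_of_opNorm_le (LinearMap.mkContinuous_norm_le _ zero_le_one _) α

lemma hasDerivAt_integral_IccExtend [CompleteSpace V] (β : C(unitInterval, V)) (t : ℝ) :
    HasDerivAt (fun t : ℝ => ∫ s in (0 : ℝ)..t, IccExtend zero_le_one β s)
      (IccExtend zero_le_one β t) t :=
  have hβ := β.continuous.Icc_extend' (h := zero_le_one)
  intervalIntegral.integral_hasDerivAt_right (hβ.intervalIntegrable _ _)
    (hβ.stronglyMeasurableAtFilter _ _) hβ.continuousAt

lemma primitive_apply_eq_sub_of_hasDerivAt [CompleteSpace V] (g : ℝ → V) (β : C(unitInterval, V))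
    (hg : ∀ t : unitInterval, HasDerivAt g (β t) t) (t : unitInterval) :
    primitive V β t = g t - g 0 := by
  rw [primitive_apply]
  refine intervalIntegral.integral_eq_sub_of_hasDerivAt (fun s hs => ?_)
    (intervalIntegrable_IccExtend β 0 t)
  rw [uIcc_of_le t.2.1] at hs
  have hsI : s ∈ Icc (0 : ℝ) 1 := ⟨hs.1, hs.2.trans t.2.2⟩
  rw [IccExtend_of_mem _ _ hsI]
  exact hg ⟨s, hsI⟩

end Primitive

section LocalAction

variable {E V : Type u} [NormedAddCommGroup E] [NormedSpace ℝ E] [NormedAddCommGroup V]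
  [NormedSpace ℝ V]

/-- The velocity `t ↦ L (α t) h` prescribed along a curve `α`, as a map on the space of pairs
`(h, α)`. -/
def velocityMap (L : V → E →L[ℝ] V) (hL : Continuous L) (q : E × C(unitInterval, V)) :
    C(unitInterval, V) :=
  (⟨fun r : E × V => L r.2 r.1, (hL.comp continuous_snd).clm_apply continuous_fst⟩ :
    C(E × V, V)).comp (constPair unitInterval E V q)

@[simp]
lemma velocityMap_apply (L : V → E →L[ℝ] V) (hL : Continuous L) (q : E × C(unitInterval, V))
    (t : unitInterval) : velocityMap L hL q t = L (q.2 t) q.1 := by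
  simp [velocityMap]

lemma contDiff_velocityMap {L : V → E →L[ℝ] V} (hL : ContDiff ℝ ∞ L) :
    ContDiff ℝ ∞ (velocityMap L hL.continuous) := by
  rw [contDiff_infty]
  intro n
  refine (contDiff_comp_left n _ ?_).comp (constPair unitInterval E V).contDiff
  exact ((hL.of_le (by exact_mod_cast le_top)).comp contDiff_snd).clm_apply contDiff_fst

lemma hasFDerivAt_velocityMap {L : V → E →L[ℝ] V} (hL : ContDiff ℝ ∞ L)
    (q : E × C(unitInterval, V)) :
    HasFDerivAt (velocityMap L hL.continuous) (fderiv ℝ (velocityMap L hL.continuous) q) q :=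
  ((contDiff_velocityMap hL).differentiable (by simp) q).hasFDerivAt

lemma fderiv_velocityMap_apply {L : V → E →L[ℝ] V} (hL : ContDiff ℝ ∞ L)
    (q r : E × C(unitInterval, V)) (t : unitInterval) :
    fderiv ℝ (velocityMap L hL.continuous) q r t
      = fderiv ℝ L (q.2 t) (r.2 t) q.1 + L (q.2 t) r.1 := by
  let ev : C(unitInterval, V) →L[ℝ] V := ContinuousMap.evalCLM ℝ t
  have hev : HasFDerivAt (fun q => velocityMap L hL.continuous q t)
      (ev.comp (fderiv ℝ (velocityMap L hL.continuous) q)) q :=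
    ev.hasFDerivAt.comp q (hasFDerivAt_velocityMap hL q)
  have hL' : HasFDerivAt (fun q : E × C(unitInterval, V) => L (q.2 t)) _ q :=
    HasFDerivAt.comp (f := fun q : E × C(unitInterval, V) => q.2 t) q
      (hL.differentiable (by simp) (q.2 t)).hasFDerivAt
      (ev.comp (ContinuousLinearMap.snd ℝ E C(unitInterval, V))).hasFDerivAt
  simp only [velocityMap_apply] at hev
  have happly := DFunLike.congr_fun (hev.unique (hL'.clm_apply hasFDerivAt_fst)) r
  simp only [ContinuousLinearMap.comp_apply, add_apply, ContinuousLinearMap.flip_apply] at happly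
  exact happly.trans (add_comm _ _)

lemma fderiv_velocityMap_const {L : V → E →L[ℝ] V} (hL : ContDiff ℝ ∞ L) (p : V) :
    fderiv ℝ (velocityMap L hL.continuous) (0, ContinuousLinearMap.const ℝ unitInterval p)
      = ((ContinuousLinearMap.const ℝ unitInterval).comp (L p)).comp
        (ContinuousLinearMap.fst ℝ E C(unitInterval, V)) := by
  ext r t
  all_goals rw [ContinuousLinearMap.comp_apply, fderiv_velocityMap_apply hL]; simp

/-- The integral form of the initial value problem `α' = L (α) h`, `α 0 = p` on the unit interval,
for the data `q = (h, p)`. -/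
def SolvesIntegralEq (L : V → E →L[ℝ] V) (hL : Continuous L) (q : E × V)
    (α : C(unitInterval, V)) : Prop :=
  α = ContinuousLinearMap.const ℝ unitInterval q.2 + primitive V (velocityMap L hL (q.1, α))

namespace SolvesIntegralEq

variable {L : V → E →L[ℝ] V} {hL : Continuous L} {q : E × V} {α : C(unitInterval, V)}

lemma apply (hα : SolvesIntegralEq L hL q α) (t : unitInterval) :
    α t = q.2 + ∫ s in (0 : ℝ)..t, IccExtend zero_le_one (velocityMap L hL (q.1, α)) s := by
  conv_lhs => rw [hα]
  rfl

lemma apply_of_fst_eq_zero {p : V} (hα : SolvesIntegralEq L hL (0, p) α) (t : unitInterval) :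
    α t = p := by
  have hzero : velocityMap L hL (0, α) = 0 := by ext t; simp
  rw [hα.apply, hzero]
  simp [IccExtend]

lemma map_apply_one [CompleteSpace V] {W : Type*} [NormedAddCommGroup W] [NormedSpace ℝ W]
    [CompleteSpace W] (hα : SolvesIntegralEq L hL q α) (Q : V →L[ℝ] W) {w : W}
    (hQ : ∀ t, Q (L (α t) q.1) = w) : Q (α 1) = Q q.2 + w := by
  have hvel : ∀ s : ℝ, Q (IccExtend zero_le_one (velocityMap L hL (q.1, α)) s) = w := fun s => by
    rw [IccExtend, Function.comp_apply, velocityMap_apply]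
    exact hQ _
  rw [hα.apply, map_add, ← ContinuousLinearMap.intervalIntegral_comp_comm _
    (intervalIntegrable_IccExtend _ _ _)]
  simp [hvel]

lemma exists_linearized_solution [CompleteSpace V] {L : V → E →L[ℝ] V} (hL : ContDiff ℝ ∞ L)
    (hα : SolvesIntegralEq L hL.continuous q α)
    (hcomm : ∀ t h k, fderiv ℝ L (α t) (L (α t) h) k = fderiv ℝ L (α t) (L (α t) k) h) (k : E) :
    ∃ ρ : C(unitInterval, V), (∀ t : unitInterval, ρ t = (t : ℝ) • L (α t) k) ∧
      ρ = primitive V (fderiv ℝ (velocityMap L hL.continuous) (q.1, α) (k, ρ)) := by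
  -- For commuting fields this is the variation of `α` in the parameter direction `k`.
  let ρ : C(unitInterval, V) := ⟨fun t => (t : ℝ) • L (α t) k,
    continuous_subtype_val.smul ((hL.continuous.comp α.continuous).clm_apply continuous_const)⟩
  refine ⟨ρ, fun t => rfl, ?_⟩
  let γ : ℝ → V := fun t =>
    q.2 + ∫ s in (0 : ℝ)..t, IccExtend zero_le_one (velocityMap L hL.continuous (q.1, α)) s
  have hγα : ∀ t : unitInterval, γ t = α t := fun t => (hα.apply t).symm
  have hγ : ∀ t : unitInterval, HasDerivAt γ (L (α t) q.1) t := fun t => by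
    have := (hasDerivAt_integral_IccExtend (velocityMap L hL.continuous (q.1, α)) t).const_add q.2
    rwa [IccExtend_val, velocityMap_apply] at this
  have hLγ : ∀ t : unitInterval, HasDerivAt (fun s : ℝ => s • L (γ s) k)
      (fderiv ℝ (velocityMap L hL.continuous) (q.1, α) (k, ρ) t) t := fun t => by
    have hL' := (hL.differentiable (by simp) (γ t)).hasFDerivAt.comp_hasDerivAt (t : ℝ) (hγ t)
    refine ((hasDerivAt_id (t : ℝ)).smul (hL'.clm_apply (hasDerivAt_const (t : ℝ) k))).congr_deriv
      ?_
    rw [fderiv_velocityMap_apply hL]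
    simp [ρ, hγα, hcomm t k q.1]
  ext t
  rw [primitive_apply_eq_sub_of_hasDerivAt _ _ hLγ t]
  simp [ρ, hγα]

end SolvesIntegralEq

lemma eq_zero_of_linearized_integral_eq {L : V → E →L[ℝ] V} (hL : ContDiff ℝ ∞ L)
    {α η : C(unitInterval, V)} {h : E} {K : ℝ} (hK : ∀ t, ‖fderiv ℝ L (α t)‖ ≤ K)
    (hKh : K * ‖h‖ < 1)
    (hη : η = primitive V (fderiv ℝ (velocityMap L hL.continuous) (h, α) (0, η))) : η = 0 := by
  have hK0 : 0 ≤ K := (norm_nonneg (fderiv ℝ L (α 0))).trans (hK 0)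
  have hvel : ‖fderiv ℝ (velocityMap L hL.continuous) (h, α) (0, η)‖ ≤ K * ‖h‖ * ‖η‖ := by
    refine (ContinuousMap.norm_le _ (by positivity)).2 fun t => ?_
    rw [fderiv_velocityMap_apply hL, map_zero, add_zero]
    calc ‖fderiv ℝ L (α t) (η t) h‖ ≤ ‖fderiv ℝ L (α t)‖ * ‖η t‖ * ‖h‖ :=
          ContinuousLinearMap.le_opNorm₂ _ _ _
      _ ≤ K * ‖η‖ * ‖h‖ := by gcongr; exacts [hK t, η.norm_coe_le_norm t]
      _ = K * ‖h‖ * ‖η‖ := by ring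
  have hcontr : ‖η‖ ≤ K * ‖h‖ * ‖η‖ := by
    conv_lhs => rw [hη]
    exact (norm_primitive_apply_le _).trans hvel
  by_contra hne
  nlinarith [norm_pos_iff.2 hne]

lemma fderiv_apply_inl_of_solvesIntegralEq {L : V → E →L[ℝ] V} (hL : ContDiff ℝ ∞ L)
    {α : E × V → C(unitInterval, V)} {q : E × V} (hα : DifferentiableAt ℝ α q)
    (hsol : ∀ᶠ r in 𝓝 q, SolvesIntegralEq L hL.continuous r (α r)) (k : E) :
    fderiv ℝ α q (k, 0) = primitive V
      (fderiv ℝ (velocityMap L hL.continuous) (q.1, α q) (k, fderiv ℝ α q (k, 0))) := by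
  have hT := hasFDerivAt_velocityMap hL
  simp only [SolvesIntegralEq] at hsol
  generalize velocityMap L hL.continuous = T at *
  have hTα : HasFDerivAt (fun r : E × V => T (r.1, α r)) _ q :=
    (hT (q.1, α q)).comp (f := fun r : E × V => (r.1, α r)) q
      (hasFDerivAt_fst.prodMk hα.hasFDerivAt)
  have hrhs : HasFDerivAt (fun r : E × V => ContinuousLinearMap.const ℝ unitInterval r.2 +
      primitive V (T (r.1, α r))) _ q :=
    ((ContinuousLinearMap.const ℝ unitInterval (M := V)).hasFDerivAt.comp q hasFDerivAt_snd).add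
      ((primitive V).hasFDerivAt.comp q hTα)
  simpa using DFunLike.congr_fun
    (hα.hasFDerivAt.unique (hrhs.congr_of_eventuallyEq hsol)) ((k, 0) : E × V)

lemma exists_contDiffOn_solvesIntegralEq [CompleteSpace E] [CompleteSpace V]
    {L : V → E →L[ℝ] V} (hL : ContDiff ℝ ∞ L) {p₀ : V} {s : Set ((E × V) × C(unitInterval, V))}
    (hs : IsOpen s) (hp₀ : ((0, p₀), ContinuousLinearMap.const ℝ unitInterval p₀) ∈ s) :
    ∃ (α : E × V → C(unitInterval, V)) (O : Set (E × V)), IsOpen O ∧ (0, p₀) ∈ O ∧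
      ContDiffOn ℝ ∞ α O ∧
      ∀ q ∈ O, (q, α q) ∈ s ∧ SolvesIntegralEq L hL.continuous q (α q) := by
  let cst : V →L[ℝ] C(unitInterval, V) := ContinuousLinearMap.const ℝ unitInterval
  let T := velocityMap L hL.continuous
  let x₀ : (E × V) × C(unitInterval, V) := ((0, p₀), cst p₀)
  let pr : (E × V) × C(unitInterval, V) →L[ℝ] E × C(unitInterval, V) :=
    (ContinuousLinearMap.fst ℝ E V).prodMap (ContinuousLinearMap.id ℝ C(unitInterval, V))
  let ini : (E × V) × C(unitInterval, V) →L[ℝ] C(unitInterval, V) :=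
    (cst.comp (ContinuousLinearMap.snd ℝ E V)).comp (ContinuousLinearMap.fst ℝ _ _)
  let G : (E × V) × C(unitInterval, V) → C(unitInterval, V) :=
    fun x => x.2 - ini x - primitive V (T (pr x))
  have hG : ContDiff ℝ ∞ G := (contDiff_snd.sub ini.contDiff).sub
    ((primitive V).contDiff.comp ((contDiff_velocityMap hL).comp pr.contDiff))
  have hG' : HasFDerivAt G _ x₀ := (hasFDerivAt_snd.sub ini.hasFDerivAt).sub
    ((primitive V).hasFDerivAt.comp x₀ ((hasFDerivAt_velocityMap hL (pr x₀)).comp x₀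
      pr.hasFDerivAt))
  have hpr : pr x₀ = (0, cst p₀) := rfl
  have hGx₀ : G x₀ = 0 := by
    have hT : T (0, cst p₀) = 0 := by ext t; simp [T]
    simp [G, hpr, hT, x₀, ini]
  let A : E × V →L[ℝ] C(unitInterval, V) := -(cst.comp (ContinuousLinearMap.snd ℝ E V) +
    (primitive V).comp ((cst.comp (L p₀)).comp (ContinuousLinearMap.fst ℝ E V)))
  have hGA : HasFDerivAt G (A.coprod (ContinuousLinearMap.id ℝ C(unitInterval, V))) x₀ := by
    refine hG'.congr_fderiv ?_
    rw [hpr, fderiv_velocityMap_const hL]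
    refine ContinuousLinearMap.ext fun x => ?_
    simp [A, ini, pr, cst]
    abel
  obtain ⟨α, O, hO, hpO, hα, hsol⟩ := exists_contDiffOn_implicitFunction hs hG.contDiffOn hp₀ A
    (ContinuousLinearEquiv.refl ℝ C(unitInterval, V)) hGA
  refine ⟨α, O, hO, hpO, hα, fun q hq => ⟨(hsol q hq).1, ?_⟩⟩
  have hzero := (hsol q hq).2.trans hGx₀
  simp only [G] at hzero
  rw [sub_sub, sub_eq_zero] at hzero
  exact hzero

/-- A smooth map `u` on an open set `O` of pairs `(h, p)`, with values in `Ω`, such that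
`h ↦ u (h, p)` is a local action by the fields `p ↦ L p k`. -/
structure IsLocalAction (L : V → E →L[ℝ] V) (Ω : Set V) (u : E × V → V) (O : Set (E × V)) :
    Prop where
  isOpen : IsOpen O
  contDiffOn : ContDiffOn ℝ ∞ u O
  apply_zero : ∀ p, (0, p) ∈ O → u (0, p) = p
  mapsTo : MapsTo u O Ω
  fderiv_inl : ∀ q ∈ O, ∀ k, fderiv ℝ u q (k, 0) = L (u q) k


lemma exists_isLocalAction [CompleteSpace E] [CompleteSpace V] {W : Type*} [NormedAddCommGroup W]
    [NormedSpace ℝ W] [CompleteSpace W] {L : V → E →L[ℝ] V} (hL : ContDiff ℝ ∞ L) {p₀ : V}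
    {Ω : Set V} (hΩ : IsOpen Ω) (hp₀ : p₀ ∈ Ω)
    (hcomm : ∀ p ∈ Ω, ∀ h k, fderiv ℝ L p (L p h) k = fderiv ℝ L p (L p k) h)
    (Q : V →L[ℝ] W) (hQ : ∀ p ∈ Ω, ∀ h, Q (L p h) = Q (L p₀ h)) :
    ∃ u O, IsLocalAction L Ω u O ∧ (0, p₀) ∈ O ∧ ∀ q ∈ O, Q (u q) = Q q.2 + Q (L p₀ q.1) := by
  let K := ‖fderiv ℝ L p₀‖ + 1
  have hK : IsOpen {p | ‖fderiv ℝ L p‖ < K} :=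
    isOpen_lt (hL.continuous_fderiv (by simp)).norm continuous_const
  obtain ⟨ε, hε, hεΩ⟩ := Metric.isOpen_iff.1 (hΩ.inter hK) p₀
    ⟨hp₀, show ‖fderiv ℝ L p₀‖ < K from lt_add_of_pos_right _ one_pos⟩
  let cst : C(unitInterval, V) := ContinuousLinearMap.const ℝ unitInterval p₀
  let s : Set ((E × V) × C(unitInterval, V)) := {x | dist x.2 cst < ε ∧ K * ‖x.1.1‖ < 1}
  have hs : IsOpen s :=
    (isOpen_lt (continuous_snd.dist continuous_const) continuous_const).inter
      (isOpen_lt (continuous_const.mul (continuous_fst.comp continuous_fst).norm) continuous_const)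
  have hs_apply : ∀ x ∈ s, ∀ t, x.2 t ∈ Ω ∧ ‖fderiv ℝ L (x.2 t)‖ ≤ K := fun x hx t =>
    (hεΩ ((ContinuousMap.dist_apply_le_dist (g := cst) t).trans_lt hx.1)).imp_right le_of_lt
  obtain ⟨α, O, hO, hpO, hα, hsol⟩ := exists_contDiffOn_solvesIntegralEq hL hs
    (show ((0, p₀), cst) ∈ s by simp [s, hε])
  let ev : C(unitInterval, V) →L[ℝ] V := ContinuousMap.evalCLM ℝ 1
  refine ⟨fun q => α q 1, O, ⟨hO, ev.contDiff.comp_contDiffOn hα,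
    fun p hp => (hsol _ hp).2.apply_of_fst_eq_zero 1, fun q hq => (hs_apply _ (hsol q hq).1 1).1,
    fun q hq k => ?_⟩, hpO, fun q hq =>
      (hsol q hq).2.map_apply_one Q fun t => hQ _ (hs_apply _ (hsol q hq).1 t).1 q.1⟩
  have hαq : DifferentiableAt ℝ α q := (hα.contDiffAt (hO.mem_nhds hq)).differentiableAt (by simp)
  have hfderiv := fderiv_apply_inl_of_solvesIntegralEq hL hαq
    (eventually_of_mem (hO.mem_nhds hq) fun r hr => (hsol r hr).2) k
  obtain ⟨ρ, hρ, hρeq⟩ := (hsol q hq).2.exists_linearized_solution hL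
    (fun t => hcomm _ (hs_apply _ (hsol q hq).1 t).1) k
  have hdiff : fderiv ℝ α q (k, 0) - ρ = 0 := by
    refine eq_zero_of_linearized_integral_eq hL (h := q.1) (α := α q)
      (fun t => (hs_apply _ (hsol q hq).1 t).2) (hsol q hq).1.2 ?_
    conv_lhs => rw [hfderiv, hρeq]
    rw [← map_sub, ← map_sub, Prod.mk_sub_mk, sub_self]
  have hev : HasFDerivAt (fun q => α q 1) _ q := ev.hasFDerivAt.comp q hαq.hasFDerivAt
  rw [hev.fderiv, ContinuousLinearMap.comp_apply, sub_eq_zero.1 hdiff]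
  exact (hρ 1).trans (one_smul ℝ _)

lemma IsLocalAction.hasFDerivAt {L : V → E →L[ℝ] V} {Ω : Set V} {u : E × V → V}
    {O : Set (E × V)} (hu : IsLocalAction L Ω u O) {q : E × V} (hq : q ∈ O) :
    HasFDerivAt u (fderiv ℝ u q) q :=
  ((hu.contDiffOn.contDiffAt (hu.isOpen.mem_nhds hq)).differentiableAt (by simp)).hasFDerivAt

lemma IsLocalAction.fderiv_zero_apply {L : V → E →L[ℝ] V} {Ω : Set V} {u : E × V → V}
    {O : Set (E × V)} (hu : IsLocalAction L Ω u O) {p : V} (hp : (0, p) ∈ O) (k : E) (v : V) :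
    fderiv ℝ u (0, p) (k, v) = L p k + v := by
  have hinr : HasFDerivAt (fun w => u (0, w)) _ p :=
    HasFDerivAt.comp (f := fun w => ((0 : E), w)) p (hu.hasFDerivAt hp)
      (ContinuousLinearMap.inr ℝ E V).hasFDerivAt
  have hid : (fun w => u (0, w)) =ᶠ[𝓝 p] id :=
    eventually_of_mem ((Continuous.prodMk_right (0 : E)).continuousAt.preimage_mem_nhds
      (hu.isOpen.mem_nhds hp)) hu.apply_zero
  have hv : fderiv ℝ u (0, p) (0, v) = v := DFunLike.congr_fun
    (hinr.unique ((hasFDerivAt_id p).congr_of_eventuallyEq hid)) v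
  have hk := hu.fderiv_inl _ hp k
  rw [hu.apply_zero p hp] at hk
  rw [← hk, ← hv, ← map_add, hv]
  simp

end LocalAction

section Straightening

lemma exists_contDiff_eqOn_ball {V F : Type*} [NormedAddCommGroup V] [NormedSpace ℝ V]
    [FiniteDimensional ℝ V] [NormedAddCommGroup F] [NormedSpace ℝ F] {f : V → F} {Ω : Set V}
    (hf : ContDiffOn ℝ ∞ f Ω) (hΩ : IsOpen Ω) {p₀ : V} (hp₀ : p₀ ∈ Ω) :
    ∃ (g : V → F) (ε : ℝ), 0 < ε ∧ ContDiff ℝ ∞ g ∧ Metric.ball p₀ ε ⊆ Ω ∧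
      EqOn g f (Metric.ball p₀ ε) := by
  obtain ⟨ε, hε, hεΩ⟩ := Metric.nhds_basis_closedBall.mem_iff.1 (hΩ.mem_nhds hp₀)
  let χ : ContDiffBump p₀ := ⟨ε / 2, ε, by positivity, by linarith⟩
  refine ⟨fun p => χ p • f p, ε / 2, by positivity, contDiff_iff_contDiffAt.2 fun p => ?_,
    (Metric.ball_subset_closedBall.trans
      (Metric.closedBall_subset_closedBall (by linarith))).trans hεΩ,
    fun p hp => by simp [χ.one_of_mem_closedBall (Metric.ball_subset_closedBall hp)]⟩
  by_cases hp : p ∈ Ω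
  · exact χ.contDiffAt.smul (hf.contDiffAt (hΩ.mem_nhds hp))
  · have hpχ : p ∉ tsupport χ := fun h => hp (hεΩ (χ.tsupport_eq ▸ h))
    refine (contDiffAt_const (c := (0 : F))).congr_of_eventuallyEq ?_
    filter_upwards [notMem_tsupport_iff_eventuallyEq.1 hpχ] with q hq
    simp [hq]

variable {E V : Type u} [NormedAddCommGroup E] [NormedSpace ℝ E] [NormedAddCommGroup V]
  [NormedSpace ℝ V] {W : Type*} [NormedAddCommGroup W] [NormedSpace ℝ W]
  {L : V → E →L[ℝ] V} {Ω : Set V} {p₀ : V} {P : V →L[ℝ] E}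

lemma exists_isSmoothCoordChange_of_isLocalAction [CompleteSpace V] {u : E × V → V}
    {O : Set (E × V)} (hu : IsLocalAction L Ω u O) (hp₀ : (0, p₀) ∈ O)
    (hP : ∀ h, P (L p₀ h) = h) :
    ∃ Φ : OpenPartialHomeomorph V V, IsSmoothCoordChange Φ ∧ p₀ ∈ Φ.source ∧ Φ.source ⊆ Ω ∧
      Φ p₀ = p₀ ∧ (∀ p ∈ Φ.source, ∀ h, fderiv ℝ Φ p (L p h) = L p₀ h) ∧
      ∀ p ∈ Φ.source, ∃ q ∈ O, u q = p ∧ q.2 + L p₀ q.1 = Φ p := by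
  -- `w = p₀ + (w - p₀)` is split into a group parameter and a point of a slice through `p₀`.
  let B : V →L[ℝ] E × V := P.prod (ContinuousLinearMap.id ℝ V - (L p₀).comp P)
  let b : V → E × V := fun w => B (w - p₀) + (0, p₀)
  have hB_add (v : V) : L p₀ (B v).1 + (B v).2 = v := by simp [B]
  have hB_apply (h : E) : B (L p₀ h) = (h, 0) := by simp [B, hP]
  have hb (w : V) : HasFDerivAt b B w :=
    (B.hasFDerivAt.comp w ((hasFDerivAt_id w).sub_const p₀)).add_const _
  have hbsmooth : ContDiff ℝ ∞ b :=
    (B.contDiff.comp (contDiff_id.sub contDiff_const)).add contDiff_const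
  have hb₀ : b p₀ = (0, p₀) := by simp [b]
  have hb₀O : p₀ ∈ b ⁻¹' O := by rwa [mem_preimage, hb₀]
  have hub (w : V) (hw : w ∈ b ⁻¹' O) : HasFDerivAt (u ∘ b) ((fderiv ℝ u (b w)).comp B) w :=
    (hu.hasFDerivAt hw).comp w (hb w)
  have hub₀ : HasFDerivAt (u ∘ b)
      ((ContinuousLinearEquiv.refl ℝ V : V ≃L[ℝ] V) : V →L[ℝ] V) p₀ := by
    refine (hub p₀ hb₀O).congr_fderiv (ContinuousLinearMap.ext fun v => ?_)
    rw [ContinuousLinearMap.comp_apply, hb₀, hu.fderiv_zero_apply hp₀, hB_add]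
    rfl
  obtain ⟨Ψ, hΨ, hpΨ, hΨO, hΨu⟩ := exists_isSmoothCoordChange_of_hasFDerivAt
    (hu.isOpen.preimage hbsmooth.continuous) hb₀O (hu.contDiffOn.comp hbsmooth.contDiffOn
      fun w hw => hw) _ hub₀
  have hΨp₀ : Ψ p₀ = p₀ := by rw [hΨu, Function.comp_apply, hb₀, hu.apply_zero p₀ hp₀]
  have hsymm (p : V) (hp : p ∈ Ψ.target) : b (Ψ.symm p) ∈ O ∧ u (b (Ψ.symm p)) = p :=
    ⟨hΨO (Ψ.map_target hp), (hΨu _).symm.trans (Ψ.right_inv hp)⟩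
  refine ⟨Ψ.symm, hΨ.symm, ?_, fun p hp => ?_, ?_, fun p hp h => ?_, fun p hp =>
    ⟨b (Ψ.symm p), (hsymm p hp).1, (hsymm p hp).2, ?_⟩⟩
  · simpa [hΨp₀] using Ψ.map_source hpΨ
  · exact (hsymm p hp).2 ▸ hu.mapsTo (hsymm p hp).1
  · simpa [hΨp₀] using Ψ.left_inv hpΨ
  · have hΨ' : fderiv ℝ Ψ (Ψ.symm p) (L p₀ h) = L p h := by
      rw [((hub _ (hsymm p hp).1).congr_of_eventuallyEq (.of_forall hΨu)).fderiv,
        ContinuousLinearMap.comp_apply, hB_apply, hu.fderiv_inl _ (hsymm p hp).1,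
        (hsymm p hp).2]
    simpa [Ψ.right_inv hp, hΨ'] using hΨ.fderiv_symm_fderiv_apply (Ψ.map_target hp) (L p₀ h)
  · simp [b, B]; abel

lemma exists_straightening [CompleteSpace E] [FiniteDimensional ℝ V] [CompleteSpace W]
    (hL : ContDiffOn ℝ ∞ L Ω) (hΩ : IsOpen Ω) (hp₀ : p₀ ∈ Ω)
    (hcomm : ∀ p ∈ Ω, ∀ h k, fderiv ℝ L p (L p h) k = fderiv ℝ L p (L p k) h)
    (hP : ∀ h, P (L p₀ h) = h) (Q : V →L[ℝ] W) (hQ : ∀ p ∈ Ω, ∀ h, Q (L p h) = Q (L p₀ h)) :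
    ∃ Φ : OpenPartialHomeomorph V V, IsSmoothCoordChange Φ ∧ p₀ ∈ Φ.source ∧ Φ.source ⊆ Ω ∧
      Φ p₀ = p₀ ∧ (∀ p ∈ Φ.source, ∀ h, fderiv ℝ Φ p (L p h) = L p₀ h) ∧
      ∀ p ∈ Φ.source, Q (Φ p) = Q p := by
  have : CompleteSpace V := FiniteDimensional.complete ℝ V
  obtain ⟨L', ε, hε, hL', hεΩ, hLL'⟩ := exists_contDiff_eqOn_ball hL hΩ hp₀
  have hp₀ε : p₀ ∈ Metric.ball p₀ ε := Metric.mem_ball_self hε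
  have hL'₀ : L' p₀ = L p₀ := hLL' hp₀ε
  have hfderiv : ∀ p ∈ Metric.ball p₀ ε, fderiv ℝ L' p = fderiv ℝ L p := fun p hp =>
    (hLL'.eventuallyEq_of_mem (Metric.isOpen_ball.mem_nhds hp)).fderiv_eq
  obtain ⟨u, O, hu, hpO, huQ⟩ := exists_isLocalAction hL' Metric.isOpen_ball hp₀ε
    (fun p hp h k => by rw [hfderiv p hp, hLL' hp]; exact hcomm p (hεΩ hp) h k) Q
    (fun p hp h => by rw [hLL' hp, hL'₀]; exact hQ p (hεΩ hp) h)
  obtain ⟨Φ, hΦ, hpΦ, hΦε, hΦp₀, hΦL, hΦu⟩ :=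
    exists_isSmoothCoordChange_of_isLocalAction hu hpO (P := P) (by rwa [hL'₀])
  refine ⟨Φ, hΦ, hpΦ, hΦε.trans hεΩ, hΦp₀, fun p hp h => ?_, fun p hp => ?_⟩
  · rw [← hLL' (hΦε hp), ← hL'₀, hΦL p hp]
  · obtain ⟨q, hq, rfl, hqΦ⟩ := hΦu p hp
    rw [huQ q hq, ← hqΦ, map_add]

end Straightening

section Frames

variable {X V E : Type*} [NormedAddCommGroup X] [NormedSpace ℝ X] [NormedAddCommGroup V]
  [NormedSpace ℝ V] [NormedAddCommGroup E] [NormedSpace ℝ E] {Ω : Set X} {x₀ : X}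

lemma exists_contDiffOn_inverse [CompleteSpace E] {A : X → E →L[ℝ] V} (hA : ContDiffOn ℝ ∞ A Ω)
    (hΩ : IsOpen Ω) (hx₀ : x₀ ∈ Ω) (hA₀ : (A x₀).IsInvertible) :
    ∃ Ω' ⊆ Ω, IsOpen Ω' ∧ x₀ ∈ Ω' ∧ ContDiffOn ℝ ∞ (fun x => (A x).inverse) Ω' ∧
      ∀ x ∈ Ω', (∀ v, A x ((A x).inverse v) = v) ∧ ∀ h, (A x).inverse (A x h) = h := by
  refine ⟨Ω ∩ A ⁻¹' range ((↑) : (E ≃L[ℝ] V) → E →L[ℝ] V), inter_subset_left,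
    hA.continuousOn.isOpen_inter_preimage hΩ ContinuousLinearEquiv.isOpen, ⟨hx₀, hA₀⟩, ?_, ?_⟩
  · rintro x ⟨hx, e, he⟩
    have hinverse : ContDiffAt ℝ ∞ ContinuousLinearMap.inverse (A x) :=
      he ▸ contDiffAt_map_inverse e
    exact (hinverse.comp x (hA.contDiffAt (hΩ.mem_nhds hx))).contDiffWithinAt
  · rintro x ⟨-, e, he⟩
    simp [← he]

lemma exists_contDiffOn_frame_range [FiniteDimensional ℝ V] {F : Type*} [NormedAddCommGroup F]
    [NormedSpace ℝ F] {T : X → F →L[ℝ] V} (hT : ContDiffOn ℝ ∞ T Ω) (hΩ : IsOpen Ω) (hx₀ : x₀ ∈ Ω)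
    (hrank : ∀ x ∈ Ω, Module.finrank ℝ (T x).range = Module.finrank ℝ (T x₀).range) :
    ∃ Ω' ⊆ Ω, IsOpen Ω' ∧ x₀ ∈ Ω' ∧
      ∃ (M : X → (T x₀).range →L[ℝ] F) (P : V →L[ℝ] (T x₀).range), ContDiffOn ℝ ∞ M Ω' ∧
        ∀ x ∈ Ω', (∀ h, P (T x (M x h)) = h) ∧ ((T x).comp (M x)).range = (T x).range := by
  obtain ⟨J₀, hJ₀⟩ := (T x₀).toLinearMap.rangeRestrict.exists_rightInverse_of_surjective
    (LinearMap.range_rangeRestrict _)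
  let J : (T x₀).range →L[ℝ] F := LinearMap.toContinuousLinearMap J₀
  have hJ (h : (T x₀).range) : T x₀ (J h) = h := congrArg Subtype.val (LinearMap.congr_fun hJ₀ h)
  obtain ⟨P, hP⟩ := Submodule.ClosedComplemented.of_finiteDimensional (T x₀).range
  let K : X → (T x₀).range →L[ℝ] (T x₀).range := fun x => P.comp ((T x).comp J)
  have hK : ContDiffOn ℝ ∞ K Ω := contDiffOn_const.clm_comp (hT.clm_comp contDiffOn_const)
  have hK₀ : K x₀ = ContinuousLinearMap.id ℝ _ := by
    ext h
    simp [K, hJ, hP]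
  obtain ⟨Ω', hΩ'Ω, hΩ', hxΩ', hKsmooth, hKinv⟩ := exists_contDiffOn_inverse hK hΩ hx₀
    (hK₀ ▸ ⟨ContinuousLinearEquiv.refl ℝ _, rfl⟩)
  refine ⟨Ω', hΩ'Ω, hΩ', hxΩ', fun x => J.comp (K x).inverse, P,
    contDiffOn_const.clm_comp hKsmooth, fun x hx => ?_⟩
  have hPT : ∀ h, P (T x (J ((K x).inverse h))) = h := (hKinv x hx).1
  refine ⟨hPT, Submodule.eq_of_le_of_finrank_eq ?_ ?_⟩
  · rintro _ ⟨h, rfl⟩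
    exact ⟨J ((K x).inverse h), rfl⟩
  · rw [hrank x (hΩ'Ω hx)]
    exact LinearMap.finrank_range_of_inj (Function.LeftInverse.injective hPT)

lemma exists_contDiffOn_frame_ker [FiniteDimensional ℝ V] [FiniteDimensional ℝ E]
    {G : X → V →L[ℝ] E} (hG : ContDiffOn ℝ ∞ G Ω) (hΩ : IsOpen Ω) (hx₀ : x₀ ∈ Ω)
    (hsurj : (G x₀).range = ⊤) :
    ∃ Ω' ⊆ Ω, IsOpen Ω' ∧ x₀ ∈ Ω' ∧
      ∃ (L : X → (G x₀).ker →L[ℝ] V) (P : V →L[ℝ] (G x₀).ker), ContDiffOn ℝ ∞ L Ω' ∧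
        ∀ x ∈ Ω', (∀ h, P (L x h) = h) ∧ (L x).range = (G x).ker := by
  have : CompleteSpace V := FiniteDimensional.complete ℝ V
  obtain ⟨P, hP⟩ := Submodule.ClosedComplemented.of_finiteDimensional (G x₀).ker
  let A : X → V →L[ℝ] E × (G x₀).ker := fun x =>
    (ContinuousLinearMap.inl ℝ E _).comp (G x) + (ContinuousLinearMap.inr ℝ E _).comp P
  have hA_apply (x : X) (v : V) : A x v = (G x v, P v) := by simp [A]
  have hA : ContDiffOn ℝ ∞ A Ω := (contDiffOn_const.clm_comp hG).add contDiffOn_const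
  have hA₀ : (A x₀).IsInvertible :=
    ⟨(G x₀).equivProdOfSurjectiveOfIsCompl P hsurj (LinearMap.range_eq_of_proj hP)
      (LinearMap.isCompl_of_proj hP), ContinuousLinearMap.ext fun v => (hA_apply x₀ v).symm⟩
  obtain ⟨Ω', hΩ'Ω, hΩ', hxΩ', hAsmooth, hAinv⟩ := exists_contDiffOn_inverse hA hΩ hx₀ hA₀
  refine ⟨Ω', hΩ'Ω, hΩ', hxΩ', fun x => (A x).inverse.comp (ContinuousLinearMap.inr ℝ E _), P,
    hAsmooth.clm_comp contDiffOn_const, fun x hx => ?_⟩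
  have hAL (h : (G x₀).ker) :
      (G x ((A x).inverse (0, h)), P ((A x).inverse (0, h))) = (0, h) :=
    (hA_apply x _).symm.trans ((hAinv x hx).1 (0, h))
  refine ⟨fun h => congrArg Prod.snd (hAL h), le_antisymm ?_ fun v (hv : G x v = 0) => ⟨P v, ?_⟩⟩
  · rintro _ ⟨h, rfl⟩
    exact congrArg Prod.fst (hAL h)
  · have hAv : A x v = (0, P v) := (hA_apply x v).trans (by rw [hv])
    exact (congrArg (A x).inverse hAv.symm).trans ((hAinv x hx).2 v)

end Frames

section Frobenius

variable {V E F : Type*} [NormedAddCommGroup V] [NormedSpace ℝ V] [NormedAddCommGroup E]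
  [NormedSpace ℝ E] [NormedAddCommGroup F] [NormedSpace ℝ F] {p : V}

lemma fderiv_apply_eq_zero_of_eventually_apply_eq {A : V → E →L[ℝ] F}
    (hA : DifferentiableAt ℝ A p) {e : E} {c : F} (hc : ∀ᶠ q in 𝓝 p, A q e = c) (v : V) :
    fderiv ℝ A p v e = 0 := by
  have hconst : HasFDerivAt (fun q => A q e) (0 : V →L[ℝ] F) p :=
    (hasFDerivAt_const c p).congr_of_eventuallyEq hc
  simpa using congrArg (fun B : V →L[ℝ] F => B v)
    ((hA.hasFDerivAt.clm_apply (hasFDerivAt_const e p)).unique hconst)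

-- The bracket is killed by `P`, which is injective on the range of `L p`.
lemma fderiv_apply_comm_of_bracket_mem_range {L : V → E →L[ℝ] V} {P : V →L[ℝ] E}
    (hL : DifferentiableAt ℝ L p) (hP : ∀ᶠ q in 𝓝 p, ∀ h, P (L q h) = h) {h k : E}
    (hbracket : fderiv ℝ L p (L p h) k - fderiv ℝ L p (L p k) h ∈ (L p).range) :
    fderiv ℝ L p (L p h) k = fderiv ℝ L p (L p k) h := by
  have hPL (v : V) (k : E) : P (fderiv ℝ L p v k) = 0 := by
    have hcomp : HasFDerivAt (fun q => P.comp (L q)) _ p :=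
      (hasFDerivAt_const P p).clm_comp hL.hasFDerivAt
    have hzero := fderiv_apply_eq_zero_of_eventually_apply_eq hcomp.differentiableAt
      (hP.mono fun q hq => hq k) v
    rw [hcomp.fderiv] at hzero
    simpa using hzero
  obtain ⟨l, hl : L p l = _⟩ := hbracket
  have hl₀ : l = 0 := by rw [← hP.self_of_nhds l, hl, map_sub, hPL, hPL, sub_zero]
  rw [← sub_eq_zero, ← hl, hl₀, map_zero]

lemma bracket_comp_mem_range {T : V → V →L[ℝ] V} {M : V → E →L[ℝ] V}
    (hT : DifferentiableAt ℝ T p) (hM : DifferentiableAt ℝ M p)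
    (hN : ∀ a b, T p (fderiv ℝ T p a b - fderiv ℝ T p b a)
      = fderiv ℝ T p (T p a) b - fderiv ℝ T p (T p b) a) (h k : E) :
    fderiv ℝ (fun q => (T q).comp (M q)) p (T p (M p h)) k
      - fderiv ℝ (fun q => (T q).comp (M q)) p (T p (M p k)) h ∈ (T p).range := by
  rw [HasFDerivAt.fderiv (hT.hasFDerivAt.clm_comp hM.hasFDerivAt)]
  refine ⟨fderiv ℝ T p (M p h) (M p k) - fderiv ℝ T p (M p k) (M p h)
    + fderiv ℝ M p (T p (M p h)) k - fderiv ℝ M p (T p (M p k)) h, ?_⟩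
  change T p _ = _
  rw [map_sub, map_add, hN]
  simp only [add_apply, ContinuousLinearMap.comp_apply, ContinuousLinearMap.compL_apply,
    ContinuousLinearMap.flip_apply]
  abel

end Frobenius

section DistributionStraightening

variable {V E : Type u} [NormedAddCommGroup V] [NormedSpace ℝ V] [FiniteDimensional ℝ V]
  [NormedAddCommGroup E] [NormedSpace ℝ E] {Ω : Set V} {p₀ : V}

/- The frame is normalized by a fixed projection `P`, so brackets tangent to the distribution that
it spans already vanish. -/
lemma exists_straightening_of_bracket_mem_range [CompleteSpace E] {L : V → E →L[ℝ] V}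
    {P : V →L[ℝ] E} (hL : ContDiffOn ℝ ∞ L Ω) (hΩ : IsOpen Ω) (hp₀ : p₀ ∈ Ω)
    (hP : ∀ p ∈ Ω, ∀ h, P (L p h) = h)
    (hbracket : ∀ p ∈ Ω, ∀ h k,
      fderiv ℝ L p (L p h) k - fderiv ℝ L p (L p k) h ∈ (L p).range) :
    ∃ Φ : OpenPartialHomeomorph V V, IsSmoothCoordChange Φ ∧ p₀ ∈ Φ.source ∧ Φ.source ⊆ Ω ∧
      Φ p₀ = p₀ ∧ ∀ p ∈ Φ.source, ∀ v, fderiv ℝ Φ p v ∈ (L p₀).range ↔ v ∈ (L p).range := by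
  obtain ⟨Φ, hΦ, hpΦ, hΦΩ, hΦp₀, hΦL, -⟩ := exists_straightening hL hΩ hp₀
    (fun p hp h k => fderiv_apply_comm_of_bracket_mem_range
      ((hL.contDiffAt (hΩ.mem_nhds hp)).differentiableAt (by simp))
      (eventually_of_mem (hΩ.mem_nhds hp) hP) (hbracket p hp h k))
    (hP p₀ hp₀) (0 : V →L[ℝ] V) (fun _ _ _ => rfl)
  refine ⟨Φ, hΦ, hpΦ, hΦΩ, hΦp₀, fun p hp v => ⟨?_, ?_⟩⟩
  · rintro ⟨h, hh : L p₀ h = _⟩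
    exact ⟨h, hΦ.fderiv_injective hp ((hΦL p hp h).trans hh)⟩
  · rintro ⟨h, rfl⟩
    exact ⟨h, (hΦL p hp h).symm⟩

lemma exists_straightening_range {T : V → V →L[ℝ] V} (hT : ContDiffOn ℝ ∞ T Ω) (hΩ : IsOpen Ω)
    (hp₀ : p₀ ∈ Ω)
    (hrank : ∀ p ∈ Ω, Module.finrank ℝ (T p).range = Module.finrank ℝ (T p₀).range)
    (hN : ∀ p ∈ Ω, ∀ a b, T p (fderiv ℝ T p a b - fderiv ℝ T p b a)
      = fderiv ℝ T p (T p a) b - fderiv ℝ T p (T p b) a) :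
    ∃ Φ : OpenPartialHomeomorph V V, IsSmoothCoordChange Φ ∧ p₀ ∈ Φ.source ∧ Φ.source ⊆ Ω ∧
      Φ p₀ = p₀ ∧ ∀ p ∈ Φ.source, ∀ v, fderiv ℝ Φ p (T p v) ∈ (T p₀).range := by
  obtain ⟨Ω', hΩ'Ω, hΩ', hpΩ', M, P, hM, hMP⟩ := exists_contDiffOn_frame_range hT hΩ hp₀ hrank
  have hdiff {G : Type u} [NormedAddCommGroup G] [NormedSpace ℝ G] {A : V → G}
      (hA : ContDiffOn ℝ ∞ A Ω') (p : V) (hp : p ∈ Ω') : DifferentiableAt ℝ A p :=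
    (hA.contDiffAt (hΩ'.mem_nhds hp)).differentiableAt (by simp)
  obtain ⟨Φ, hΦ, hpΦ, hΦΩ', hΦp₀, hΦL⟩ := exists_straightening_of_bracket_mem_range
    ((hT.mono hΩ'Ω).clm_comp hM) hΩ' hpΩ' (fun p hp => (hMP p hp).1) fun p hp h k => by
      rw [(hMP p hp).2]
      exact bracket_comp_mem_range (hdiff (hT.mono hΩ'Ω) p hp) (hdiff hM p hp) (hN p (hΩ'Ω hp)) h k
  refine ⟨Φ, hΦ, hpΦ, hΦΩ'.trans hΩ'Ω, hΦp₀, fun p hp v => ?_⟩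
  rw [← (hMP p₀ hpΩ').2, hΦL p hp, (hMP p (hΦΩ' hp)).2]
  exact ⟨v, rfl⟩

theorem exists_straightening_ker [FiniteDimensional ℝ E] {G : V → V →L[ℝ] E}
    (hG : ContDiffOn ℝ ∞ G Ω) (hΩ : IsOpen Ω) (hp₀ : p₀ ∈ Ω) (hsurj : (G p₀).range = ⊤)
    (hinv : ∀ p ∈ Ω, ∀ X Y : V → V, DifferentiableAt ℝ X p → DifferentiableAt ℝ Y p →
      (∀ᶠ q in 𝓝 p, G q (X q) = 0) → (∀ᶠ q in 𝓝 p, G q (Y q) = 0) →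
      G p (VectorField.lieBracket ℝ X Y p) = 0) :
    ∃ Φ : OpenPartialHomeomorph V V, IsSmoothCoordChange Φ ∧ p₀ ∈ Φ.source ∧ Φ.source ⊆ Ω ∧
      ∀ p ∈ Φ.source, ∀ v, G p₀ (fderiv ℝ Φ p v) = 0 ↔ G p v = 0 := by
  obtain ⟨Ω', hΩ'Ω, hΩ', hpΩ', L, P, hL, hLP⟩ := exists_contDiffOn_frame_ker hG hΩ hp₀ hsurj
  have hfield (p : V) (hp : p ∈ Ω') (h : (G p₀).ker) :
      HasFDerivAt (fun q => L q h) ((fderiv ℝ L p).flip h) p := by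
    have hLd := ((hL.contDiffAt (hΩ'.mem_nhds hp)).differentiableAt (by simp)).hasFDerivAt
    exact (hLd.clm_apply (hasFDerivAt_const h p)).congr_fderiv (by ext; simp)
  have hGL (p : V) (hp : p ∈ Ω') (h : (G p₀).ker) : G p (L p h) = 0 :=
    (hLP p hp).2.le ⟨h, rfl⟩
  obtain ⟨Φ, hΦ, hpΦ, hΦΩ', -, hΦL⟩ := exists_straightening_of_bracket_mem_range hL hΩ' hpΩ'
    (fun p hp => (hLP p hp).1) fun p hp h k => by
      rw [(hLP p hp).2]
      have hbracket := hinv p (hΩ'Ω hp) _ _ (hfield p hp h).differentiableAt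
        (hfield p hp k).differentiableAt
        (eventually_of_mem (hΩ'.mem_nhds hp) fun q hq => hGL q hq h)
        (eventually_of_mem (hΩ'.mem_nhds hp) fun q hq => hGL q hq k)
      rwa [VectorField.lieBracket, (hfield p hp h).fderiv, (hfield p hp k).fderiv] at hbracket
  refine ⟨Φ, hΦ, hpΦ, hΦΩ'.trans hΩ'Ω, fun p hp v => ?_⟩
  have hmem := hΦL p hp v
  rwa [(hLP p₀ hpΩ').2, (hLP p (hΦΩ' hp)).2] at hmem

end DistributionStraightening

section VerticalStraightening

variable {F E : Type*} [NormedAddCommGroup F] [NormedSpace ℝ F] [NormedAddCommGroup E]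
  [NormedSpace ℝ E] {H : F × E → F →L[ℝ] E}

lemma exists_straightening_vertical {F E : Type u} [NormedAddCommGroup F] [NormedSpace ℝ F]
    [FiniteDimensional ℝ F] [NormedAddCommGroup E] [NormedSpace ℝ E] [FiniteDimensional ℝ E]
    {H : F × E → F →L[ℝ] E} {Ω : Set (F × E)} (hH : ContDiffOn ℝ ∞ H Ω) (hΩ : IsOpen Ω)
    {p₀ : F × E} (hp₀ : p₀ ∈ Ω)
    (hN : ∀ p ∈ Ω, ∀ f g, fderiv ℝ H p (0, H p f) g = fderiv ℝ H p (0, H p g) f)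
    {S : E →L[ℝ] F} (hS : ∀ h, H p₀ (S h) = h) :
    ∃ Φ : OpenPartialHomeomorph (F × E) (F × E), IsSmoothCoordChange Φ ∧ p₀ ∈ Φ.source ∧
      Φ.source ⊆ Ω ∧ Φ p₀ = p₀ ∧ (∀ p ∈ Φ.source, ∀ h, fderiv ℝ Φ p (0, H p (S h)) = (0, h)) ∧
      ∀ p ∈ Φ.source, (Φ p).1 = p.1 := by
  have : CompleteSpace E := FiniteDimensional.complete ℝ E
  have : CompleteSpace F := FiniteDimensional.complete ℝ F
  let L : F × E → E →L[ℝ] F × E := fun p => (ContinuousLinearMap.inr ℝ F E).comp ((H p).comp S)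
  have hL : ContDiffOn ℝ ∞ L Ω := contDiffOn_const.clm_comp (hH.clm_comp contDiffOn_const)
  have hfderiv (p : F × E) (hp : p ∈ Ω) (v : F × E) (k : E) :
      fderiv ℝ L p v k = (0, fderiv ℝ H p v (S k)) := by
    have hHp := ((hH.contDiffAt (hΩ.mem_nhds hp)).differentiableAt (by simp)).hasFDerivAt
    have hLp : HasFDerivAt L _ p := (hasFDerivAt_const (ContinuousLinearMap.inr ℝ F E) p).clm_comp
      (hHp.clm_comp (hasFDerivAt_const S p))
    simp [hLp.fderiv]
  obtain ⟨Φ, hΦ, hpΦ, hΦΩ, hΦp₀, hΦL, hΦfst⟩ := exists_straightening hL hΩ hp₀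
    (fun p hp h k => by rw [hfderiv p hp, hfderiv p hp]; exact Prod.ext rfl (hN p hp (S h) (S k)))
    (P := ContinuousLinearMap.snd ℝ F E) hS (ContinuousLinearMap.fst ℝ F E) (fun _ _ _ => rfl)
  exact ⟨Φ, hΦ, hpΦ, hΦΩ, hΦp₀, fun p hp h => by simpa [L, hS] using hΦL p hp h, hΦfst⟩

lemma fderiv_inr_eq_zero_of_rightInverse {p : F × E} (hH : DifferentiableAt ℝ H p)
    (hN : ∀ f g, fderiv ℝ H p (0, H p f) g = fderiv ℝ H p (0, H p g) f) {S : E →L[ℝ] F}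
    (hS : ∀ᶠ q in 𝓝 p, ∀ h, H q (S h) = h) (c : E) : fderiv ℝ H p (0, c) = 0 := by
  have hHS (v : F × E) (e : E) : fderiv ℝ H p v (S e) = 0 :=
    fderiv_apply_eq_zero_of_eventually_apply_eq hH (hS.mono fun q hq => hq e) v
  have hSp := hS.self_of_nhds
  ext g
  -- Only the component of `g` in the kernel of `H p` matters.
  have hswap := hN (S c) (g - S (H p g))
  rw [show H p (g - S (H p g)) = 0 by rw [map_sub, hSp, sub_self], hSp, Prod.mk_zero_zero,
    map_zero, map_sub, hHS, sub_zero] at hswap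
  simpa using hswap

lemma eq_of_fst_eq_of_rightInverse {B : Set (F × E)} (hB : IsOpen B) (hBc : Convex ℝ B)
    (hH : DifferentiableOn ℝ H B)
    (hN : ∀ p ∈ B, ∀ f g, fderiv ℝ H p (0, H p f) g = fderiv ℝ H p (0, H p g) f)
    {S : E →L[ℝ] F} (hS : ∀ p ∈ B, ∀ h, H p (S h) = h) {y : F} {z z' : E} (hz : (y, z) ∈ B)
    (hz' : (y, z') ∈ B) : H (y, z) = H (y, z') := by
  have hline : Convex ℝ ((fun z => (y, z)) ⁻¹' B) :=
    hBc.affine_preimage (AffineMap.const ℝ E y |>.prod (AffineMap.id ℝ E))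
  have hHline (z : E) (hz : (y, z) ∈ B) :
      HasFDerivAt (𝕜 := ℝ) (fun z => H (y, z)) 0 z := by
    have hd : DifferentiableAt ℝ H (y, z) := hH.differentiableAt (hB.mem_nhds hz)
    refine (hd.hasFDerivAt.comp z (hasFDerivAt_prodMk_right y z)).congr_fderiv ?_
    ext c : 1
    simpa using fderiv_inr_eq_zero_of_rightInverse hd (hN _ hz)
      (eventually_of_mem (hB.mem_nhds hz) hS) c
  refine hline.is_const_of_fderivWithin_eq_zero (𝕜 := ℝ) (f := fun z => H (y, z))
    (fun z hz => ?_) (fun z hz => ?_) hz hz'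
  · exact (hHline z hz).differentiableAt.differentiableWithinAt
  · rw [fderivWithin_of_isOpen (hB.preimage (Continuous.prodMk_right y)) hz, (hHline z hz).fderiv]

end VerticalStraightening

section SmoothCoordinates

variable {n : ℕ} {M : Type u} [TopologicalSpace M] [ChartedSpace (EuclideanSpace ℝ (Fin n)) M]
  {V : Type v} [NormedAddCommGroup V] [NormedSpace ℝ V]

/-- A system of smooth local coordinates on `M` with values in a normed space `V`, which need not
be the model space: this allows adapted coordinates with values in a product. -/
structure IsSmoothCoord (χ : OpenPartialHomeomorph M V) : Prop where
  smooth : ContMDiffOn (𝓡 n) 𝓘(ℝ, V) ∞ χ χ.source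
  smooth_symm : ContMDiffOn 𝓘(ℝ, V) (𝓡 n) ∞ χ.symm χ.target

/-- The differential of `V`-valued coordinates, read as a map into `V`. -/
def coordD (χ : OpenPartialHomeomorph M V) (z : M) : TangentSpace (𝓡 n) z →L[ℝ] V :=
  mfderiv (𝓡 n) 𝓘(ℝ, V) χ z

/-- The vector field on `M` with coordinate expression `X`. -/
def coordField (χ : OpenPartialHomeomorph M V) (X : V → V) (z : M) : TangentSpace (𝓡 n) z :=
  (coordD χ z).inverse (X (χ z))

/-- The expression of a vector field in coordinates. -/
def coordExpr (χ : OpenPartialHomeomorph M V) (X : ∀ z : M, TangentSpace (𝓡 n) z) (p : V) : V :=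
  coordD χ (χ.symm p) (X (χ.symm p))

namespace IsSmoothCoord

variable {χ : OpenPartialHomeomorph M V} {z : M}

lemma mdifferentiable (hχ : IsSmoothCoord (n := n) χ) : χ.MDifferentiable (𝓡 n) 𝓘(ℝ, V) :=
  ⟨hχ.smooth.mdifferentiableOn (by simp), hχ.smooth_symm.mdifferentiableOn (by simp)⟩

lemma contMDiffAt (hχ : IsSmoothCoord (n := n) χ) (hz : z ∈ χ.source) :
    ContMDiffAt (𝓡 n) 𝓘(ℝ, V) ∞ χ z :=
  hχ.smooth.contMDiffAt (χ.open_source.mem_nhds hz)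

lemma contMDiffAt_symm (hχ : IsSmoothCoord (n := n) χ) {p : V} (hp : p ∈ χ.target) :
    ContMDiffAt 𝓘(ℝ, V) (𝓡 n) ∞ χ.symm p :=
  hχ.smooth_symm.contMDiffAt (χ.open_target.mem_nhds hp)

lemma hasMFDerivAt (hχ : IsSmoothCoord (n := n) χ) (hz : z ∈ χ.source) :
    HasMFDerivAt (𝓡 n) 𝓘(ℝ, V) χ z (coordD χ z) :=
  ((hχ.contMDiffAt hz).mdifferentiableAt (by simp)).hasMFDerivAt

lemma isInvertible (hχ : IsSmoothCoord (n := n) χ) (hz : z ∈ χ.source) :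
    (coordD (n := n) χ z).IsInvertible :=
  ⟨hχ.mdifferentiable.mfderiv hz, rfl⟩

lemma coordD_inverse (hχ : IsSmoothCoord (n := n) χ) (hz : z ∈ χ.source) (v : V) :
    coordD (n := n) χ z ((coordD χ z).inverse v) = v := by
  obtain ⟨e, he⟩ := hχ.isInvertible hz
  simp [← he]

lemma inverse_coordD (hχ : IsSmoothCoord (n := n) χ) (hz : z ∈ χ.source)
    (ξ : TangentSpace (𝓡 n) z) : (coordD χ z).inverse (coordD χ z ξ) = ξ := by
  obtain ⟨e, he⟩ := hχ.isInvertible hz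
  simp [← he]

lemma coordD_injective (hχ : IsSmoothCoord (n := n) χ) (hz : z ∈ χ.source) :
    Function.Injective (coordD (n := n) χ z) :=
  Function.LeftInverse.injective (hχ.inverse_coordD hz)

lemma coordD_coordField (hχ : IsSmoothCoord (n := n) χ) (hz : z ∈ χ.source) (X : V → V) :
    coordD (n := n) χ z (coordField χ X z) = X (χ z) :=
  hχ.coordD_inverse hz _

lemma coordField_coordExpr (hχ : IsSmoothCoord (n := n) χ) (hz : z ∈ χ.source)
    (X : ∀ z : M, TangentSpace (𝓡 n) z) : coordField χ (coordExpr χ X) z = X z := by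
  refine hχ.coordD_injective hz ?_
  rw [hχ.coordD_coordField hz, coordExpr, χ.left_inv hz]

lemma trans (hχ : IsSmoothCoord (n := n) χ) {V' : Type*} [NormedAddCommGroup V']
    [NormedSpace ℝ V'] {Φ : OpenPartialHomeomorph V V'} (hΦ : IsSmoothCoordChange Φ) :
    IsSmoothCoord (n := n) (χ.trans Φ) where
  smooth := hΦ.contDiffOn.contMDiffOn.comp (hχ.smooth.mono inter_subset_left) fun _ hz => hz.2
  smooth_symm :=
    hχ.smooth_symm.comp (hΦ.contDiffOn_symm.contMDiffOn.mono inter_subset_left) fun _ hz => hz.2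

lemma coordD_trans (hχ : IsSmoothCoord (n := n) χ) {V' : Type*} [NormedAddCommGroup V']
    [NormedSpace ℝ V'] {Φ : OpenPartialHomeomorph V V'} (hΦ : IsSmoothCoordChange Φ)
    (hz : z ∈ (χ.trans Φ).source) (ξ : TangentSpace (𝓡 n) z) :
    coordD (n := n) (χ.trans Φ) z ξ = fderiv ℝ Φ (χ z) (coordD χ z ξ) :=
  congrArg (fun A : TangentSpace (𝓡 n) z →L[ℝ] V' => A ξ)
    ((hΦ.hasFDerivAt hz.2).hasMFDerivAt.comp z (hχ.hasMFDerivAt hz.1)).mfderiv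

section VectorFields

variable {X : ∀ z : M, TangentSpace (𝓡 n) z}

section ContinuousLinearEquiv

variable {V' : Type*} [NormedAddCommGroup V'] [NormedSpace ℝ V'] (L : V ≃L[ℝ] V')

lemma transHomeomorph (hχ : IsSmoothCoord (n := n) χ) :
    IsSmoothCoord (n := n) (χ.transHomeomorph L.toHomeomorph) where
  smooth := L.contDiff.contMDiff.comp_contMDiffOn hχ.smooth
  smooth_symm := hχ.smooth_symm.comp L.symm.contDiff.contMDiff.contMDiffOn fun _ hp => hp

lemma coordD_transHomeomorph (hχ : IsSmoothCoord (n := n) χ) (hz : z ∈ χ.source)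
    (ξ : TangentSpace (𝓡 n) z) :
    coordD (χ.transHomeomorph L.toHomeomorph) z ξ = L (coordD χ z ξ) :=
  congrArg (fun A : TangentSpace (𝓡 n) z →L[ℝ] V' => A ξ)
    (L.hasFDerivAt.hasMFDerivAt.comp z (hχ.hasMFDerivAt hz)).mfderiv

end ContinuousLinearEquiv

lemma tangentMapWithin_field_eventuallyEq (hz : z ∈ χ.source) :
    (fun x => (tangentMapWithin (𝓡 n) 𝓘(ℝ, V) χ χ.source ⟨x, X x⟩).2)
      =ᶠ[𝓝 z] fun x => coordD χ x (X x) := by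
  filter_upwards [χ.open_source.mem_nhds hz] with x hx
  exact congrArg (fun A : TangentSpace (𝓡 n) x →L[ℝ] V => A (X x))
    (mfderivWithin_of_isOpen χ.open_source hx)

lemma tangentMapWithin_symm_field_eventuallyEq (hχ : IsSmoothCoord (n := n) χ)
    (hz : z ∈ χ.source) :
    (fun x => tangentMapWithin 𝓘(ℝ, V) (𝓡 n) χ.symm χ.target
      (⟨χ x, coordD χ x (X x)⟩ : TangentBundle 𝓘(ℝ, V) V))
      =ᶠ[𝓝 z] fun x => (⟨x, X x⟩ : TangentBundle (𝓡 n) M) := by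
  filter_upwards [χ.open_source.mem_nhds hz] with x hx
  rw [tangentMapWithin, mfderivWithin_of_isOpen χ.open_target (χ.map_source hx)]
  have hsymm : mfderiv 𝓘(ℝ, V) (𝓡 n) χ.symm (χ x) (coordD χ x (X x)) = X x :=
    congrArg (fun A : TangentSpace (𝓡 n) x →L[ℝ] TangentSpace (𝓡 n) x => A (X x))
      (hχ.mdifferentiable.symm_comp_deriv hx)
  exact Bundle.TotalSpace.ext (χ.left_inv hx) (heq_of_eq hsymm)

variable [IsManifold (𝓡 n) ∞ M]

lemma contMDiffAt_tangentMapWithin (hχ : IsSmoothCoord (n := n) χ) (hz : z ∈ χ.source)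
    (ξ : TangentSpace (𝓡 n) z) :
    ContMDiffAt (𝓡 n).tangent 𝓘(ℝ, V).tangent ∞
      (tangentMapWithin (𝓡 n) 𝓘(ℝ, V) χ χ.source) (⟨z, ξ⟩ : TangentBundle (𝓡 n) M) :=
  (hχ.smooth.contMDiffOn_tangentMapWithin (m := ∞) (by simp)
    χ.open_source.uniqueMDiffOn).contMDiffAt
      ((χ.open_source.preimage (FiberBundle.continuous_proj _ _)).mem_nhds hz)

lemma contMDiffAt_tangentMapWithin_symm (hχ : IsSmoothCoord (n := n) χ) (hz : z ∈ χ.source)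
    (v : V) :
    ContMDiffAt 𝓘(ℝ, V).tangent (𝓡 n).tangent ∞
      (tangentMapWithin 𝓘(ℝ, V) (𝓡 n) χ.symm χ.target) (⟨χ z, v⟩ : TangentBundle 𝓘(ℝ, V) V) :=
  (hχ.smooth_symm.contMDiffOn_tangentMapWithin (m := ∞) (by simp)
    χ.open_target.uniqueMDiffOn).contMDiffAt
      ((χ.open_target.preimage (FiberBundle.continuous_proj _ _)).mem_nhds (χ.map_source hz))

lemma contMDiffAt_field_iff (hχ : IsSmoothCoord (n := n) χ) (hz : z ∈ χ.source) :
    ContMDiffAt (𝓡 n) (𝓡 n).tangent ∞ (fun x => (⟨x, X x⟩ : TangentBundle (𝓡 n) M)) z ↔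
      ContMDiffAt (𝓡 n) 𝓘(ℝ, V) ∞ (fun x => coordD χ x (X x)) z := by
  refine ⟨fun hX => ?_, fun hX => ?_⟩
  · exact ((contMDiff_snd_tangentBundle_modelSpace V 𝓘(ℝ, V)).contMDiffAt.comp z
      ((hχ.contMDiffAt_tangentMapWithin hz (X z)).comp z hX)).congr_of_eventuallyEq
        (tangentMapWithin_field_eventuallyEq hz).symm
  · have hpair : ContMDiffAt (𝓡 n) 𝓘(ℝ, V).tangent ∞
        (fun x => (⟨χ x, coordD χ x (X x)⟩ : TangentBundle 𝓘(ℝ, V) V)) z := by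
      rw [Bundle.contMDiffAt_totalSpace]
      exact ⟨hχ.contMDiffAt hz, by simpa using hX⟩
    exact ((hχ.contMDiffAt_tangentMapWithin_symm hz _).comp z hpair).congr_of_eventuallyEq
      (hχ.tangentMapWithin_symm_field_eventuallyEq hz).symm

lemma fieldDifferentiableAt_iff (hχ : IsSmoothCoord (n := n) χ) (hz : z ∈ χ.source) :
    FieldDifferentiableAt X z ↔
      MDifferentiableAt (𝓡 n) 𝓘(ℝ, V) (fun x => coordD χ x (X x)) z := by
  refine ⟨fun hX => ?_, fun hX => ?_⟩
  · exact (((contMDiff_snd_tangentBundle_modelSpace V 𝓘(ℝ, V)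
      (n := ∞)).contMDiffAt.mdifferentiableAt (by simp)).comp z
        (((hχ.contMDiffAt_tangentMapWithin hz (X z)).mdifferentiableAt (by simp)).comp z
          hX)).congr_of_eventuallyEq (tangentMapWithin_field_eventuallyEq hz).symm
  · have hpair : MDifferentiableAt (𝓡 n) 𝓘(ℝ, V).tangent
        (fun x => (⟨χ x, coordD χ x (X x)⟩ : TangentBundle 𝓘(ℝ, V) V)) z := by
      rw [mdifferentiableAt_totalSpace]
      exact ⟨(hχ.contMDiffAt hz).mdifferentiableAt (by simp), by simpa using hX⟩
    exact (((hχ.contMDiffAt_tangentMapWithin_symm hz _).mdifferentiableAt (by simp)).comp z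
      hpair).congr_of_eventuallyEq (hχ.tangentMapWithin_symm_field_eventuallyEq hz).symm

lemma contMDiffAt_coordField (hχ : IsSmoothCoord (n := n) χ) (hz : z ∈ χ.source) {X : V → V}
    (hX : ContDiffAt ℝ ∞ X (χ z)) :
    ContMDiffAt (𝓡 n) (𝓡 n).tangent ∞
      (fun x => (⟨x, coordField χ X x⟩ : TangentBundle (𝓡 n) M)) z := by
  rw [hχ.contMDiffAt_field_iff hz]
  refine (hX.contMDiffAt.comp z (hχ.contMDiffAt hz)).congr_of_eventuallyEq ?_
  filter_upwards [χ.open_source.mem_nhds hz] with y hy using hχ.coordD_coordField hy X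

lemma fieldDifferentiableAt_coordField (hχ : IsSmoothCoord (n := n) χ) (hz : z ∈ χ.source)
    {X : V → V} (hX : DifferentiableAt ℝ X (χ z)) :
    FieldDifferentiableAt (n := n) (coordField χ X) z := by
  rw [hχ.fieldDifferentiableAt_iff hz]
  refine (hX.mdifferentiableAt.comp z
    ((hχ.contMDiffAt hz).mdifferentiableAt (by simp))).congr_of_eventuallyEq ?_
  filter_upwards [χ.open_source.mem_nhds hz] with y hy using hχ.coordD_coordField hy X

lemma differentiableAt_coordExpr (hχ : IsSmoothCoord (n := n) χ) (hz : z ∈ χ.source)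
    (hX : FieldDifferentiableAt X z) : DifferentiableAt ℝ (coordExpr χ X) (χ z) := by
  rw [hχ.fieldDifferentiableAt_iff hz] at hX
  have hcomp : MDifferentiableAt 𝓘(ℝ, V) 𝓘(ℝ, V) (coordExpr χ X) (χ z) :=
    MDifferentiableAt.comp (g := fun x => coordD χ x (X x)) (χ z) (by rwa [χ.left_inv hz])
      ((hχ.contMDiffAt_symm (χ.map_source hz)).mdifferentiableAt (by simp))
  exact hcomp.differentiableAt

end VectorFields

variable [IsManifold (𝓡 n) ∞ M] [FiniteDimensional ℝ V]

lemma coordD_mlieBracket_coordField (hχ : IsSmoothCoord (n := n) χ) (hz : z ∈ χ.source)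
    {X Y : V → V} (hX : DifferentiableAt ℝ X (χ z)) (hY : DifferentiableAt ℝ Y (χ z)) :
    coordD χ z (VectorField.mlieBracket (𝓡 n) (coordField χ X) (coordField χ Y) z)
      = VectorField.lieBracket ℝ X Y (χ z) := by
  have : CompleteSpace V := FiniteDimensional.complete ℝ V
  have hsection {X : V → V} (hX : DifferentiableAt ℝ X (χ z)) : MDifferentiableAt 𝓘(ℝ, V)
      𝓘(ℝ, V).tangent (fun p => (⟨p, X p⟩ : TangentBundle 𝓘(ℝ, V) V)) (χ z) := by
    rw [mdifferentiableAt_totalSpace]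
    exact ⟨mdifferentiableAt_id, by simpa using hX.mdifferentiableAt⟩
  have hle (k : ℕ) : (k : WithTop ℕ∞) ≤ ∞ := WithTop.coe_le_coe.2 (le_top (a := (k : ℕ∞)))
  have : IsManifold (𝓡 n) (minSmoothness ℝ 3) M := by
    rw [minSmoothness_of_isRCLikeNormedField]
    exact IsManifold.of_le (hle 3)
  have hpullback := VectorField.mpullback_mlieBracket (I := 𝓡 n) (I' := 𝓘(ℝ, V)) (f := χ)
    (x₀ := z) (n := ∞) (V := X) (W := Y) (hsection hX) (hsection hY) (hχ.contMDiffAt hz)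
    (by rw [minSmoothness_of_isRCLikeNormedField]; exact hle 2)
  have hmodel : VectorField.mlieBracket 𝓘(ℝ, V) X Y = VectorField.lieBracket ℝ X Y :=
    VectorField.mlieBracketWithin_univ.symm.trans
      (VectorField.mlieBracketWithin_eq_lieBracketWithin.trans VectorField.lieBracketWithin_univ)
  rw [← hmodel]
  exact (congrArg (coordD χ z) hpullback.symm).trans (hχ.coordD_inverse hz _)

lemma coordD_mlieBracket (hχ : IsSmoothCoord (n := n) χ) (hz : z ∈ χ.source)
    {X Y : ∀ z : M, TangentSpace (𝓡 n) z} (hX : FieldDifferentiableAt X z)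
    (hY : FieldDifferentiableAt Y z) :
    coordD χ z (VectorField.mlieBracket (𝓡 n) X Y z)
      = fderiv ℝ (coordExpr χ Y) (χ z) (coordD χ z (X z))
        - fderiv ℝ (coordExpr χ X) (χ z) (coordD χ z (Y z)) := by
  have hfield (X : ∀ z : M, TangentSpace (𝓡 n) z) : X =ᶠ[𝓝 z] coordField χ (coordExpr χ X) := by
    filter_upwards [χ.open_source.mem_nhds hz] with y hy using (hχ.coordField_coordExpr hy X).symm
  rw [(hfield X).mlieBracket_vectorField_eq (hfield Y), hχ.coordD_mlieBracket_coordField hz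
    (hχ.differentiableAt_coordExpr hz hX) (hχ.differentiableAt_coordExpr hz hY)]
  have hvalue (X : ∀ z : M, TangentSpace (𝓡 n) z) : coordExpr χ X (χ z) = coordD χ z (X z) := by
    rw [coordExpr, χ.left_inv hz]
  rw [VectorField.lieBracket, hvalue, hvalue]

end IsSmoothCoord

variable [IsManifold (𝓡 n) ∞ M]

lemma exists_smoothField_eventuallyEq [T2Space M] {X : ∀ z : M, TangentSpace (𝓡 n) z} {W : Set M}
    (hW : IsOpen W) {z : M} (hz : z ∈ W) (hX : SmoothFieldOn X W) :
    ∃ X' : ∀ z : M, TangentSpace (𝓡 n) z, SmoothFieldOn X' univ ∧ X' =ᶠ[𝓝 z] X := by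
  obtain ⟨f, -, hf⟩ := (SmoothBumpFunction.nhds_basis_tsupport (I := 𝓡 n) z).mem_iff.1
    (hW.mem_nhds hz)
  refine ⟨fun x => f x • X x, contMDiffOn_univ.2 fun x => ?_, ?_⟩
  · by_cases hx : x ∈ tsupport f
    · exact ContMDiffAt.smul_section (V := (TangentSpace (𝓡 n) : M → Type _)) (f.contMDiff x)
        (hX.contMDiffAt (hW.mem_nhds (hf hx)))
    · have hzero : ContMDiff (𝓡 n) (𝓡 n).tangent ∞ (fun x => (⟨x, 0⟩ : TangentBundle (𝓡 n) M)) :=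
        Bundle.contMDiff_zeroSection (F := EuclideanSpace ℝ (Fin n)) ℝ
          (TangentSpace (𝓡 n) : M → Type _)
      refine (hzero x).congr_of_eventuallyEq ?_
      filter_upwards [(isClosed_tsupport f).isOpen_compl.mem_nhds hx] with y hy
      have hfy : f y = 0 := image_eq_zero_of_notMem_tsupport hy
      exact Bundle.TotalSpace.ext rfl (heq_of_eq (by simp [hfy]))
  · filter_upwards [f.eventuallyEq_one] with y (hy : f y = 1)
    exact (congrArg (· • X y) hy).trans (one_smul ℝ (X y))

namespace Tensor11

variable (Θ : Tensor11 n M)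

/-- The expression of a `(1,1)` tensor field in coordinates. -/
def coord (χ : OpenPartialHomeomorph M V) (p : V) : V →L[ℝ] V :=
  (coordD χ (χ.symm p)).comp ((Θ (χ.symm p)).comp (coordD χ (χ.symm p)).inverse)

lemma contMDiffAt_apply_field {z : M} {X : ∀ z : M, TangentSpace (𝓡 n) z}
    (hX : ContMDiffAt (𝓡 n) (𝓡 n).tangent ∞ (fun x => (⟨x, X x⟩ : TangentBundle (𝓡 n) M)) z) :
    ContMDiffAt (𝓡 n) (𝓡 n).tangent ∞
      (fun x => (⟨x, Θ x (X x)⟩ : TangentBundle (𝓡 n) M)) z :=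
  ContMDiffAt.clm_bundle_apply (Θ.contMDiff z) hX

lemma fieldDifferentiableAt_apply {z : M} {X : ∀ z : M, TangentSpace (𝓡 n) z}
    (hX : FieldDifferentiableAt X z) : FieldDifferentiableAt (fun x => Θ x (X x)) z :=
  MDifferentiableAt.clm_bundle_apply ((Θ.contMDiff z).mdifferentiableAt (by simp)) hX

variable {χ : OpenPartialHomeomorph M V} (hχ : IsSmoothCoord (n := n) χ)

include hχ

lemma coordD_apply {z : M} (hz : z ∈ χ.source) (ξ : TangentSpace (𝓡 n) z) :
    coordD χ z (Θ z ξ) = Θ.coord χ (χ z) (coordD χ z ξ) := by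
  simp only [Tensor11.coord, ContinuousLinearMap.comp_apply]
  rw [χ.left_inv hz, hχ.inverse_coordD hz]

variable [FiniteDimensional ℝ V]

lemma contDiffOn_coord : ContDiffOn ℝ ∞ (Θ.coord χ) χ.target := by
  rw [contDiffOn_clm_apply]
  intro v p hp
  have hz := χ.map_target hp
  have hfield := Θ.contMDiffAt_apply_field (hχ.contMDiffAt_coordField hz
    (contDiffAt_const (c := v)))
  rw [hχ.contMDiffAt_field_iff hz] at hfield
  exact (hfield.comp p (hχ.contMDiffAt_symm hp)).contDiffAt.contDiffWithinAt

omit [FiniteDimensional ℝ V] in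
lemma exists_smoothField_eventuallyEq_const [T2Space M] {z : M} (hz : z ∈ χ.source) (a : V) :
    ∃ X : ∀ z : M, TangentSpace (𝓡 n) z, SmoothFieldOn X univ ∧
      X =ᶠ[𝓝 z] coordField χ (fun _ => a) ∧
      (fun x => Θ x (X x)) =ᶠ[𝓝 z] coordField χ (fun q => Θ.coord χ q a) := by
  obtain ⟨X, hX, hXz⟩ := exists_smoothField_eventuallyEq (X := coordField χ (fun _ => a))
    χ.open_source hz fun x hx =>
      (hχ.contMDiffAt_coordField hx contDiffAt_const).contMDiffWithinAt
  refine ⟨X, hX, hXz, ?_⟩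
  filter_upwards [hXz, χ.open_source.mem_nhds hz] with y hy hys
  refine hχ.coordD_injective hys ?_
  rw [hy, Θ.coordD_apply hχ hys, hχ.coordD_coordField hys, hχ.coordD_coordField hys]

variable {Θ} in
-- Evaluate the Nijenhuis tensor on vector fields with constant coordinate expressions `a`, `b`.
lemma NijenhuisVanishes.coord_eq [T2Space M] (hN : Θ.NijenhuisVanishes) {p : V}
    (hp : p ∈ χ.target) (a b : V) :
    Θ.coord χ p (fderiv ℝ (Θ.coord χ) p a b - fderiv ℝ (Θ.coord χ) p b a) =
      fderiv ℝ (Θ.coord χ) p (Θ.coord χ p a) b - fderiv ℝ (Θ.coord χ) p (Θ.coord χ p b) a := by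
  set T := Θ.coord χ with hT
  have hz := χ.map_target hp
  have hχz : χ (χ.symm p) = p := χ.right_inv hp
  have hTp : DifferentiableAt ℝ T p :=
    ((Θ.contDiffOn_coord hχ).contDiffAt (χ.open_target.mem_nhds hp)).differentiableAt (by simp)
  have hTa (a : V) : DifferentiableAt ℝ (fun q => T q a) (χ (χ.symm p)) := by
    rw [hχz]; exact hTp.clm_apply (differentiableAt_const a)
  have hfderiv (a c : V) : fderiv ℝ (fun q => T q a) p c = fderiv ℝ T p c a := by
    simp [fderiv_clm_apply hTp (differentiableAt_const a)]
  have hconst (a : V) : DifferentiableAt ℝ (fun _ : V => a) (χ (χ.symm p)) :=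
    differentiableAt_const a
  obtain ⟨X, hX, hXz, hΘX⟩ := Θ.exists_smoothField_eventuallyEq_const hχ hz a
  obtain ⟨Y, hY, hYz, hΘY⟩ := Θ.exists_smoothField_eventuallyEq_const hχ hz b
  have hcoord := congrArg (coordD χ (χ.symm p)) (hN X Y hX hY (χ.symm p))
  rw [Tensor11.nijenhuis, hΘX.mlieBracket_vectorField_eq hYz,
    hXz.mlieBracket_vectorField_eq hΘY, hΘX.mlieBracket_vectorField_eq hΘY,
    hXz.mlieBracket_vectorField_eq hYz] at hcoord
  simp only [map_sub, map_add, map_zero, Θ.coordD_apply hχ hz] at hcoord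
  rw [hχ.coordD_mlieBracket_coordField hz (hTa a) (hconst b),
    hχ.coordD_mlieBracket_coordField hz (hconst a) (hTa b),
    hχ.coordD_mlieBracket_coordField hz (hTa a) (hTa b),
    hχ.coordD_mlieBracket_coordField hz (hconst a) (hconst b)] at hcoord
  simp only [VectorField.lieBracket, hχz, hfderiv, ← hT, fderiv_fun_const, Pi.zero_apply,
    zero_apply, sub_zero, zero_sub, map_neg, map_zero, map_sub] at hcoord ⊢
  rw [← sub_eq_zero, ← hcoord]
  abel

end Tensor11

end SmoothCoordinates

section LinearAlgebra

lemma finrank_range_eq_of_semiconj {R V W : Type*} [Ring R] [AddCommGroup V] [Module R V]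
    [AddCommGroup W] [Module R W] (A : V ≃ₗ[R] W) {f : V →ₗ[R] V} {g : W →ₗ[R] W}
    (h : ∀ v, A (f v) = g (A v)) : Module.finrank R f.range = Module.finrank R g.range := by
  have hmap : f.range.map (A : V →ₗ[R] W) = g.range := by
    rw [← LinearMap.range_comp, show A.toLinearMap ∘ₗ f = g ∘ₗ A from LinearMap.ext h,
      LinearMap.range_comp, A.range, Submodule.map_top]
  rw [← hmap, LinearEquiv.finrank_map_eq]

lemma exists_equiv_prod_fst_eq_zero_iff {V : Type*} [NormedAddCommGroup V] [NormedSpace ℝ V]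
    [FiniteDimensional ℝ V] (K : Submodule ℝ V) {m r : ℕ} (hr : Module.finrank ℝ K = r)
    (hm : Module.finrank ℝ V = m + r) :
    ∃ L : V ≃L[ℝ] EuclideanSpace ℝ (Fin m) × EuclideanSpace ℝ (Fin r),
      ∀ v, (L v).1 = 0 ↔ v ∈ K := by
  obtain ⟨C, hC⟩ := K.exists_isCompl
  have hCm : Module.finrank ℝ C = m := by
    have := Submodule.finrank_add_eq_of_isCompl hC
    omega
  let split := Submodule.prodEquivOfIsCompl C K hC.symm
  let L : V ≃ₗ[ℝ] EuclideanSpace ℝ (Fin m) × EuclideanSpace ℝ (Fin r) :=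
    split.symm.trans <|
      (LinearEquiv.ofFinrankEq _ _ (by rw [hCm, finrank_euclideanSpace_fin])).prodCongr
        (LinearEquiv.ofFinrankEq _ _ (by rw [hr, finrank_euclideanSpace_fin]))
  refine ⟨L.toContinuousLinearEquiv, fun v => ?_⟩
  exact (LinearEquiv.map_eq_zero_iff _ (x := (split.symm v).1)).trans
    (Submodule.prodEquivOfIsCompl_symm_apply_fst_eq_zero _ _ hC.symm)

variable {V F E : Type*} [NormedAddCommGroup V] [NormedSpace ℝ V] [NormedAddCommGroup F]
  [NormedSpace ℝ F] [NormedAddCommGroup E] [NormedSpace ℝ E]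

/-- The block `F → E` of an endomorphism of `V` with respect to a splitting `V ≃ F × E`. -/
def offDiagonalBlock (L : V ≃L[ℝ] F × E) (T : V →L[ℝ] V) : F →L[ℝ] E :=
  (ContinuousLinearMap.snd ℝ F E).comp ((L : V →L[ℝ] F × E).comp
    (T.comp ((L.symm : F × E →L[ℝ] V).comp (ContinuousLinearMap.inl ℝ F E))))

variable {L : V ≃L[ℝ] F × E} {T : V →L[ℝ] V}

lemma apply_eq_offDiagonalBlock (hL : ∀ v, (L v).1 = 0 ↔ v ∈ T.range) (hT : ∀ v, T (T v) = 0)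
    (v : V) : L (T v) = (0, offDiagonalBlock L T (L v).1) := by
  have hker : T (L.symm (0, (L v).2)) = 0 := by
    obtain ⟨w, hw : T w = _⟩ := (hL (L.symm (0, (L v).2))).1 (by simp)
    rw [← hw, hT]
  have hv : v = L.symm ((L v).1, 0) + L.symm (0, (L v).2) := by
    rw [← map_add, Prod.mk_add_mk, add_zero, zero_add, L.symm_apply_apply]
  refine Prod.ext ((hL _).2 ⟨v, rfl⟩) ?_
  conv_lhs => rw [hv, map_add, hker, add_zero]
  rfl

lemma offDiagonalBlock_surjective (hL : ∀ v, (L v).1 = 0 ↔ v ∈ T.range)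
    (hT : ∀ v, T (T v) = 0) : Function.Surjective (offDiagonalBlock L T) := by
  intro e
  obtain ⟨w, hw : T w = _⟩ := (hL (L.symm (0, e))).1 (by simp)
  refine ⟨(L w).1, ?_⟩
  have hLw := apply_eq_offDiagonalBlock hL hT w
  rw [hw, L.apply_symm_apply] at hLw
  exact (congrArg Prod.snd hLw).symm

end LinearAlgebra

section AdaptedCoordinates

variable {n : ℕ} {M : Type u} [TopologicalSpace M] [ChartedSpace (EuclideanSpace ℝ (Fin n)) M]

lemma isSmoothCoord_of_mem_maximalAtlas {χ : OpenPartialHomeomorph M (EuclideanSpace ℝ (Fin n))}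
    (hχ : χ ∈ IsManifold.maximalAtlas (𝓡 n) ∞ M) : IsSmoothCoord (n := n) χ where
  smooth := contMDiffOn_of_mem_maximalAtlas hχ
  smooth_symm := contMDiffOn_symm_of_mem_maximalAtlas hχ

variable [IsManifold (𝓡 n) ∞ M] {Θ : Tensor11 n M}

lemma Tensor11.AlgebraicallyConstant.finrank_range_eq (hΘ : Θ.AlgebraicallyConstant) (x y : M) :
    Module.finrank ℝ (Θ x).range = Module.finrank ℝ (Θ y).range := by
  obtain ⟨A, hA⟩ := hΘ x y
  exact finrank_range_eq_of_semiconj A hA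

lemma Tensor11.finrank_range_coord (Θ : Tensor11 n M) {V : Type v} [NormedAddCommGroup V]
    [NormedSpace ℝ V] {χ : OpenPartialHomeomorph M V} (hχ : IsSmoothCoord (n := n) χ) {z : M}
    (hz : z ∈ χ.source) :
    Module.finrank ℝ (Θ.coord χ (χ z)).range = Module.finrank ℝ (Θ z).range :=
  (finrank_range_eq_of_semiconj (hχ.mdifferentiable.mfderiv hz).toLinearEquiv
    (Θ.coordD_apply hχ hz)).symm

lemma Tensor11.exists_isSmoothCoord_range_coord_eq [T2Space M] (hconst : Θ.AlgebraicallyConstant)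
    (hN : Θ.NijenhuisVanishes) (x₀ : M) :
    ∃ (χ : OpenPartialHomeomorph M (EuclideanSpace ℝ (Fin n)))
      (K : Submodule ℝ (EuclideanSpace ℝ (Fin n))),
      IsSmoothCoord (n := n) χ ∧ x₀ ∈ χ.source ∧ ∀ z ∈ χ.source, (Θ.coord χ (χ z)).range = K := by
  let c := chartAt (EuclideanSpace ℝ (Fin n)) x₀
  have hc : IsSmoothCoord (n := n) c :=
    isSmoothCoord_of_mem_maximalAtlas (IsManifold.chart_mem_maximalAtlas x₀)
  have hx₀ : x₀ ∈ c.source := mem_chart_source _ _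
  have hrank (p) (hp : p ∈ c.target) : Module.finrank ℝ (Θ.coord c p).range
      = Module.finrank ℝ (Θ.coord c (c x₀)).range := by
    rw [← c.right_inv hp, Θ.finrank_range_coord hc (c.map_target hp),
      Θ.finrank_range_coord hc hx₀, hconst.finrank_range_eq _ x₀]
  obtain ⟨Φ, hΦ, hpΦ, -, -, hrange⟩ := exists_straightening_range (Θ.contDiffOn_coord hc)
    c.open_target (c.map_source hx₀) hrank (fun p hp => hN.coord_eq hc hp)
  have hχ : IsSmoothCoord (n := n) (c.trans Φ) := hc.trans hΦ
  refine ⟨c.trans Φ, (Θ.coord c (c x₀)).range, hχ, ⟨hx₀, hpΦ⟩, fun z hz => ?_⟩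
  refine Submodule.eq_of_le_of_finrank_eq ?_ ?_
  · rintro - ⟨v, rfl⟩
    obtain ⟨ξ, rfl⟩ : ∃ ξ, coordD (c.trans Φ) z ξ = v := ⟨_, hχ.coordD_inverse hz v⟩
    change Θ.coord (c.trans Φ) ((c.trans Φ) z) (coordD (c.trans Φ) z ξ) ∈ _
    rw [← Θ.coordD_apply hχ hz, hc.coordD_trans hΦ hz, Θ.coordD_apply hc hz.1]
    exact hrange _ hz.2 _
  · rw [Θ.finrank_range_coord hχ hz, Θ.finrank_range_coord hc hx₀, hconst.finrank_range_eq z x₀]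

lemma Tensor11.coord_coord_eq_zero (hsq : ∀ (x : M) (ξ : TangentSpace (𝓡 n) x), Θ x (Θ x ξ) = 0)
    {V : Type*} [NormedAddCommGroup V] [NormedSpace ℝ V] {χ : OpenPartialHomeomorph M V}
    (hχ : IsSmoothCoord (n := n) χ) {z : M} (hz : z ∈ χ.source) (v : V) :
    Θ.coord χ (χ z) (Θ.coord χ (χ z) v) = 0 := by
  rw [← hχ.coordD_inverse hz v, ← Θ.coordD_apply hχ hz, ← Θ.coordD_apply hχ hz, hsq, map_zero]

variable {F E : Type*} [NormedAddCommGroup F] [NormedSpace ℝ F] [NormedAddCommGroup E]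
  [NormedSpace ℝ E]

/-- Coordinates in which the tensor `Θ` is `(f, e) ↦ (0, H f)`. -/
def Tensor11.IsAdapted (Θ : Tensor11 n M) (χ : OpenPartialHomeomorph M (F × E))
    (H : F × E → F →L[ℝ] E) : Prop :=
  ∀ z ∈ χ.source, ∀ ξ : TangentSpace (𝓡 n) z,
    coordD χ z (Θ z ξ) = (0, H (χ z) (coordD χ z ξ).1)

theorem Tensor11.exists_isAdapted [T2Space M] (hconst : Θ.AlgebraicallyConstant)
    (hsq : ∀ (x : M) (ξ : TangentSpace (𝓡 n) x), Θ x (Θ x ξ) = 0) (hN : Θ.NijenhuisVanishes)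
    (x₀ : M) :
    ∃ (m r : ℕ) (χ : OpenPartialHomeomorph M (EuclideanSpace ℝ (Fin m) × EuclideanSpace ℝ (Fin r)))
      (H : EuclideanSpace ℝ (Fin m) × EuclideanSpace ℝ (Fin r) →
        EuclideanSpace ℝ (Fin m) →L[ℝ] EuclideanSpace ℝ (Fin r)),
      n = m + r ∧ IsSmoothCoord (n := n) χ ∧ x₀ ∈ χ.source ∧ Θ.IsAdapted χ H ∧
        Function.Surjective (H (χ x₀)) := by
  obtain ⟨χ, K, hχ, hx₀, hK⟩ := Tensor11.exists_isSmoothCoord_range_coord_eq hconst hN x₀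
  have hKn : Module.finrank ℝ K ≤ n := by simpa using Submodule.finrank_le K
  obtain ⟨L, hL⟩ := exists_equiv_prod_fst_eq_zero_iff K (m := n - Module.finrank ℝ K) rfl
    (by rw [finrank_euclideanSpace_fin]; omega)
  have hLrange (z) (hz : z ∈ χ.source) (v) : (L v).1 = 0 ↔ v ∈ (Θ.coord χ (χ z)).range := by
    rw [hK z hz, hL]
  have hsymm (z : M) : L.symm ((χ.transHomeomorph L.toHomeomorph) z) = χ z :=
    L.symm_apply_apply (χ z)
  refine ⟨_, _, χ.transHomeomorph L.toHomeomorph,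
    fun p => offDiagonalBlock L (Θ.coord χ (L.symm p)), by omega, hχ.transHomeomorph L, hx₀,
    fun z hz ξ => ?_, ?_⟩
  · simp only [hχ.coordD_transHomeomorph L hz, Θ.coordD_apply hχ hz, hsymm]
    exact apply_eq_offDiagonalBlock (hLrange z hz) (coord_coord_eq_zero hsq hχ hz) _
  · simp only [hsymm]
    exact offDiagonalBlock_surjective (hLrange x₀ hx₀) (coord_coord_eq_zero hsq hχ hx₀)

namespace Tensor11.IsAdapted

variable {χ : OpenPartialHomeomorph M (F × E)} {H : F × E → F →L[ℝ] E}

lemma coord_apply (h : Θ.IsAdapted χ H) (hχ : IsSmoothCoord (n := n) χ) {p : F × E}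
    (hp : p ∈ χ.target) (v : F × E) : Θ.coord χ p v = (0, H p v.1) := by
  have hz := χ.map_target hp
  have hΘ := h _ hz ((coordD χ (χ.symm p)).inverse v)
  rwa [Θ.coordD_apply hχ hz, hχ.coordD_inverse hz, χ.right_inv hp] at hΘ

lemma contDiffOn [FiniteDimensional ℝ F] [FiniteDimensional ℝ E] (h : Θ.IsAdapted χ H)
    (hχ : IsSmoothCoord (n := n) χ) : ContDiffOn ℝ ∞ H χ.target := by
  have hblock : ContDiffOn ℝ ∞ (fun p => (ContinuousLinearMap.snd ℝ F E).comp
      ((Θ.coord χ p).comp (ContinuousLinearMap.inl ℝ F E))) χ.target :=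
    contDiffOn_const.clm_comp ((Θ.contDiffOn_coord hχ).clm_comp contDiffOn_const)
  refine hblock.congr fun p hp => ?_
  ext f
  simp [h.coord_apply hχ hp]

lemma fderiv_coord_apply [FiniteDimensional ℝ F] [FiniteDimensional ℝ E] (h : Θ.IsAdapted χ H)
    (hχ : IsSmoothCoord (n := n) χ) {p : F × E} (hp : p ∈ χ.target) (c v : F × E) :
    fderiv ℝ (Θ.coord χ) p c v = (0, fderiv ℝ H p c v.1) := by
  have hdiff {G : Type _} [NormedAddCommGroup G] [NormedSpace ℝ G] {A : F × E → G}
      (hA : ContDiffOn ℝ ∞ A χ.target) : HasFDerivAt A (fderiv ℝ A p) p :=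
    ((hA.contDiffAt (χ.open_target.mem_nhds hp)).differentiableAt (by simp)).hasFDerivAt
  have hcoord := (hdiff (Θ.contDiffOn_coord hχ)).clm_apply (hasFDerivAt_const v p)
  have hblock := (hasFDerivAt_const (0 : F) p).prodMk
    ((hdiff (h.contDiffOn hχ)).clm_apply (hasFDerivAt_const v.1 p))
  have heq : (fun q => Θ.coord χ q v) =ᶠ[𝓝 p] fun q => ((0 : F), H q v.1) := by
    filter_upwards [χ.open_target.mem_nhds hp] with q hq using h.coord_apply hχ hq v
  simpa using congrArg (fun A : F × E →L[ℝ] F × E => A c)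
    (hcoord.unique (hblock.congr_of_eventuallyEq heq))

lemma fderiv_apply_comm [T2Space M] [FiniteDimensional ℝ F] [FiniteDimensional ℝ E]
    (h : Θ.IsAdapted χ H) (hχ : IsSmoothCoord (n := n) χ) (hN : Θ.NijenhuisVanishes) {p : F × E}
    (hp : p ∈ χ.target) (f g : F) :
    fderiv ℝ H p (0, H p f) g = fderiv ℝ H p (0, H p g) f := by
  have hcoord := hN.coord_eq hχ hp (f, 0) (g, 0)
  simp only [h.fderiv_coord_apply hχ hp, h.coord_apply hχ hp, Prod.mk_sub_mk, sub_zero,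
    map_zero] at hcoord
  exact sub_eq_zero.1 (congrArg Prod.snd hcoord).symm

lemma congr {H' : F × E → F →L[ℝ] E} (h : Θ.IsAdapted χ H) (hH : ∀ p ∈ χ.target, H p = H' p) :
    Θ.IsAdapted χ H' := fun z hz ξ => by rw [h z hz ξ, hH _ (χ.map_source hz)]

lemma trans_of_fst_eq (h : Θ.IsAdapted χ H) (hχ : IsSmoothCoord (n := n) χ)
    {Φ : OpenPartialHomeomorph (F × E) (F × E)} (hΦ : IsSmoothCoordChange Φ)
    (hfst : ∀ p ∈ Φ.source, (Φ p).1 = p.1) :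
    Θ.IsAdapted (χ.trans Φ) fun q => (ContinuousLinearMap.snd ℝ F E).comp
      ((fderiv ℝ Φ (Φ.symm q)).comp
        ((ContinuousLinearMap.inr ℝ F E).comp (H (Φ.symm q)))) := by
  have hfderiv_fst (p) (hp : p ∈ Φ.source) (v : F × E) : (fderiv ℝ Φ p v).1 = v.1 := by
    have heq : (fun q => (Φ q).1) =ᶠ[𝓝 p] Prod.fst := by
      filter_upwards [Φ.open_source.mem_nhds hp] with q hq using hfst q hq
    exact congrArg (fun A : F × E →L[ℝ] F => A v)
      ((hΦ.hasFDerivAt hp).fst.unique (hasFDerivAt_fst.congr_of_eventuallyEq heq))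
  intro z hz ξ
  have hsymm : Φ.symm ((χ.trans Φ) z) = χ z := Φ.left_inv hz.2
  simp only [hχ.coordD_trans hΦ hz, h z hz.1, hsymm]
  exact Prod.ext (hfderiv_fst _ hz.2 _) <|
    congrArg (fun f => (fderiv ℝ Φ (χ z) (0, H (χ z) f)).2) (hfderiv_fst _ hz.2 _).symm

lemma exists_rightInverse [T2Space M] {F E : Type v} [NormedAddCommGroup F] [NormedSpace ℝ F]
    [NormedAddCommGroup E] [NormedSpace ℝ E] [FiniteDimensional ℝ F] [FiniteDimensional ℝ E]
    {χ : OpenPartialHomeomorph M (F × E)} {H : F × E → F →L[ℝ] E} (h : Θ.IsAdapted χ H)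
    (hχ : IsSmoothCoord (n := n) χ) (hN : Θ.NijenhuisVanishes) {x₀ : M} (hx₀ : x₀ ∈ χ.source)
    (hsurj : Function.Surjective (H (χ x₀))) :
    ∃ (χ' : OpenPartialHomeomorph M (F × E)) (H' : F × E → F →L[ℝ] E) (S : E →L[ℝ] F),
      IsSmoothCoord (n := n) χ' ∧ x₀ ∈ χ'.source ∧ Θ.IsAdapted χ' H' ∧
        ∀ p ∈ χ'.target, ∀ e, H' p (S e) = e := by
  obtain ⟨S, hS⟩ := (H (χ x₀)).exists_rightInverse_of_surjective (LinearMap.range_eq_top.2 hsurj)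
  obtain ⟨Φ, hΦ, hpΦ, -, -, hΦS, hΦfst⟩ := exists_straightening_vertical (h.contDiffOn hχ)
    χ.open_target (χ.map_source hx₀) (fun p hp => h.fderiv_apply_comm hχ hN hp)
    (DFunLike.congr_fun hS)
  exact ⟨χ.trans Φ, _, S, hχ.trans hΦ, ⟨hx₀, hpΦ⟩, h.trans_of_fst_eq hχ hΦ hΦfst,
    fun q hq e => congrArg Prod.snd (hΦS _ (Φ.map_target hq.1) e)⟩

end Tensor11.IsAdapted

end AdaptedCoordinates

section NormalForm

variable {n : ℕ} {M : Type u} [TopologicalSpace M] [ChartedSpace (EuclideanSpace ℝ (Fin n)) M]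

lemma IsSmoothCoordChange.prod_ofSet {F F' E : Type*} [NormedAddCommGroup F] [NormedSpace ℝ F]
    [NormedAddCommGroup F'] [NormedSpace ℝ F'] [NormedAddCommGroup E] [NormedSpace ℝ E]
    {Φ : OpenPartialHomeomorph F F'} (hΦ : IsSmoothCoordChange Φ) {s : Set E} (hs : IsOpen s) :
    IsSmoothCoordChange (Φ.prod (OpenPartialHomeomorph.ofSet s hs)) where
  contDiffOn := hΦ.contDiffOn.prodMap contDiffOn_id
  contDiffOn_symm := hΦ.contDiffOn_symm.prodMap contDiffOn_id

variable [IsManifold (𝓡 n) ∞ M] {Θ : Tensor11 n M}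

lemma Tensor11.IsAdapted.trans_prod_ofSet {F F' E : Type*} [NormedAddCommGroup F]
    [NormedSpace ℝ F] [NormedAddCommGroup F'] [NormedSpace ℝ F'] [NormedAddCommGroup E]
    [NormedSpace ℝ E] {χ : OpenPartialHomeomorph M (F × E)} {H : F × E → F →L[ℝ] E}
    (h : Θ.IsAdapted χ H) (hχ : IsSmoothCoord (n := n) χ) {Φ : OpenPartialHomeomorph F F'}
    (hΦ : IsSmoothCoordChange Φ) {s : Set E} (hs : IsOpen s) :
    Θ.IsAdapted (χ.trans (Φ.prod (OpenPartialHomeomorph.ofSet s hs)))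
      fun p => (H (Φ.symm p.1, p.2)).comp (fderiv ℝ Φ.symm p.1) := by
  intro z hz ξ
  have hz₁ : (χ z).1 ∈ Φ.source := hz.2.1
  have hfderiv (v : F × E) : fderiv ℝ (Φ.prod (OpenPartialHomeomorph.ofSet s hs)) (χ z) v
      = (fderiv ℝ Φ (χ z).1 v.1, v.2) :=
    congrArg (fun A : F × E →L[ℝ] F' × E => A v)
      (((hΦ.hasFDerivAt hz₁).comp (χ z) hasFDerivAt_fst).prodMk hasFDerivAt_snd).fderiv
  rw [hχ.coordD_trans (hΦ.prod_ofSet hs) hz, hχ.coordD_trans (hΦ.prod_ofSet hs) hz, h z hz.1,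
    hfderiv, hfderiv]
  change (_, H (χ z) _) = (0, H (Φ.symm (Φ (χ z).1), (χ z).2) (fderiv ℝ Φ.symm (Φ (χ z).1)
    (fderiv ℝ Φ (χ z).1 (coordD χ z ξ).1)))
  rw [Φ.left_inv hz₁, hΦ.fderiv_symm_fderiv_apply hz₁, map_zero]

/-- Coordinates in which `Θ` has the normal form `(f, e) ↦ (0, G y f)`, where the first coordinate
`y` ranges over the whole of `F` and `T y` is a right inverse of `G y`. -/
structure Tensor11.IsNormalForm {F E : Type*} [NormedAddCommGroup F] [NormedSpace ℝ F]
    [NormedAddCommGroup E] [NormedSpace ℝ E] (Θ : Tensor11 n M)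
    (χ : OpenPartialHomeomorph M (F × E)) (G : F → F →L[ℝ] E) (T : F → E →L[ℝ] F) : Prop where
  isSmoothCoord : IsSmoothCoord (n := n) χ
  isAdapted : Θ.IsAdapted χ fun p => G p.1
  contDiff : ContDiff ℝ ∞ G
  contDiff_rightInverse : ContDiff ℝ ∞ T
  apply_rightInverse : ∀ y e, G y (T y e) = e
  exists_fst_eq : ∀ y, ∃ z ∈ χ.source, (χ z).1 = y

lemma isSmoothCoordChange_univBall_symm {F : Type*} [NormedAddCommGroup F]
    [InnerProductSpace ℝ F] (y : F) {ε : ℝ} (hε : 0 < ε) :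
    IsSmoothCoordChange (OpenPartialHomeomorph.univBall y ε).symm where
  contDiffOn := by
    rw [OpenPartialHomeomorph.symm_source, OpenPartialHomeomorph.univBall_target y hε]
    exact OpenPartialHomeomorph.contDiffOn_univBall_symm
  contDiffOn_symm := OpenPartialHomeomorph.contDiff_univBall.contDiffOn

lemma Tensor11.IsAdapted.isNormalForm_univBall [T2Space M] {F E : Type*} [NormedAddCommGroup F]
    [InnerProductSpace ℝ F] [FiniteDimensional ℝ F] [NormedAddCommGroup E] [NormedSpace ℝ E]
    [FiniteDimensional ℝ E] {χ : OpenPartialHomeomorph M (F × E)} {H : F × E → F →L[ℝ] E}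
    (h : Θ.IsAdapted χ H) (hχ : IsSmoothCoord (n := n) χ) (hN : Θ.NijenhuisVanishes)
    {S : E →L[ℝ] F} (hS : ∀ p ∈ χ.target, ∀ e, H p (S e) = e) {y₀ : F} {z₀ : E} {ε : ℝ}
    (hε : 0 < ε) (hB : Metric.ball y₀ ε ×ˢ Metric.ball z₀ ε ⊆ χ.target) :
    let g := OpenPartialHomeomorph.univBall y₀ ε
    Θ.IsNormalForm (χ.trans (g.symm.prod (OpenPartialHomeomorph.ofSet (Metric.ball z₀ ε)
      Metric.isOpen_ball)))
      (fun y => (H (g y, z₀)).comp (fderiv ℝ g y))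
      (fun y => (fderiv ℝ g.symm (g y)).comp S) := by
  intro g
  have hg : IsSmoothCoordChange g.symm := isSmoothCoordChange_univBall_symm y₀ hε
  have hgd : ContDiff ℝ ∞ g := OpenPartialHomeomorph.contDiff_univBall
  have hg_symm (y : F) : g.symm (g y) = y := g.left_inv (by simp [g])
  have hg_mem (y : F) : g y ∈ g.symm.source := g.map_source (by simp [g])
  have hsource : g.symm.source = Metric.ball y₀ ε := OpenPartialHomeomorph.univBall_target y₀ hε
  have hgB (y : F) {z : E} (hz : z ∈ Metric.ball z₀ ε) : (g y, z) ∈ χ.target :=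
    hB ⟨hsource ▸ hg_mem y, hz⟩
  have hz₀ : z₀ ∈ Metric.ball z₀ ε := Metric.mem_ball_self hε
  refine ⟨hχ.trans (hg.prod_ofSet _), (h.trans_prod_ofSet hχ hg _).congr ?_, ?_, ?_,
    fun y e => ?_, fun y => ?_⟩
  · intro p hp
    have hconst := eq_of_fst_eq_of_rightInverse (Metric.isOpen_ball.prod Metric.isOpen_ball)
      ((convex_ball y₀ ε).prod (convex_ball z₀ ε)) ((h.contDiffOn hχ).mono hB |>.differentiableOn
      (by simp)) (fun p hp => h.fderiv_apply_comm hχ hN (hB hp)) (fun p hp => hS p (hB hp))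
      (y := g p.1) (z := p.2) (z' := z₀) ⟨hsource ▸ hg_mem _, hp.1.2⟩ ⟨hsource ▸ hg_mem _, hz₀⟩
    exact congrArg (fun A : F →L[ℝ] E => A.comp (fderiv ℝ g p.1)) hconst
  · exact ((h.contDiffOn hχ).comp_contDiff (hgd.prodMk contDiff_const) fun y => hgB y hz₀).clm_comp
      (hgd.fderiv_right (m := ∞) (by simp))
  · exact ((hg.contDiffOn.fderiv_of_isOpen (m := ∞) g.open_target (by simp)).comp_contDiff hgd
      hg_mem).clm_comp contDiff_const
  · have hinv := hg.fderiv_symm_fderiv_apply (hg_mem y) (S e)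
    rw [hg_symm, g.symm_symm] at hinv
    simp only [ContinuousLinearMap.comp_apply, hinv, hS _ (hgB y hz₀)]
  · exact ⟨χ.symm (g y, z₀), ⟨χ.map_target (hgB y hz₀), by
      simpa [χ.right_inv (hgB y hz₀)] using ⟨hg_mem y, hε⟩⟩, by
      simpa [χ.right_inv (hgB y hz₀)] using hg_symm y⟩

theorem Tensor11.IsAdapted.exists_isNormalForm [T2Space M] {F E : Type*} [NormedAddCommGroup F]
    [InnerProductSpace ℝ F] [FiniteDimensional ℝ F] [NormedAddCommGroup E] [NormedSpace ℝ E]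
    [FiniteDimensional ℝ E] {χ : OpenPartialHomeomorph M (F × E)} {H : F × E → F →L[ℝ] E}
    (h : Θ.IsAdapted χ H) (hχ : IsSmoothCoord (n := n) χ) (hN : Θ.NijenhuisVanishes) {x₀ : M}
    (hx₀ : x₀ ∈ χ.source) {S : E →L[ℝ] F} (hS : ∀ p ∈ χ.target, ∀ e, H p (S e) = e) :
    ∃ (χ' : OpenPartialHomeomorph M (F × E)) (G : F → F →L[ℝ] E) (T : F → E →L[ℝ] F),
      Θ.IsNormalForm χ' G T ∧ x₀ ∈ χ'.source ∧ IsConnected χ'.source := by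
  obtain ⟨ε, hε, hB⟩ := Metric.isOpen_iff.1 χ.open_target _ (χ.map_source hx₀)
  rw [← ball_prod_same] at hB
  let Ψ := (OpenPartialHomeomorph.univBall (χ x₀).1 ε).symm.prod
    (OpenPartialHomeomorph.ofSet (Metric.ball (χ x₀).2 ε) Metric.isOpen_ball)
  have hsource : Ψ.source = Metric.ball (χ x₀).1 ε ×ˢ Metric.ball (χ x₀).2 ε := by
    simp [Ψ, OpenPartialHomeomorph.univBall_target _ hε]
  refine ⟨_, _, _, h.isNormalForm_univBall hχ hN hS hε hB, ⟨hx₀, ?_⟩, ?_⟩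
  · change χ x₀ ∈ Ψ.source
    rw [hsource]
    exact ⟨Metric.mem_ball_self hε, Metric.mem_ball_self hε⟩
  · have himage : (χ.trans Ψ).source = χ.symm '' Ψ.source := by
      rw [OpenPartialHomeomorph.trans_source, ← χ.symm_image_eq_source_inter_preimage]
      exact hsource ▸ hB
    rw [himage, hsource]
    exact (((convex_ball _ ε).isConnected ⟨_, Metric.mem_ball_self hε⟩).prod
      ((convex_ball _ ε).isConnected ⟨_, Metric.mem_ball_self hε⟩)).image _
      (χ.continuousOn_symm.mono hB)

end NormalForm

section KernelBundle

lemma smoothFieldOn_of_contDiffOn {m : ℕ}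
    {X : EuclideanSpace ℝ (Fin m) → EuclideanSpace ℝ (Fin m)} {W : Set (EuclideanSpace ℝ (Fin m))}
    (hX : ContDiffOn ℝ ∞ X W) : SmoothFieldOn (n := m) X W :=
  contMDiffOn_vectorSpace_iff_contDiffOn.2 hX

variable {n m r : ℕ}
  {G : EuclideanSpace ℝ (Fin m) → EuclideanSpace ℝ (Fin m) →L[ℝ] EuclideanSpace ℝ (Fin r)}
  {T : EuclideanSpace ℝ (Fin m) → EuclideanSpace ℝ (Fin r) →L[ℝ] EuclideanSpace ℝ (Fin m)}

/-- The distribution on a Euclidean space formed by the kernels of a smooth family of surjective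
linear maps. -/
def kernelDistribution (hG : ContDiff ℝ ∞ G) (hsurj : ∀ y, Function.Surjective (G y)) :
    SmoothDistribution m (EuclideanSpace ℝ (Fin m)) where
  space y := (G y).ker
  exists_local_frame y₀ := by
    obtain ⟨W, -, hW, hy₀, J, P, hJ, hJP⟩ := exists_contDiffOn_frame_ker hG.contDiffOn isOpen_univ
      (mem_univ y₀) (LinearMap.range_eq_top.2 (hsurj y₀))
    let b := Module.finBasis ℝ (G y₀).ker
    refine ⟨_, W, fun i y => J y (b i), hW, hy₀,
      fun i => smoothFieldOn_of_contDiffOn (hJ.clm_apply contDiffOn_const), fun y hy => ?_⟩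
    obtain ⟨hP, hrange⟩ := hJP y hy
    have hker : (J y).ker = ⊥ := LinearMap.ker_eq_bot.2 (Function.LeftInverse.injective hP)
    refine ⟨b.linearIndependent.map' (J y).toLinearMap hker, ?_⟩
    calc Submodule.span ℝ (range (J y ∘ b))
        = (Submodule.span ℝ (range b)).map (J y).toLinearMap := by
          rw [range_comp, Submodule.map_span, ContinuousLinearMap.coe_coe]
      _ = (G y).ker := by rw [b.span_eq, Submodule.map_top, hrange]

/-- The quotient by the kernel of a surjective linear map, identified with its target. -/
def kernelDistribution.quotEquiv (hG : ContDiff ℝ ∞ G) (hsurj : ∀ y, Function.Surjective (G y))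
    (y : EuclideanSpace ℝ (Fin m)) :
    (kernelDistribution hG hsurj).Quot y ≃ₗ[ℝ] EuclideanSpace ℝ (Fin r) :=
  (G y).toLinearMap.quotKerEquivOfSurjective (hsurj y)

lemma kernelDistribution.quotEquiv_mkQ (hG : ContDiff ℝ ∞ G)
    (hsurj : ∀ y, Function.Surjective (G y)) (y η : EuclideanSpace ℝ (Fin m)) :
    quotEquiv hG hsurj y (((kernelDistribution hG hsurj).space y).mkQ η) = G y η :=
  rfl

lemma kernelDistribution.mkQ_eq_quotEquiv_symm (hG : ContDiff ℝ ∞ G)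
    (hGT : ∀ y, Function.RightInverse (T y) (G y)) (y : EuclideanSpace ℝ (Fin m))
    (e : EuclideanSpace ℝ (Fin r)) :
    ((kernelDistribution hG fun y => (hGT y).surjective).space y).mkQ (T y e)
      = (quotEquiv hG (fun y => (hGT y).surjective) y).symm e := by
  rw [LinearEquiv.eq_symm_apply, quotEquiv_mkQ, hGT y]

/-- A fibre of the first component of `L : V ≃ F × E`, as an affine space over a module `Q`
identified with `E`. -/
abbrev fibreTorsor {V F E Q : Type*} [NormedAddCommGroup V] [NormedSpace ℝ V]
    [NormedAddCommGroup F] [NormedSpace ℝ F] [NormedAddCommGroup E] [NormedSpace ℝ E]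
    [AddCommGroup Q] [Module ℝ Q] (L : V ≃L[ℝ] F × E) (A : Q ≃ₗ[ℝ] E) (y : F) :
    AddTorsor Q {p : V // (L p).1 = y} where
  vadd q p := ⟨p.1 + L.symm (0, A q), by simp [p.2]⟩
  zero_vadd p := Subtype.ext <| by
    change p.1 + L.symm (0, A 0) = p.1
    rw [map_zero, ← Prod.zero_eq_mk, map_zero, add_zero]
  add_vadd q q' p := Subtype.ext <| by
    change p.1 + L.symm (0, A (q + q')) = p.1 + L.symm (0, A q') + L.symm (0, A q)
    rw [map_add, add_assoc, ← map_add L.symm, Prod.mk_add_mk, add_zero, add_comm (A q)]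
  vsub p p' := A.symm ((L p.1).2 - (L p'.1).2)
  nonempty := ⟨⟨L.symm (y, 0), by simp⟩⟩
  vsub_vadd' p p' := Subtype.ext <| L.injective <| by
    change L (p'.1 + L.symm (0, A (A.symm ((L p.1).2 - (L p'.1).2)))) = L p.1
    rw [A.apply_symm_apply, map_add, L.apply_symm_apply]
    exact Prod.ext (by simp [p.2, p'.2]) (by simp)
  vadd_vsub' q p := by
    change A.symm ((L (p.1 + L.symm (0, A q))).2 - (L p.1).2) = q
    simp

variable (hG : ContDiff ℝ ∞ G) (hT : ContDiff ℝ ∞ T) (hGT : ∀ y, Function.RightInverse (T y) (G y))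
  (L : EuclideanSpace ℝ (Fin n) ≃L[ℝ] EuclideanSpace ℝ (Fin m) × EuclideanSpace ℝ (Fin r))

/-- The trivial affine bundle associated with the quotient by the distribution of kernels of `G`,
its projection being the first component of `L`. -/
def kernelBundle : AffineQuotientBundle n (kernelDistribution hG fun y => (hGT y).surjective) where
  Total := EuclideanSpace ℝ (Fin n)
  proj p := (L p).1
  torsor y := fibreTorsor L (kernelDistribution.quotEquiv hG _ y) y
  locally_trivial y₀ := by
    let D := kernelDistribution hG fun y => (hGT y).surjective
    let A := kernelDistribution.quotEquiv hG fun y => (hGT y).surjective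
    let b := (EuclideanSpace.basisFun (Fin r) ℝ).toBasis
    have hb (y) (i) : (D.space y).mkQ (T y (b i)) = (b.map (A y).symm) i :=
      kernelDistribution.mkQ_eq_quotEquiv_symm hG hGT y (b i)
    refine ⟨r, univ, fun y => ⟨L.symm (y, 0), by simp⟩, fun i y => T y (b i),
      L.toHomeomorph.toOpenPartialHomeomorph, isOpen_univ, trivial,
      fun i => smoothFieldOn_of_contDiffOn (hT.clm_apply contDiff_const).contDiffOn,
      fun y _ => ?_, rfl, univ_prod_univ.symm, ?_, ?_, fun y _ c => ?_⟩
    · rw [show (fun i => (D.space y).mkQ (T y (b i))) = b.map (A y).symm from funext (hb y)]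
      exact ⟨Module.Basis.linearIndependent _, Module.Basis.span_eq _⟩
    · exact (((ContinuousLinearMap.fst ℝ _ _).contDiff.comp L.contDiff).contMDiff.prodMk
        ((ContinuousLinearMap.snd ℝ _ _).contDiff.comp L.contDiff).contMDiff).contMDiffOn
    · have hinl := (L.symm.contDiff (n := ∞)).comp
        (ContinuousLinearMap.inl ℝ _ _).contDiff |>.contMDiff
      have hinr := (L.symm.contDiff (n := ∞)).comp
        (ContinuousLinearMap.inr ℝ _ _).contDiff |>.contMDiff
      exact ((hinl.comp contMDiff_fst).add (hinr.comp contMDiff_snd)).contMDiffOn.congr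
        fun q _ => by simp [← map_add]
    · have hc : A y (∑ i, c i • (D.space y).mkQ (T y (b i))) = c := by
        simp only [map_sum, map_smul, D, A, kernelDistribution.quotEquiv_mkQ, hGT y _]
        exact b.sum_repr c
      change L.symm (y, c)
        = L.symm (y, 0) + L.symm (0, A y (∑ i, c i • (D.space y).mkQ (T y (b i))))
      rw [hc, ← map_add, Prod.mk_add_mk, add_zero, zero_add]

lemma kernelBundle_vertical (p : EuclideanSpace ℝ (Fin n))
    (q : (kernelDistribution hG fun y => (hGT y).surjective).Quot (L p).1) :
    (kernelBundle hG hT hGT L).vertical p q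
      = L.symm (0, kernelDistribution.quotEquiv hG _ _ q) := by
  let v : EuclideanSpace ℝ (Fin n) := L.symm (0, kernelDistribution.quotEquiv hG _ _ q)
  have hline : (kernelBundle hG hT hGT L).fibreLine p q = fun t : ℝ => p + t • v := by
    funext t
    change p + L.symm (0, kernelDistribution.quotEquiv hG _ _ (t • q)) = _
    rw [map_smul, ← map_smul L.symm, Prod.smul_mk, smul_zero]
  have hderiv : HasFDerivAt (fun t : ℝ => p + t • v)
      ((ContinuousLinearMap.id ℝ ℝ).smulRight v) 0 :=
    ((hasFDerivAt_id (0 : ℝ)).smul_const v).const_add p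
  have hvertical : mfderiv 𝓘(ℝ, ℝ) (𝓡 n) (fun t : ℝ => p + t • v) 0 (1 : ℝ) = (1 : ℝ) • v :=
    DFunLike.congr_fun hderiv.hasMFDerivAt.mfderiv (1 : ℝ)
  exact (congrArg (fun γ => mfderiv 𝓘(ℝ, ℝ) (𝓡 n) γ 0 (1 : ℝ)) hline).trans
    (hvertical.trans (one_smul ℝ v))

lemma kernelBundle_tensor (p ξ : EuclideanSpace ℝ (Fin n)) :
    (kernelBundle hG hT hGT L).tensor p ξ = L.symm (0, G (L p).1 (L ξ).1) := by
  have hproj : HasFDerivAt (fun p => (L p).1)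
      ((ContinuousLinearMap.fst ℝ _ _).comp L.toContinuousLinearMap) p :=
    ((ContinuousLinearMap.fst ℝ _ _).comp L.toContinuousLinearMap).hasFDerivAt
  have hdproj : mfderiv (𝓡 n) (𝓡 m) (fun p => (L p).1) p ξ = (L ξ).1 :=
    DFunLike.congr_fun hproj.hasMFDerivAt.mfderiv ξ
  exact (kernelBundle_vertical hG hT hGT L p _).trans
    (congrArg (fun η => L.symm (0, G (L p).1 η)) hdproj)

end KernelBundle

section Realization

variable {n : ℕ} {M : Type u} [TopologicalSpace M] [ChartedSpace (EuclideanSpace ℝ (Fin n)) M]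
  [IsManifold (𝓡 n) ∞ M] {Θ : Tensor11 n M}

/-- The local realization through a trivial affine bundle provided by a normal form of `Θ`. -/
def Tensor11.IsNormalForm.localRealization {m r : ℕ}
    {χ : OpenPartialHomeomorph M (EuclideanSpace ℝ (Fin m) × EuclideanSpace ℝ (Fin r))}
    {G : EuclideanSpace ℝ (Fin m) → EuclideanSpace ℝ (Fin m) →L[ℝ] EuclideanSpace ℝ (Fin r)}
    {T : EuclideanSpace ℝ (Fin m) → EuclideanSpace ℝ (Fin r) →L[ℝ] EuclideanSpace ℝ (Fin m)}
    (h : Θ.IsNormalForm χ G T)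
    (L : EuclideanSpace ℝ (Fin n) ≃L[ℝ] EuclideanSpace ℝ (Fin m) × EuclideanSpace ℝ (Fin r)) :
    LocalRealization.{u, 0} Θ where
  baseDim := m
  Base := EuclideanSpace ℝ (Fin m)
  dist := kernelDistribution h.contDiff fun y => Function.RightInverse.surjective
    (h.apply_rightInverse y)
  bundle := kernelBundle h.contDiff h.contDiff_rightInverse h.apply_rightInverse L
  φ := χ.transHomeomorph L.symm.toHomeomorph
  smooth_φ := (h.isSmoothCoord.transHomeomorph L.symm).smooth
  smooth_φ_symm := (h.isSmoothCoord.transHomeomorph L.symm).smooth_symm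
  meets_fibres y := by
    obtain ⟨z, hz, rfl⟩ := h.exists_fst_eq y
    exact ⟨z, hz, congrArg Prod.fst (L.apply_symm_apply (χ z))⟩
  map_tensor z hz ξ := by
    have hχ := h.isSmoothCoord
    have hΘ : coordD (χ.transHomeomorph L.symm.toHomeomorph) z (Θ z ξ)
        = L.symm (0, G (L (L.symm (χ z))).1 (L (L.symm (coordD χ z ξ))).1) := by
      rw [hχ.coordD_transHomeomorph L.symm hz, h.isAdapted z hz, L.apply_symm_apply,
        L.apply_symm_apply]
    rw [← hχ.coordD_transHomeomorph L.symm hz] at hΘ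
    exact hΘ.trans (kernelBundle_tensor _ h.contDiff_rightInverse h.apply_rightInverse L _ _).symm

theorem Tensor11.exists_localRealization [T2Space M] (hconst : Θ.AlgebraicallyConstant)
    (hsq : ∀ (x : M) (ξ : TangentSpace (𝓡 n) x), Θ x (Θ x ξ) = 0) (hN : Θ.NijenhuisVanishes)
    (x : M) : ∃ R : LocalRealization.{u, 0} Θ, x ∈ R.φ.source ∧ IsConnected R.φ.source := by
  obtain ⟨m, r, χ₀, H₀, hn, hχ₀, hx₀, hH₀, hsurj⟩ := exists_isAdapted hconst hsq hN x
  obtain ⟨χ₁, H₁, S, hχ₁, hx₁, hH₁, hS⟩ := hH₀.exists_rightInverse hχ₀ hN hx₀ hsurj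
  obtain ⟨χ, G, T, hnf, hx, hconn⟩ := hH₁.exists_isNormalForm hχ₁ hN hx₁ hS
  exact ⟨hnf.localRealization (ContinuousLinearEquiv.ofFinrankEq (by simp [hn])), hx, hconn⟩

end Realization

section AffineBundleCoordinates

lemma exists_clm_mkQ_eq_sum_smul {V : Type*} [NormedAddCommGroup V] [NormedSpace ℝ V]
    [FiniteDimensional ℝ V] {K : Submodule ℝ V} {r : ℕ} {X : Fin r → V}
    (hli : LinearIndependent ℝ fun i => K.mkQ (X i))
    (hspan : Submodule.span ℝ (range fun i => K.mkQ (X i)) = ⊤) :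
    ∃ Q : V →L[ℝ] EuclideanSpace ℝ (Fin r), Function.Surjective Q ∧ (∀ v, v ∈ K ↔ Q v = 0) ∧
      ∀ v, K.mkQ v = ∑ i, Q v i • K.mkQ (X i) := by
  let b : Module.Basis (Fin r) ℝ (V ⧸ K) := Module.Basis.mk hli hspan.ge
  let coords : (V ⧸ K) ≃ₗ[ℝ] EuclideanSpace ℝ (Fin r) :=
    b.equivFun.trans (WithLp.linearEquiv 2 ℝ (Fin r → ℝ)).symm
  refine ⟨LinearMap.toContinuousLinearMap (coords.toLinearMap.comp K.mkQ),
    coords.surjective.comp (Submodule.mkQ_surjective K), fun v => ?_, fun v => ?_⟩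
  · exact (Submodule.Quotient.mk_eq_zero K).symm.trans (LinearEquiv.map_eq_zero_iff coords).symm
  · have hsum := (b.sum_equivFun (K.mkQ v)).symm
    simp only [b, Module.Basis.mk_apply] at hsum
    exact hsum

namespace AffineQuotientBundle

variable {n m r : ℕ} {B : Type v} [TopologicalSpace B]
  [ChartedSpace (EuclideanSpace ℝ (Fin m)) B] [IsManifold (𝓡 m) ∞ B] {D : SmoothDistribution m B}

/-- A local trivialization `e` over `W` of an affine bundle, given by a section `s` and vector
fields `X i` inducing a frame of the quotient bundle. -/
structure IsTrivialization (A : AffineQuotientBundle n D) (W : Set B)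
    (s : ∀ y : B, {p : A.Total // A.proj p = y}) (X : Fin r → ∀ y : B, TangentSpace (𝓡 m) y)
    (e : OpenPartialHomeomorph A.Total (B × EuclideanSpace ℝ (Fin r))) : Prop where
  linearIndependent : ∀ y ∈ W, LinearIndependent ℝ fun i => (D.space y).mkQ (X i y)
  span_eq_top : ∀ y ∈ W, Submodule.span ℝ (range fun i => (D.space y).mkQ (X i y)) = ⊤
  source_eq : e.source = A.proj ⁻¹' W
  target_eq : e.target = W ×ˢ univ
  smooth : ContMDiffOn (𝓡 n) ((𝓡 m).prod (𝓡 r)) ∞ e e.source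
  smooth_symm : ContMDiffOn ((𝓡 m).prod (𝓡 r)) (𝓡 n) ∞ e.symm e.target
  symm_apply : ∀ y ∈ W, ∀ c : EuclideanSpace ℝ (Fin r),
    e.symm (y, c) = ((∑ i, c i • (D.space y).mkQ (X i y)) +ᵥ s y : {p : A.Total // A.proj p = y})

/-- Coordinates on the total space obtained from coordinates `κ` on the base and a
trivialization `e`. -/
def trivializationCoord {P B F V : Type*} [TopologicalSpace P] [TopologicalSpace B]
    [TopologicalSpace F] [TopologicalSpace V] (e : OpenPartialHomeomorph P (B × F))
    (κ : OpenPartialHomeomorph B V) : OpenPartialHomeomorph P (V × F) :=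
  e.trans (κ.prod (OpenPartialHomeomorph.refl F))

namespace IsTrivialization

variable {A : AffineQuotientBundle n D} {W : Set B} {s : ∀ y : B, {p : A.Total // A.proj p = y}}
  {X : Fin r → ∀ y : B, TangentSpace (𝓡 m) y}
  {e : OpenPartialHomeomorph A.Total (B × EuclideanSpace ℝ (Fin r))}
  {κ : OpenPartialHomeomorph B (EuclideanSpace ℝ (Fin m))} {p : A.Total}

lemma proj_mem (h : A.IsTrivialization W s X e) (hp : p ∈ e.source) : A.proj p ∈ W := by
  rwa [h.source_eq] at hp

lemma fst_apply (h : A.IsTrivialization W s X e) (hp : p ∈ e.source) : (e p).1 = A.proj p := by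
  have hmem : (e p).1 ∈ W := by
    have := e.map_source hp
    rw [h.target_eq] at this
    exact this.1
  have hsymm := h.symm_apply (e p).1 hmem (e p).2
  rw [Prod.mk.eta, e.left_inv hp] at hsymm
  have hproj (y : B) (q : {p : A.Total // A.proj p = y}) : A.proj q = y := q.2
  exact ((congrArg A.proj hsymm).trans (hproj _ _)).symm

lemma mdifferentiableAt_proj (h : A.IsTrivialization W s X e) (hp : p ∈ e.source) :
    MDifferentiableAt (𝓡 n) (𝓡 m) A.proj p := by
  have hfst : MDifferentiableAt (𝓡 n) (𝓡 m) (fun p => (e p).1) p :=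
    (contMDiff_fst.contMDiffAt.comp p
      (h.smooth.contMDiffAt (e.open_source.mem_nhds hp))).mdifferentiableAt (by simp)
  refine hfst.congr_of_eventuallyEq ?_
  filter_upwards [e.open_source.mem_nhds hp] with q hq using (h.fst_apply hq).symm

lemma fibreLine_eq (h : A.IsTrivialization W s X e) (hp : p ∈ e.source)
    (c : EuclideanSpace ℝ (Fin r)) (t : ℝ) :
    A.fibreLine p (∑ i, c i • (D.space (A.proj p)).mkQ (X i (A.proj p))) t
      = e.symm (A.proj p, (e p).2 + t • c) := by
  have hp' : (⟨p, rfl⟩ : {p' : A.Total // A.proj p' = A.proj p}) =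
      (∑ i, (e p).2 i • (D.space (A.proj p)).mkQ (X i (A.proj p))) +ᵥ s (A.proj p) := by
    refine Subtype.ext ?_
    rw [← h.symm_apply _ (h.proj_mem hp)]
    change p = e.symm (A.proj p, (e p).2)
    rw [← h.fst_apply hp, Prod.mk.eta, e.left_inv hp]
  rw [fibreLine, hp', vadd_vadd, h.symm_apply _ (h.proj_mem hp)]
  congr 2
  simp only [PiLp.add_apply, PiLp.smul_apply, add_smul, Finset.sum_add_distrib, Finset.smul_sum,
    smul_assoc]
  exact add_comm _ _

lemma trivializationCoord_fst (h : A.IsTrivialization W s X e)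
    (hp : p ∈ (trivializationCoord e κ).source) :
    (trivializationCoord e κ p).1 = κ (A.proj p) :=
  congrArg κ (h.fst_apply hp.1)

lemma proj_mem_source (h : A.IsTrivialization W s X e)
    (hp : p ∈ (trivializationCoord e κ).source) : A.proj p ∈ κ.source :=
  h.fst_apply hp.1 ▸ hp.2.1

lemma isSmoothCoord (h : A.IsTrivialization W s X e) (hκ : IsSmoothCoord (n := m) κ) :
    IsSmoothCoord (n := n) (trivializationCoord e κ) where
  smooth :=
    have he := h.smooth.mono inter_subset_left
    (hκ.smooth.comp (contMDiff_fst.comp_contMDiffOn he) fun _ hp => hp.2.1).prodMk_space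
      (contMDiff_snd.comp_contMDiffOn he)
  smooth_symm :=
    h.smooth_symm.comp (t := e.target)
      ((hκ.smooth_symm.comp contDiff_fst.contMDiff.contMDiffOn fun _ hp => hp.1.1).prodMk
        contDiff_snd.contMDiff.contMDiffOn) fun _ hp => hp.2

lemma coordD_fst (h : A.IsTrivialization W s X e) (hκ : IsSmoothCoord (n := m) κ)
    (hp : p ∈ (trivializationCoord e κ).source) (ξ : TangentSpace (𝓡 n) p) :
    (coordD (trivializationCoord e κ) p ξ).1
      = coordD κ (A.proj p) (mfderiv (𝓡 n) (𝓡 m) A.proj p ξ) := by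
  let ψ := trivializationCoord e κ
  have hfst : HasMFDerivAt (𝓡 n) 𝓘(ℝ, EuclideanSpace ℝ (Fin m)) (fun q => (ψ q).1) p
      ((ContinuousLinearMap.fst ℝ _ _).comp (coordD ψ p)) :=
    (hasFDerivAt_fst (𝕜 := ℝ) (p := ψ p)).hasMFDerivAt.comp p
      ((h.isSmoothCoord hκ).hasMFDerivAt hp)
  have hproj := (hκ.hasMFDerivAt (h.proj_mem_source hp)).comp p
    (h.mdifferentiableAt_proj hp.1).hasMFDerivAt
  have heq : (fun q => (ψ q).1) =ᶠ[𝓝 p] κ ∘ A.proj := by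
    filter_upwards [ψ.open_source.mem_nhds hp] with q hq using h.trivializationCoord_fst hq
  exact DFunLike.congr_fun (hasMFDerivAt_unique hfst (hproj.congr_of_eventuallyEq heq)) ξ

lemma trivializationCoord_fibreLine (h : A.IsTrivialization W s X e)
    (hp : p ∈ (trivializationCoord e κ).source) (c : EuclideanSpace ℝ (Fin r)) (t : ℝ) :
    (κ (A.proj p), (e p).2 + t • c) ∈ (trivializationCoord e κ).target ∧
    A.fibreLine p (∑ i, c i • (D.space (A.proj p)).mkQ (X i (A.proj p))) t
      = (trivializationCoord e κ).symm (κ (A.proj p), (e p).2 + t • c) := by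
  have hpκ := h.proj_mem_source hp
  refine ⟨⟨⟨κ.map_source hpκ, trivial⟩, ?_⟩, ?_⟩
  · change (κ.symm (κ (A.proj p)), (e p).2 + t • c) ∈ e.target
    rw [h.target_eq, κ.left_inv hpκ]
    exact ⟨h.proj_mem hp.1, trivial⟩
  · rw [h.fibreLine_eq hp.1]
    change _ = e.symm (κ.symm (κ (A.proj p)), (e p).2 + t • c)
    rw [κ.left_inv hpκ]

-- In these coordinates the line `t ↦ p + t q` is an affine line with constant first component.
lemma coordD_vertical (h : A.IsTrivialization W s X e) (hκ : IsSmoothCoord (n := m) κ)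
    (hp : p ∈ (trivializationCoord e κ).source) (c : EuclideanSpace ℝ (Fin r)) :
    coordD (trivializationCoord e κ) p
      (A.vertical p (∑ i, c i • (D.space (A.proj p)).mkQ (X i (A.proj p)))) = (0, c) := by
  have hψ := h.isSmoothCoord hκ
  set ψ := trivializationCoord e κ
  set ℓ := A.fibreLine p (∑ i, c i • (D.space (A.proj p)).mkQ (X i (A.proj p))) with hℓ
  let γ (t : ℝ) := (κ (A.proj p), (e p).2 + t • c)
  have hline (t : ℝ) : γ t ∈ ψ.target ∧ ℓ t = ψ.symm (γ t) :=
    h.trivializationCoord_fibreLine hp c t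
  have hγ : HasFDerivAt γ ((0 : ℝ →L[ℝ] EuclideanSpace ℝ (Fin m)).prod
      ((ContinuousLinearMap.id ℝ ℝ).smulRight c)) 0 :=
    (hasFDerivAt_const _ _).prodMk (((hasFDerivAt_id (0 : ℝ)).smul_const c).const_add _)
  have hdiff : MDifferentiableAt 𝓘(ℝ, ℝ) (𝓡 n) ℓ 0 := by
    rw [show ℓ = ψ.symm ∘ γ from funext fun t => (hline t).2]
    exact ((hψ.contMDiffAt_symm (hline 0).1).mdifferentiableAt (by simp)).comp 0
      hγ.differentiableAt.mdifferentiableAt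
  have hψ0 : HasMFDerivAt (𝓡 n) 𝓘(ℝ, EuclideanSpace ℝ (Fin m) × EuclideanSpace ℝ (Fin r)) ψ
      (ℓ 0) (coordD ψ p) := by
    rw [show ℓ 0 = p by rw [hℓ, fibreLine, zero_smul, zero_vadd]]
    exact hψ.hasMFDerivAt hp
  have hcomp : ψ ∘ ℓ = γ := funext fun t => by
    rw [Function.comp_apply, (hline t).2, ψ.right_inv (hline t).1]
  have hchain := hψ0.comp 0 hdiff.hasMFDerivAt
  rw [hcomp] at hchain
  refine (DFunLike.congr_fun (hasMFDerivAt_unique hchain hγ.hasMFDerivAt) (1 : ℝ)).trans ?_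
  exact congrArg (Prod.mk (0 : EuclideanSpace ℝ (Fin m))) (one_smul ℝ c)

end IsTrivialization

/-- Coordinates `ψ` on the total space extending coordinates `κ` on the base, in which the
canonical tensor has the normal form `(v, e) ↦ (0, G v)`, where `G` has kernel `D` and depends
only on the base coordinates. -/
structure IsAdaptedCoord (A : AffineQuotientBundle n D)
    (κ : OpenPartialHomeomorph B (EuclideanSpace ℝ (Fin m)))
    (ψ : OpenPartialHomeomorph A.Total (EuclideanSpace ℝ (Fin m) × EuclideanSpace ℝ (Fin r)))
    (G : EuclideanSpace ℝ (Fin m) → EuclideanSpace ℝ (Fin m) →L[ℝ] EuclideanSpace ℝ (Fin r)) :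
    Prop where
  isSmoothCoord : IsSmoothCoord (n := n) ψ
  proj_mem : ∀ p ∈ ψ.source, A.proj p ∈ κ.source
  fst_eq : ∀ p ∈ ψ.source, (ψ p).1 = κ (A.proj p)
  surjective : ∀ p ∈ ψ.source, Function.Surjective (G (ψ p).1)
  mem_space_iff : ∀ p ∈ ψ.source, ∀ η : TangentSpace (𝓡 m) (A.proj p),
    η ∈ D.space (A.proj p) ↔ G (ψ p).1 (coordD κ (A.proj p) η) = 0
  coordD_tensor : ∀ p ∈ ψ.source, ∀ ξ : TangentSpace (𝓡 n) p,
    coordD ψ p (A.tensor p ξ) = (0, G (ψ p).1 (coordD ψ p ξ).1)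

theorem exists_isAdaptedCoord (A : AffineQuotientBundle n D)
    {κ : OpenPartialHomeomorph B (EuclideanSpace ℝ (Fin m))} (hκ : IsSmoothCoord (n := m) κ)
    {p₀ : A.Total} (hp₀ : A.proj p₀ ∈ κ.source) :
    ∃ (r : ℕ)
      (ψ : OpenPartialHomeomorph A.Total (EuclideanSpace ℝ (Fin m) × EuclideanSpace ℝ (Fin r)))
      (G : EuclideanSpace ℝ (Fin m) → EuclideanSpace ℝ (Fin m) →L[ℝ] EuclideanSpace ℝ (Fin r)),
      A.IsAdaptedCoord κ ψ G ∧ p₀ ∈ ψ.source := by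
  obtain ⟨r, W, s, X, e, -, hW, -, hX, hes, het, he, he', hsymm⟩ := A.locally_trivial (A.proj p₀)
  have h : A.IsTrivialization W s X e :=
    ⟨fun y hy => (hX y hy).1, fun y hy => (hX y hy).2, hes, het, he, he', hsymm⟩
  have : ∀ y ∈ W, ∃ Q : TangentSpace (𝓡 m) y →L[ℝ] EuclideanSpace ℝ (Fin r),
      Function.Surjective Q ∧ (∀ η, η ∈ D.space y ↔ Q η = 0) ∧
        ∀ η, (D.space y).mkQ η = ∑ i, Q η i • (D.space y).mkQ (X i y) := fun y hy =>
    exists_clm_mkQ_eq_sum_smul (V := EuclideanSpace ℝ (Fin m)) (h.linearIndependent y hy)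
      (h.span_eq_top y hy)
  choose! Q hQsurj hQker hQ using this
  let ψ := trivializationCoord e κ
  let G (u : EuclideanSpace ℝ (Fin m)) := (Q (κ.symm u)).comp (coordD κ (κ.symm u)).inverse
  have hG (p) (hp : p ∈ ψ.source) (η) : G (ψ p).1 (coordD κ (A.proj p) η) = Q (A.proj p) η := by
    have hpκ := h.proj_mem_source hp
    simp only [G, ContinuousLinearMap.comp_apply]
    rw [h.trivializationCoord_fst hp, κ.left_inv hpκ, hκ.inverse_coordD hpκ]
  have hpe : p₀ ∈ e.source := h.source_eq ▸ hW
  refine ⟨r, ψ, G, ⟨h.isSmoothCoord hκ, fun p hp => h.proj_mem_source hp,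
    fun p hp => h.trivializationCoord_fst hp, fun p hp c => ?_, fun p hp η => ?_,
    fun p hp ξ => ?_⟩, hpe, (h.fst_apply hpe).symm ▸ hp₀, trivial⟩
  · obtain ⟨η, rfl⟩ := hQsurj _ (h.proj_mem hp.1) c
    exact ⟨_, hG p hp η⟩
  · rw [hG p hp, hQker _ (h.proj_mem hp.1)]
  · rw [tensor, hQ _ (h.proj_mem hp.1), h.coordD_vertical hκ hp, h.coordD_fst hκ hp, hG p hp]

end AffineQuotientBundle

end AffineBundleCoordinates

section FibreDimension

variable {n : ℕ} {M : Type u} [TopologicalSpace M] [ChartedSpace (EuclideanSpace ℝ (Fin n)) M]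

lemma IsSmoothCoord.finrank_eq {V : Type*} [NormedAddCommGroup V] [NormedSpace ℝ V]
    {χ : OpenPartialHomeomorph M V} (hχ : IsSmoothCoord (n := n) χ) {z : M} (hz : z ∈ χ.source) :
    Module.finrank ℝ V = n :=
  (hχ.mdifferentiable.mfderiv hz).toLinearEquiv.finrank_eq.symm.trans finrank_euclideanSpace_fin

variable [IsManifold (𝓡 n) ∞ M] {Θ : Tensor11 n M}

lemma Tensor11.IsAdapted.finrank_range {F E : Type v} [NormedAddCommGroup F] [NormedSpace ℝ F]
    [NormedAddCommGroup E] [NormedSpace ℝ E] {χ : OpenPartialHomeomorph M (F × E)}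
    {H : F × E → F →L[ℝ] E} (h : Θ.IsAdapted χ H) (hχ : IsSmoothCoord (n := n) χ) {z : M}
    (hz : z ∈ χ.source) (hsurj : Function.Surjective (H (χ z))) :
    Module.finrank ℝ (Θ z).range = Module.finrank ℝ E := by
  have hrange : (Θ.coord χ (χ z)).range = (LinearMap.inr ℝ F E).range := by
    ext p
    constructor
    · rintro ⟨v, rfl⟩
      exact ⟨H (χ z) v.1, (h.coord_apply hχ (χ.map_source hz) v).symm⟩
    · rintro ⟨e, rfl⟩
      obtain ⟨f, rfl⟩ := hsurj e
      exact ⟨(f, 0), h.coord_apply hχ (χ.map_source hz) _⟩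
  rw [← Θ.finrank_range_coord hχ hz, hrange,
    LinearMap.finrank_range_of_inj LinearMap.inr_injective]

lemma Tensor11.codimImKer_add_two_mul_finrank_range
    (hsq : ∀ (x : M) (ξ : TangentSpace (𝓡 n) x), Θ x (Θ x ξ) = 0) (x : M) :
    Θ.codimImKer x + 2 * Module.finrank ℝ (Θ x).range = n := by
  have : FiniteDimensional ℝ (TangentSpace (𝓡 n) x) :=
    inferInstanceAs (FiniteDimensional ℝ (EuclideanSpace ℝ (Fin n)))
  have hle : (Θ x).range ≤ (Θ x).ker := by
    rintro - ⟨ξ, rfl⟩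
    exact hsq x ξ
  have hrank := (Θ x).toLinearMap.finrank_range_add_finrank_ker
  have hquot := Submodule.finrank_quotient_add_finrank ((Θ x).range.submoduleOf (Θ x).ker)
  have hsub := (Submodule.submoduleOfEquivOfLe hle).finrank_eq
  have hn : Module.finrank ℝ (TangentSpace (𝓡 n) x) = n := finrank_euclideanSpace_fin
  rw [Tensor11.codimImKer]
  omega

namespace LocalRealization

variable (R : LocalRealization.{u, v} Θ) {r : ℕ}
  {κ : OpenPartialHomeomorph R.Base (EuclideanSpace ℝ (Fin R.baseDim))}
  {ψ : OpenPartialHomeomorph R.bundle.Total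
    (EuclideanSpace ℝ (Fin R.baseDim) × EuclideanSpace ℝ (Fin r))}
  {G : EuclideanSpace ℝ (Fin R.baseDim) →
    EuclideanSpace ℝ (Fin R.baseDim) →L[ℝ] EuclideanSpace ℝ (Fin r)}

lemma isSmoothCoord_trans {V : Type*} [NormedAddCommGroup V] [NormedSpace ℝ V]
    {ψ : OpenPartialHomeomorph R.bundle.Total V} (hψ : IsSmoothCoord (n := n) ψ) :
    IsSmoothCoord (n := n) (R.φ.trans ψ) where
  smooth := hψ.smooth.comp (R.smooth_φ.mono inter_subset_left) fun _ hz => hz.2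
  smooth_symm := R.smooth_φ_symm.comp (hψ.smooth_symm.mono inter_subset_left) fun _ hz => hz.2

lemma coordD_trans {V : Type*} [NormedAddCommGroup V] [NormedSpace ℝ V]
    {ψ : OpenPartialHomeomorph R.bundle.Total V} (hψ : IsSmoothCoord (n := n) ψ) {z : M}
    (hz : z ∈ (R.φ.trans ψ).source) (ξ : TangentSpace (𝓡 n) z) :
    coordD (R.φ.trans ψ) z ξ = coordD ψ (R.φ z) (mfderiv (𝓡 n) (𝓡 n) R.φ z ξ) := by
  have hφ := ((R.smooth_φ.contMDiffAt (R.φ.open_source.mem_nhds hz.1)).mdifferentiableAt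
    (by simp)).hasMFDerivAt
  exact DFunLike.congr_fun ((hψ.hasMFDerivAt hz.2).comp z hφ).mfderiv ξ

lemma isAdapted_trans (hψ : R.bundle.IsAdaptedCoord κ ψ G) :
    Θ.IsAdapted (R.φ.trans ψ) fun p => G p.1 := by
  intro z hz ξ
  rw [R.coordD_trans hψ.isSmoothCoord hz, R.map_tensor z hz.1, hψ.coordD_tensor (R.φ z) hz.2,
    R.coordD_trans hψ.isSmoothCoord hz]
  rfl

end LocalRealization

lemma AffineQuotientBundle.IsAdaptedCoord.finrank_space_add {m r : ℕ} {B : Type v}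
    [TopologicalSpace B] [ChartedSpace (EuclideanSpace ℝ (Fin m)) B] [IsManifold (𝓡 m) ∞ B]
    {D : SmoothDistribution m B} {A : AffineQuotientBundle n D}
    {κ : OpenPartialHomeomorph B (EuclideanSpace ℝ (Fin m))}
    {ψ : OpenPartialHomeomorph A.Total (EuclideanSpace ℝ (Fin m) × EuclideanSpace ℝ (Fin r))}
    {G : EuclideanSpace ℝ (Fin m) → EuclideanSpace ℝ (Fin m) →L[ℝ] EuclideanSpace ℝ (Fin r)}
    (hψ : A.IsAdaptedCoord κ ψ G) (hκ : IsSmoothCoord (n := m) κ) {p : A.Total}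
    (hp : p ∈ ψ.source) : Module.finrank ℝ (D.space (A.proj p)) + r = m := by
  let f : EuclideanSpace ℝ (Fin m) →ₗ[ℝ] EuclideanSpace ℝ (Fin r) :=
    ((G (ψ p).1).comp (coordD κ (A.proj p))).toLinearMap
  have hf : Function.Surjective f := (hψ.surjective p hp).comp
    fun v => ⟨_, hκ.coordD_inverse (hψ.proj_mem p hp) v⟩
  have hker : D.space (A.proj p) = LinearMap.ker f := Submodule.ext (hψ.mem_space_iff p hp)
  have hrank := f.finrank_range_add_finrank_ker
  rw [LinearMap.range_eq_top.2 hf, finrank_top, finrank_euclideanSpace_fin,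
    finrank_euclideanSpace_fin, ← hker, add_comm] at hrank
  exact hrank

theorem LocalRealization.finrank_dist (R : LocalRealization.{u, v} Θ)
    (hconst : Θ.AlgebraicallyConstant)
    (hsq : ∀ (x : M) (ξ : TangentSpace (𝓡 n) x), Θ x (Θ x ξ) = 0) (x : M) (y : R.Base) :
    Module.finrank ℝ (R.dist.space y) = Θ.codimImKer x := by
  obtain ⟨x₀, hx₀, rfl⟩ := R.meets_fibres y
  have hκ : IsSmoothCoord (n := R.baseDim)
      (chartAt (EuclideanSpace ℝ (Fin R.baseDim)) (R.bundle.proj (R.φ x₀))) :=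
    isSmoothCoord_of_mem_maximalAtlas (IsManifold.chart_mem_maximalAtlas _)
  obtain ⟨r, ψ, G, hψ, hx₀ψ⟩ := R.bundle.exists_isAdaptedCoord hκ (mem_chart_source _ _)
  have hχ := R.isSmoothCoord_trans hψ.isSmoothCoord
  have hx₀χ : x₀ ∈ (R.φ.trans ψ).source := ⟨hx₀, hx₀ψ⟩
  have hdist := hψ.finrank_space_add hκ hx₀ψ
  have hdim := hχ.finrank_eq hx₀χ
  have hrank := (R.isAdapted_trans hψ).finrank_range hχ hx₀χ (hψ.surjective _ hx₀ψ)
  have hcodim := Tensor11.codimImKer_add_two_mul_finrank_range hsq x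
  rw [Module.finrank_prod, finrank_euclideanSpace_fin, finrank_euclideanSpace_fin] at hdim
  rw [finrank_euclideanSpace_fin] at hrank
  rw [hconst.finrank_range_eq x x₀, hrank] at hcodim
  omega

end FibreDimension

section IntegrableDistribution

variable {n : ℕ} {M : Type u} [TopologicalSpace M] [ChartedSpace (EuclideanSpace ℝ (Fin n)) M]
  [IsManifold (𝓡 n) ∞ M] {Θ : Tensor11 n M}

lemma Tensor11.IsIntegrableOn.apply_mlieBracket_eq_zero {U : Set M} (hΘ : Θ.IsIntegrableOn U)
    (hU : IsOpen U) {x : M} (hx : x ∈ U) {X Y : ∀ z : M, TangentSpace (𝓡 n) z}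
    (hX : FieldDifferentiableAt X x) (hY : FieldDifferentiableAt Y x)
    (hΘX : ∀ᶠ z in 𝓝 x, Θ z (X z) = 0) (hΘY : ∀ᶠ z in 𝓝 x, Θ z (Y z) = 0) :
    Θ x (VectorField.mlieBracket (𝓡 n) X Y x) = 0 := by
  obtain ⟨conn, hconn, -, htor, hpar⟩ := hΘ
  have hker {X : ∀ z : M, TangentSpace (𝓡 n) z} (hX : FieldDifferentiableAt X x)
      (hΘX : ∀ᶠ z in 𝓝 x, Θ z (X z) = 0) (ξ : TangentSpace (𝓡 n) x) :
      Θ x (conn X x ξ) = 0 := by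
    have hzero : FieldDifferentiableAt (0 : ∀ z : M, TangentSpace (𝓡 n) z) x :=
      Bundle.mdifferentiableAt_zeroSection ..
    rw [← hpar x hx X hX ξ, hconn.congr_of_eventuallyEq (Θ.fieldDifferentiableAt_apply hX) hzero
      (hU.mem_nhds hx) hΘX, hconn.zero hx]
    rfl
  rw [← htor x hx X Y hX hY, map_sub, hker hY hΘY, hker hX hΘX, sub_zero]

section Adapted

variable {F E : Type*} [NormedAddCommGroup F] [NormedSpace ℝ F] [NormedAddCommGroup E]
  [NormedSpace ℝ E] {χ : OpenPartialHomeomorph M (F × E)} {G : F → F →L[ℝ] E}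

lemma Tensor11.IsAdapted.eventually_apply_coordField_eq_zero
    (h : Θ.IsAdapted χ fun p => G p.1) (hχ : IsSmoothCoord (n := n) χ) {z : M}
    (hz : z ∈ χ.source) {η : F → F} (hη : ∀ᶠ u in 𝓝 (χ z).1, G u (η u) = 0) :
    ∀ᶠ x in 𝓝 z, Θ x (coordField χ (fun p => (η p.1, 0)) x) = 0 := by
  have hfst : Tendsto (fun x => (χ x).1) (𝓝 z) (𝓝 (χ z).1) :=
    continuous_fst.continuousAt.comp (χ.continuousAt hz)
  filter_upwards [hfst.eventually hη, χ.open_source.mem_nhds hz] with x hx hxχ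
  refine hχ.coordD_injective hxχ ?_
  rw [h x hxχ, hχ.coordD_coordField hxχ, map_zero]
  exact Prod.ext rfl hx

lemma Tensor11.IsAdapted.apply_lieBracket_eq_zero [FiniteDimensional ℝ F] [FiniteDimensional ℝ E]
    (h : Θ.IsAdapted χ fun p => G p.1) (hχ : IsSmoothCoord (n := n) χ) {U : Set M}
    (hΘ : Θ.IsIntegrableOn U) (hU : IsOpen U) (hχU : χ.source ⊆ U) {u : F} {c : E}
    (huc : (u, c) ∈ χ.target) {η₁ η₂ : F → F} (hη₁ : DifferentiableAt ℝ η₁ u)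
    (hη₂ : DifferentiableAt ℝ η₂ u) (hker₁ : ∀ᶠ u' in 𝓝 u, G u' (η₁ u') = 0)
    (hker₂ : ∀ᶠ u' in 𝓝 u, G u' (η₂ u') = 0) :
    G u (VectorField.lieBracket ℝ η₁ η₂ u) = 0 := by
  have hz := χ.map_target huc
  have hχz := χ.right_inv huc
  have hlift {η : F → F} (hη : DifferentiableAt ℝ η u) : HasFDerivAt
      (fun p : F × E => (η p.1, (0 : E)))
      (((fderiv ℝ η u).comp (ContinuousLinearMap.fst ℝ F E)).prod 0) (χ (χ.symm (u, c))) := by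
    rw [hχz]
    exact (HasFDerivAt.comp (u, c) hη.hasFDerivAt hasFDerivAt_fst).prodMk (hasFDerivAt_const _ _)
  have hbracket := hΘ.apply_mlieBracket_eq_zero hU (hχU hz)
    (hχ.fieldDifferentiableAt_coordField hz (hlift hη₁).differentiableAt)
    (hχ.fieldDifferentiableAt_coordField hz (hlift hη₂).differentiableAt)
    (h.eventually_apply_coordField_eq_zero hχ hz (by rwa [hχz]))
    (h.eventually_apply_coordField_eq_zero hχ hz (by rwa [hχz]))
  have hcoord := congrArg (coordD χ (χ.symm (u, c))) hbracket
  rw [h _ hz, hχ.coordD_mlieBracket_coordField hz (hlift hη₁).differentiableAt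
    (hlift hη₂).differentiableAt, VectorField.lieBracket, (hlift hη₁).fderiv, (hlift hη₂).fderiv,
    map_zero, hχz] at hcoord
  exact congrArg Prod.snd hcoord

end Adapted

namespace AffineQuotientBundle.IsAdaptedCoord

variable {m r : ℕ} {B : Type v} [TopologicalSpace B] [ChartedSpace (EuclideanSpace ℝ (Fin m)) B]
  [IsManifold (𝓡 m) ∞ B] {D : SmoothDistribution m B} {A : AffineQuotientBundle n D}
  {κ : OpenPartialHomeomorph B (EuclideanSpace ℝ (Fin m))}
  {ψ : OpenPartialHomeomorph A.Total (EuclideanSpace ℝ (Fin m) × EuclideanSpace ℝ (Fin r))}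
  {G : EuclideanSpace ℝ (Fin m) → EuclideanSpace ℝ (Fin m) →L[ℝ] EuclideanSpace ℝ (Fin r)}

lemma fst_mem_target (hψ : A.IsAdaptedCoord κ ψ G)
    {p : EuclideanSpace ℝ (Fin m) × EuclideanSpace ℝ (Fin r)} (hp : p ∈ ψ.target) :
    p.1 ∈ κ.target := by
  have hq := ψ.map_target hp
  rw [← ψ.right_inv hp, hψ.fst_eq _ hq]
  exact κ.map_source (hψ.proj_mem _ hq)

lemma mem_space_iff_of_mem_target (hψ : A.IsAdaptedCoord κ ψ G) {y : B} (hy : y ∈ κ.source)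
    {c : EuclideanSpace ℝ (Fin r)} (hyc : (κ y, c) ∈ ψ.target) (η : TangentSpace (𝓡 m) y) :
    η ∈ D.space y ↔ G (κ y) (coordD κ y η) = 0 := by
  obtain ⟨p, hp, hψp⟩ : ∃ p ∈ ψ.source, ψ p = (κ y, c) :=
    ⟨_, ψ.map_target hyc, ψ.right_inv hyc⟩
  have hfst := hψ.fst_eq p hp
  obtain rfl : y = A.proj p := κ.injOn hy (hψ.proj_mem p hp) (by rw [← hfst, hψp])
  rw [hψ.mem_space_iff p hp, hfst]

end AffineQuotientBundle.IsAdaptedCoord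

lemma Tensor11.IsAdapted.contDiffOn_slice {F E : Type*} [NormedAddCommGroup F] [NormedSpace ℝ F]
    [NormedAddCommGroup E] [NormedSpace ℝ E] [FiniteDimensional ℝ F] [FiniteDimensional ℝ E]
    {χ : OpenPartialHomeomorph M (F × E)} {G : F → F →L[ℝ] E}
    (h : Θ.IsAdapted χ fun p => G p.1) (hχ : IsSmoothCoord (n := n) χ) (c : E) :
    ContDiffOn ℝ ∞ G ((fun u => (u, c)) ⁻¹' χ.target) :=
  (h.contDiffOn hχ).comp (contDiff_id.prodMk contDiff_const).contDiffOn fun _ hu => hu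

theorem LocalRealization.isIntegrable_dist (R : LocalRealization.{u, v} Θ) {U : Set M}
    (hΘ : Θ.IsIntegrableOn U) (hU : IsOpen U) (hRU : R.φ.source ⊆ U) : R.dist.IsIntegrable := by
  intro y
  obtain ⟨x₀, hx₀, rfl⟩ := R.meets_fibres y
  set y := R.bundle.proj (R.φ x₀)
  set κ := chartAt (EuclideanSpace ℝ (Fin R.baseDim)) y
  have hyκ : y ∈ κ.source := mem_chart_source _ _
  have hκ : IsSmoothCoord (n := R.baseDim) κ :=
    isSmoothCoord_of_mem_maximalAtlas (IsManifold.chart_mem_maximalAtlas y)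
  obtain ⟨r, ψ, G, hψ, hx₀ψ⟩ := R.bundle.exists_isAdaptedCoord hκ hyκ
  set χ := R.φ.trans ψ
  have hχ : IsSmoothCoord (n := n) χ := R.isSmoothCoord_trans hψ.isSmoothCoord
  have had := R.isAdapted_trans hψ
  have hx₀χ : x₀ ∈ χ.source := ⟨hx₀, hx₀ψ⟩
  have hΩ : IsOpen ((fun u => (u, (χ x₀).2)) ⁻¹' χ.target) :=
    χ.open_target.preimage (by fun_prop)
  obtain ⟨Φ, hΦ, hΦ₀, hΦΩ, hΦG⟩ := exists_straightening_ker (had.contDiffOn_slice hχ _) hΩ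
    (p₀ := (χ x₀).1) (χ.map_source hx₀χ) (LinearMap.range_eq_top.2 (hψ.surjective _ hx₀ψ))
    fun u hu η₁ η₂ hη₁ hη₂ =>
      had.apply_lieBracket_eq_zero hχ hΘ hU (inter_subset_left.trans hRU) hu hη₁ hη₂
  have hκΦ := hκ.trans hΦ
  have hy : κ y ∈ Φ.source := hψ.fst_eq _ hx₀ψ ▸ hΦ₀
  refine ⟨κ.trans Φ, (κ.trans Φ).mem_maximalAtlas_of_contMDiffOn hκΦ.smooth hκΦ.smooth_symm,
    ⟨hyκ, hy⟩, (G (χ x₀).1).ker, fun y' hy' η => ?_⟩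
  have hd : chartDifferential (κ.trans Φ) y' η = fderiv ℝ Φ (κ y') (coordD κ y' η) :=
    hκ.coordD_trans hΦ hy' η
  rw [hd]
  exact (hψ.mem_space_iff_of_mem_target hy'.1 (hΦΩ hy'.2).1 η).trans (hΦG _ hy'.2 _).symm

end IntegrableDistribution

section ConstantTensor

variable {n : ℕ} {M : Type u} [TopologicalSpace M] [ChartedSpace (EuclideanSpace ℝ (Fin n)) M]

lemma contMDiffAt_clm_of_apply {E F : Type*} [NormedAddCommGroup E] [NormedSpace ℝ E]
    [FiniteDimensional ℝ E] [NormedAddCommGroup F] [NormedSpace ℝ F] {f : M → E →L[ℝ] F} {x : M}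
    (hf : ∀ v, ContMDiffAt (𝓡 n) 𝓘(ℝ, F) ∞ (fun z => f z v) x) :
    ContMDiffAt (𝓡 n) 𝓘(ℝ, E →L[ℝ] F) ∞ f x := by
  let b := Module.finBasis ℝ E
  have hsum : f = fun z => ∑ i, ContinuousLinearMap.smulRightL ℝ E F
      (LinearMap.toContinuousLinearMap (b.coord i)) (f z (b i)) := by
    funext z
    ext v
    have hv := congrArg (f z) (b.sum_repr v)
    simp only [map_sum, map_smul] at hv
    rw [← hv]
    simp
  rw [hsum]
  exact contMDiffAt_finsetSum fun i _ =>
    (ContinuousLinearMap.contDiff _).contMDiff.contMDiffAt.comp x (hf (b i))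

lemma contMDiffAt_endomorphism_of_apply_field [IsManifold (𝓡 n) ∞ M]
    {A : ∀ z : M, TangentSpace (𝓡 n) z →L[ℝ] TangentSpace (𝓡 n) z} {x : M}
    (hA : ∀ X : ∀ z : M, TangentSpace (𝓡 n) z,
      ContMDiffAt (𝓡 n) (𝓡 n).tangent ∞ (fun z => (⟨z, X z⟩ : TangentBundle (𝓡 n) M)) x →
      ContMDiffAt (𝓡 n) (𝓡 n).tangent ∞ (fun z => (⟨z, A z (X z)⟩ : TangentBundle (𝓡 n) M)) x) :
    ContMDiffAt (𝓡 n)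
      ((𝓡 n).prod 𝓘(ℝ, EuclideanSpace ℝ (Fin n) →L[ℝ] EuclideanSpace ℝ (Fin n))) ∞
      (fun z => (⟨z, A z⟩ :
        Bundle.TotalSpace (EuclideanSpace ℝ (Fin n) →L[ℝ] EuclideanSpace ℝ (Fin n))
          fun z : M => TangentSpace (𝓡 n) z →L[ℝ] TangentSpace (𝓡 n) z)) x := by
  rw [contMDiffAt_hom_bundle]
  refine ⟨contMDiffAt_id, contMDiffAt_clm_of_apply fun v => ?_⟩
  set e := trivializationAt (EuclideanSpace ℝ (Fin n)) (TangentSpace (𝓡 n)) x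
  have hx : x ∈ e.baseSet := FiberBundle.mem_baseSet_trivializationAt' x
  have hsymm : ContMDiffAt (𝓡 n) (𝓡 n).tangent ∞
      (fun z => (⟨z, e.symm z v⟩ : TangentBundle (𝓡 n) M)) x := by
    have hpair : ContMDiffAt (𝓡 n) ((𝓡 n).prod (𝓡 n)) ∞ (fun z : M => (z, v)) x :=
      contMDiffAt_id.prodMk contMDiffAt_const
    refine (((e.contMDiffOn_symm (IB := 𝓡 n) (n := ∞)).contMDiffAt (e.open_target.mem_nhds
      (e.mk_mem_target.2 hx : (x, v) ∈ e.target))).comp x hpair).congr_of_eventuallyEq ?_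
    filter_upwards [e.open_baseSet.mem_nhds hx] with z hz using e.mk_symm hz v
  refine ((Bundle.contMDiffAt_section x).1 (hA _ hsymm)).congr_of_eventuallyEq ?_
  filter_upwards [e.open_baseSet.mem_nhds hx] with z hz
  rw [ContinuousLinearMap.inCoordinates_eq hz hz]
  rfl

/-- The connection which is the ordinary derivative in the coordinates `χ`. -/
def coordConnection {V : Type*} [NormedAddCommGroup V] [NormedSpace ℝ V]
    (χ : OpenPartialHomeomorph M V) (Y : ∀ x : M, TangentSpace (𝓡 n) x) (x : M) :
    TangentSpace (𝓡 n) x →L[ℝ] TangentSpace (𝓡 n) x :=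
  (coordD χ x).inverse.comp ((fderiv ℝ (coordExpr χ Y) (χ x)).comp (coordD χ x))

namespace IsSmoothCoord

variable {V : Type*} [NormedAddCommGroup V] [NormedSpace ℝ V] {χ : OpenPartialHomeomorph M V}
  {x : M} (hχ : IsSmoothCoord (n := n) χ)

include hχ

lemma coordD_coordConnection (hx : x ∈ χ.source) (Y : ∀ x : M, TangentSpace (𝓡 n) x)
    (ξ : TangentSpace (𝓡 n) x) :
    coordD χ x (coordConnection χ Y x ξ) = fderiv ℝ (coordExpr χ Y) (χ x) (coordD χ x ξ) :=
  hχ.coordD_inverse hx _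

lemma differentiableAt_comp_symm (hx : x ∈ χ.source) {g : M → ℝ}
    (hg : MDifferentiableAt (𝓡 n) 𝓘(ℝ, ℝ) g x) : DifferentiableAt ℝ (g ∘ χ.symm) (χ x) :=
  (MDifferentiableAt.comp (g := g) (χ x) (by rwa [χ.left_inv hx])
    ((hχ.contMDiffAt_symm (χ.map_source hx)).mdifferentiableAt (by simp))).differentiableAt

lemma mvfderiv_apply (hx : x ∈ χ.source) {g : M → ℝ} (hg : MDifferentiableAt (𝓡 n) 𝓘(ℝ, ℝ) g x)
    (ξ : TangentSpace (𝓡 n) x) :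
    mvfderiv (𝓡 n) g x ξ = fderiv ℝ (g ∘ χ.symm) (χ x) (coordD χ x ξ) := by
  have hcomp := (hχ.differentiableAt_comp_symm hx hg).hasFDerivAt.hasMFDerivAt.comp x
    (hχ.hasMFDerivAt hx)
  have hg' : g =ᶠ[𝓝 x] (g ∘ χ.symm) ∘ χ := by
    filter_upwards [χ.open_source.mem_nhds hx] with y hy
    simp [χ.left_inv hy]
  exact DFunLike.congr_fun (hcomp.congr_of_eventuallyEq hg').mfderiv ξ

variable [IsManifold (𝓡 n) ∞ M]

lemma coordConnection_add {Y Y' : ∀ x : M, TangentSpace (𝓡 n) x}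
    (hx : x ∈ χ.source) (hY : FieldDifferentiableAt Y x) (hY' : FieldDifferentiableAt Y' x) :
    coordConnection χ (Y + Y') x = coordConnection χ Y x + coordConnection χ Y' x := by
  have hexpr : coordExpr χ (Y + Y') = coordExpr χ Y + coordExpr χ Y' :=
    funext fun p => map_add (coordD χ (χ.symm p)) _ _
  ext1 ξ
  refine hχ.coordD_injective hx ?_
  change _ = coordD χ x (coordConnection χ Y x ξ + coordConnection χ Y' x ξ)
  rw [map_add, hχ.coordD_coordConnection hx, hχ.coordD_coordConnection hx,
    hχ.coordD_coordConnection hx, hexpr, fderiv_add (hχ.differentiableAt_coordExpr hx hY)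
    (hχ.differentiableAt_coordExpr hx hY')]
  rfl

lemma coordConnection_smul {Y : ∀ x : M, TangentSpace (𝓡 n) x} {g : M → ℝ}
    (hx : x ∈ χ.source) (hY : FieldDifferentiableAt Y x)
    (hg : MDifferentiableAt (𝓡 n) 𝓘(ℝ, ℝ) g x) :
    coordConnection χ (g • Y) x =
      g x • coordConnection χ Y x + (mvfderiv (𝓡 n) g x).smulRight (Y x) := by
  have hexpr : coordExpr χ (g • Y) = fun p => (g ∘ χ.symm) p • coordExpr χ Y p :=
    funext fun p => map_smul (coordD χ (χ.symm p)) _ _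
  have hY_apply : coordExpr χ Y (χ x) = coordD χ x (Y x) := by rw [coordExpr, χ.left_inv hx]
  have hg_apply : (g ∘ χ.symm) (χ x) = g x := congrArg g (χ.left_inv hx)
  ext1 ξ
  refine hχ.coordD_injective hx ?_
  change _ = coordD χ x (g x • coordConnection χ Y x ξ + mvfderiv (𝓡 n) g x ξ • Y x)
  rw [map_add, map_smul, map_smul, hχ.coordD_coordConnection hx, hχ.coordD_coordConnection hx,
    hexpr, fderiv_fun_smul (hχ.differentiableAt_comp_symm hx hg)
    (hχ.differentiableAt_coordExpr hx hY), hχ.mvfderiv_apply hx hg, hg_apply, hY_apply]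
  rfl

lemma isCovariantDerivativeOn_coordConnection :
    IsCovariantDerivativeOn (EuclideanSpace ℝ (Fin n)) (coordConnection (n := n) χ) χ.source :=
  ⟨fun hY hY' hx => hχ.coordConnection_add hx hY hY',
    fun hY hg hx => hχ.coordConnection_smul hx hY hg⟩

lemma contMDiffCovariantDerivativeOn_coordConnection :
    ContMDiffCovariantDerivativeOn (EuclideanSpace ℝ (Fin n)) ∞
      (coordConnection (n := n) χ) χ.source := by
  refine ⟨fun {Y} hY x hx => ContMDiffAt.contMDiffWithinAt
    (contMDiffAt_endomorphism_of_apply_field fun X hX => ?_)⟩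
  have hexpr : ContDiffOn ℝ ∞ (coordExpr χ Y) χ.target := by
    intro p hp
    have hz := χ.map_target hp
    have hcoord := (hχ.contMDiffAt_field_iff hz).1 ((hY _ hz).contMDiffAt
      (χ.open_source.mem_nhds hz))
    exact (hcoord.comp p (hχ.contMDiffAt_symm hp)).contDiffAt.contDiffWithinAt
  have hfderiv := ((hexpr.fderiv_of_isOpen (m := ∞) χ.open_target (by simp)).contDiffAt
    (χ.open_target.mem_nhds (χ.map_source hx))).contMDiffAt.comp x (hχ.contMDiffAt hx)
  rw [hχ.contMDiffAt_field_iff hx] at hX ⊢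
  refine (hfderiv.clm_apply hX).congr_of_eventuallyEq ?_
  filter_upwards [χ.open_source.mem_nhds hx] with y hy using
    hχ.coordD_coordConnection hy Y (X y)

lemma coordConnection_torsion [FiniteDimensional ℝ V] {X Y : ∀ x : M, TangentSpace (𝓡 n) x}
    (hx : x ∈ χ.source) (hX : FieldDifferentiableAt X x) (hY : FieldDifferentiableAt Y x) :
    coordConnection χ Y x (X x) - coordConnection χ X x (Y x)
      = VectorField.mlieBracket (𝓡 n) X Y x := by
  refine hχ.coordD_injective hx ?_
  rw [map_sub, hχ.coordD_coordConnection hx, hχ.coordD_coordConnection hx,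
    hχ.coordD_mlieBracket hx hX hY]

variable {Θ : Tensor11 n M} {T : V →L[ℝ] V}
  (hT : ∀ z ∈ χ.source, ∀ ξ : TangentSpace (𝓡 n) z, coordD χ z (Θ z ξ) = T (coordD χ z ξ))

include hT

lemma coordConnection_tensor_apply {Y : ∀ x : M, TangentSpace (𝓡 n) x} (hx : x ∈ χ.source)
    (hY : FieldDifferentiableAt Y x) (ξ : TangentSpace (𝓡 n) x) :
    coordConnection χ (fun z => Θ z (Y z)) x ξ = Θ x (coordConnection χ Y x ξ) := by
  have hexpr : coordExpr χ (fun z => Θ z (Y z)) =ᶠ[𝓝 (χ x)] fun p => T (coordExpr χ Y p) := by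
    filter_upwards [χ.open_target.mem_nhds (χ.map_source hx)] with p hp
      using hT _ (χ.map_target hp) _
  refine hχ.coordD_injective hx ?_
  rw [hT x hx, hχ.coordD_coordConnection hx, hχ.coordD_coordConnection hx, hexpr.fderiv_eq]
  exact DFunLike.congr_fun
    (T.hasFDerivAt.comp (χ x) (hχ.differentiableAt_coordExpr hx hY).hasFDerivAt).fderiv _

theorem isIntegrableOn_source [FiniteDimensional ℝ V] : Θ.IsIntegrableOn χ.source :=
  ⟨coordConnection χ, hχ.isCovariantDerivativeOn_coordConnection,
    hχ.contMDiffCovariantDerivativeOn_coordConnection,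
    fun _ hx _ _ hX hY => hχ.coordConnection_torsion hx hX hY,
    fun _ hx _ hY ξ => hχ.coordConnection_tensor_apply hT hx hY ξ⟩

end IsSmoothCoord

end ConstantTensor

section IntegrableTensor

lemma exists_isSmoothCoordChange_of_inverse {F E : Type*} [NormedAddCommGroup F] [NormedSpace ℝ F]
    [NormedAddCommGroup E] [NormedSpace ℝ E] {K K' : F → E →L[ℝ] E} {Ω : Set F} (hΩ : IsOpen Ω)
    (hK : ContDiffOn ℝ ∞ K Ω) (hK' : ContDiffOn ℝ ∞ K' Ω) (hKK' : ∀ u ∈ Ω, ∀ c, K u (K' u c) = c)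
    (hK'K : ∀ u ∈ Ω, ∀ c, K' u (K u c) = c) :
    ∃ Φ : OpenPartialHomeomorph (F × E) (F × E), IsSmoothCoordChange Φ ∧
      Φ.source = Ω ×ˢ univ ∧ ∀ p, Φ p = (p.1, K' p.1 p.2) := by
  have hsmooth {K : F → E →L[ℝ] E} (hK : ContDiffOn ℝ ∞ K Ω) :
      ContDiffOn ℝ ∞ (fun p : F × E => (p.1, K p.1 p.2)) (Ω ×ˢ univ) :=
    contDiff_fst.contDiffOn.prodMk ((hK.comp contDiff_fst.contDiffOn fun p hp => hp.1).clm_apply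
      contDiff_snd.contDiffOn)
  let Φ : OpenPartialHomeomorph (F × E) (F × E) :=
    { toFun := fun p => (p.1, K' p.1 p.2)
      invFun := fun p => (p.1, K p.1 p.2)
      source := Ω ×ˢ univ
      target := Ω ×ˢ univ
      map_source' := fun p hp => ⟨hp.1, trivial⟩
      map_target' := fun p hp => ⟨hp.1, trivial⟩
      left_inv' := fun p hp => Prod.ext rfl (hKK' p.1 hp.1 p.2)
      right_inv' := fun p hp => Prod.ext rfl (hK'K p.1 hp.1 p.2)
      open_source := hΩ.prod isOpen_univ
      open_target := hΩ.prod isOpen_univ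
      continuousOn_toFun := (hsmooth hK').continuousOn
      continuousOn_invFun := (hsmooth hK).continuousOn }
  exact ⟨Φ, ⟨hsmooth hK', hsmooth hK⟩, rfl, fun _ => rfl⟩

section FibrewiseLinear

variable {F E : Type*} [NormedAddCommGroup F] [NormedSpace ℝ F] [NormedAddCommGroup E]
  [NormedSpace ℝ E] {f : F × E → F × E} {K : F → E →L[ℝ] E} {p : F × E}

lemma fderiv_apply_fst_of_fst_eq (hf : ∀ q, (f q).1 = q.1) (hfp : DifferentiableAt ℝ f p)
    (v : F × E) : (fderiv ℝ f p v).1 = v.1 := by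
  have hfst : HasFDerivAt (fun q => (f q).1) _ p := hfp.hasFDerivAt.fst
  simp only [hf] at hfst
  exact DFunLike.congr_fun (hfst.unique hasFDerivAt_fst) v

lemma fderiv_apply_inr_of_fibrewise (hf : ∀ q, f q = (q.1, K q.1 q.2))
    (hfp : DifferentiableAt ℝ f p) (c : E) : fderiv ℝ f p (0, c) = (0, K p.1 c) := by
  have hslice : HasFDerivAt (fun e : E => f (p.1, e)) _ p.2 :=
    HasFDerivAt.comp (f := fun e => (p.1, id e)) p.2 (g := f) (by exact hfp.hasFDerivAt)
      ((hasFDerivAt_const p.1 p.2).prodMk (hasFDerivAt_id p.2))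
  simp only [hf] at hslice
  exact DFunLike.congr_fun
    (hslice.unique ((hasFDerivAt_const p.1 p.2).prodMk (K p.1).hasFDerivAt)) c

end FibrewiseLinear

lemma exists_contDiffOn_comp_eq_of_ker_le {X V E : Type*} [NormedAddCommGroup X]
    [NormedSpace ℝ X] [NormedAddCommGroup V] [NormedSpace ℝ V] [NormedAddCommGroup E]
    [NormedSpace ℝ E] [FiniteDimensional ℝ E] {G : X → V →L[ℝ] E} {Ω : Set X} {x₀ : X}
    (hG : ContDiffOn ℝ ∞ G Ω) (hsurj : Function.Surjective (G x₀))
    (hker : ∀ x ∈ Ω, (G x₀).ker ≤ (G x).ker) :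
    ∃ K : X → E →L[ℝ] E, ContDiffOn ℝ ∞ K Ω ∧ K x₀ = ContinuousLinearMap.id ℝ E ∧
      ∀ x ∈ Ω, ∀ v, K x (G x₀ v) = G x v := by
  obtain ⟨S, hS⟩ := (G x₀).exists_rightInverse_of_surjective (LinearMap.range_eq_top.2 hsurj)
  refine ⟨fun x => (G x).comp S, hG.clm_comp contDiffOn_const, hS, fun x hx v => ?_⟩
  have hv : S (G x₀ v) - v ∈ (G x).ker := by
    refine hker x hx ?_
    rw [LinearMap.mem_ker, map_sub, sub_eq_zero]
    exact DFunLike.congr_fun hS (G x₀ v)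
  rwa [LinearMap.mem_ker, map_sub, sub_eq_zero] at hv

variable {n : ℕ} {M : Type u} [TopologicalSpace M] [ChartedSpace (EuclideanSpace ℝ (Fin n)) M]
  [IsManifold (𝓡 n) ∞ M] {Θ : Tensor11 n M}

theorem Tensor11.IsAdapted.exists_isIntegrableOn {F E : Type*} [NormedAddCommGroup F]
    [NormedSpace ℝ F] [FiniteDimensional ℝ F] [NormedAddCommGroup E] [NormedSpace ℝ E]
    [FiniteDimensional ℝ E] {χ : OpenPartialHomeomorph M (F × E)} {G : F → F →L[ℝ] E}
    (h : Θ.IsAdapted χ fun p => G p.1) (hχ : IsSmoothCoord (n := n) χ) {Ω : Set F}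
    (hΩ : IsOpen Ω) (hG : ContDiffOn ℝ ∞ G Ω) {x₀ : M} (hx₀ : x₀ ∈ χ.source)
    (hx₀Ω : (χ x₀).1 ∈ Ω) (hsurj : Function.Surjective (G (χ x₀).1))
    (hker : ∀ u ∈ Ω, (G (χ x₀).1).ker ≤ (G u).ker) :
    ∃ W ⊆ χ.source, IsOpen W ∧ x₀ ∈ W ∧ Θ.IsIntegrableOn W := by
  have : CompleteSpace E := FiniteDimensional.complete ℝ E
  obtain ⟨K, hK, hK₀, hKG⟩ := exists_contDiffOn_comp_eq_of_ker_le hG hsurj hker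
  obtain ⟨Ω', hΩ'Ω, hΩ', hx₀Ω', hK', hKinv⟩ := exists_contDiffOn_inverse hK hΩ hx₀Ω
    (by rw [hK₀]; exact ⟨ContinuousLinearEquiv.refl ℝ E, rfl⟩)
  obtain ⟨Φ, hΦ, hΦsource, hΦapply⟩ := exists_isSmoothCoordChange_of_inverse hΩ'
    (hK.mono hΩ'Ω) hK' (fun u hu => (hKinv u hu).1) fun u hu => (hKinv u hu).2
  refine ⟨(χ.trans Φ).source, inter_subset_left, (χ.trans Φ).open_source,
    ⟨hx₀, by rw [mem_preimage, hΦsource]; exact ⟨hx₀Ω', trivial⟩⟩,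
    (hχ.trans hΦ).isIntegrableOn_source (T := (ContinuousLinearMap.inr ℝ F E).comp
      ((G (χ x₀).1).comp (ContinuousLinearMap.fst ℝ F E))) fun z hz ξ => ?_⟩
  have hd : DifferentiableAt ℝ Φ (χ z) := (hΦ.hasFDerivAt hz.2).differentiableAt
  have hzΩ' : (χ z).1 ∈ Ω' := (hΦsource ▸ hz.2 : χ z ∈ Ω' ×ˢ univ).1
  have hKG' (v : F) : (K (χ z).1).inverse (G (χ z).1 v) = G (χ x₀).1 v := by
    rw [← hKG _ (hΩ'Ω hzΩ'), (hKinv _ hzΩ').2]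
  rw [hχ.coordD_trans hΦ hz, hχ.coordD_trans hΦ hz, h z hz.1,
    fderiv_apply_inr_of_fibrewise (K := fun u => (K u).inverse) hΦapply hd, hKG']
  exact Prod.ext rfl (congrArg (G (χ x₀).1)
    (fderiv_apply_fst_of_fst_eq (fun q => by rw [hΦapply]) hd _).symm)

theorem LocalRealization.exists_isIntegrableOn (R : LocalRealization.{u, v} Θ)
    (hD : R.dist.IsIntegrable) {x₀ : M} (hx₀ : x₀ ∈ R.φ.source) :
    ∃ W ⊆ R.φ.source, IsOpen W ∧ x₀ ∈ W ∧ Θ.IsIntegrableOn W := by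
  obtain ⟨κ, hκ_atlas, hyκ, F, hF⟩ := hD (R.bundle.proj (R.φ x₀))
  have hκ : IsSmoothCoord (n := R.baseDim) κ := isSmoothCoord_of_mem_maximalAtlas hκ_atlas
  obtain ⟨r, ψ, G, hψ, hx₀ψ⟩ := R.bundle.exists_isAdaptedCoord hκ hyκ
  set χ := R.φ.trans ψ
  have hχ : IsSmoothCoord (n := n) χ := R.isSmoothCoord_trans hψ.isSmoothCoord
  have had := R.isAdapted_trans hψ
  have hx₀χ : x₀ ∈ χ.source := ⟨hx₀, hx₀ψ⟩
  have hΩ : IsOpen ((fun u => (u, (χ x₀).2)) ⁻¹' χ.target) :=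
    χ.open_target.preimage (by fun_prop)
  have hker {u : EuclideanSpace ℝ (Fin R.baseDim)} (hu : (u, (χ x₀).2) ∈ χ.target) :
      (G u).ker = F := by
    ext v
    have huκ := hψ.fst_mem_target hu.1
    have hy := κ.map_target huκ
    have hGF := hψ.mem_space_iff_of_mem_target hy (by rw [κ.right_inv huκ]; exact hu.1)
      ((coordD κ (κ.symm u)).inverse v)
    rw [hF _ hy, hκ.coordD_inverse hy, κ.right_inv huκ] at hGF
    exact hGF.symm.trans (iff_of_eq (congrArg (· ∈ F) (hκ.coordD_inverse hy v)))
  obtain ⟨W, hWχ, hW⟩ := had.exists_isIntegrableOn hχ hΩ (had.contDiffOn_slice hχ _) hx₀χ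
    (χ.map_source hx₀χ) (hψ.surjective _ hx₀ψ)
    fun u hu => ((hker (χ.map_source hx₀χ)).trans (hker hu).symm).le
  exact ⟨W, hWχ.trans inter_subset_left, hW⟩

end IntegrableTensor

section Gluing

variable {n : ℕ} {M : Type u} [TopologicalSpace M] [ChartedSpace (EuclideanSpace ℝ (Fin n)) M]
  {ι : Type*}

/-- Near `x` the functions `g i` with `i ∈ I` are the members not vanishing identically of a smooth
partition of unity subordinate to `W`. They are defined on all of `M`, so that vector fields on `M`
can be multiplied by them, but nothing is assumed away from `x`. -/
structure IsPartitionOfUnityNear (n : ℕ) {M : Type u} [TopologicalSpace M]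
    [ChartedSpace (EuclideanSpace ℝ (Fin n)) M] (g : ι → M → ℝ) (W : ι → Set M) (x : M)
    (I : Finset ι) : Prop where
  mem : ∀ i ∈ I, x ∈ W i
  eventually_eq_zero : ∀ᶠ y in 𝓝 x, ∀ i ∉ I, g i y = 0
  contMDiffAt : ∀ i ∈ I, ContMDiffAt (𝓡 n) 𝓘(ℝ, ℝ) ∞ (g i) x
  sum_eq_one : ∑ i ∈ I, g i x = 1

lemma exists_isPartitionOfUnityNear [IsManifold (𝓡 n) ∞ M] [T2Space M]
    [SecondCountableTopology M] {W : ι → Set M} (hW : ∀ i, IsOpen (W i)) :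
    ∃ g : ι → M → ℝ, ∀ x ∈ ⋃ i, W i, ∃ I, IsPartitionOfUnityNear n g W x I := by
  classical
  have hU : IsOpen (⋃ i, W i) := isOpen_iUnion hW
  let O : TopologicalSpace.Opens M := ⟨⋃ i, W i, hU⟩
  have : LocallyCompactSpace M := ChartedSpace.locallyCompactSpace (EuclideanSpace ℝ (Fin n)) M
  have : LocallyCompactSpace O := hU.locallyCompactSpace
  have : SigmaCompactSpace O := sigmaCompactSpace_of_locallyCompact_secondCountable
  obtain ⟨f, hf⟩ := SmoothPartitionOfUnity.exists_isSubordinate (𝓡 n) (M := O) (s := univ)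
    isClosed_univ (fun i => Subtype.val ⁻¹' W i)
    (fun i => (hW i).preimage continuous_subtype_val)
    (fun x _ => by rw [← preimage_iUnion]; exact x.2)
  let g : ι → M → ℝ := fun i y => if h : y ∈ ⋃ i, W i then f i ⟨y, h⟩ else 0
  have hg (i : ι) (y : O) : g i y = f i y := dif_pos y.2
  refine ⟨g, fun x hx => ⟨f.fintsupport ⟨x, hx⟩, ⟨fun i hi => ?_, ?_, fun i _ => ?_, ?_⟩⟩⟩
  · exact hf i ((f.mem_fintsupport_iff ⟨x, hx⟩ i).1 hi)
  · have hmap : Filter.map (Subtype.val : O → M) (𝓝 ⟨x, hx⟩) = 𝓝 x :=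
      map_nhds_subtype_coe_eq_nhds hx (hU.mem_nhds hx)
    rw [← hmap, eventually_map]
    filter_upwards [f.eventually_finsupport_subset ⟨x, hx⟩] with y hy i hi
    rw [hg]
    by_contra hne
    exact hi (hy ((f.mem_finsupport y).2 hne))
  · have hrestrict : ContMDiffAt (𝓡 n) 𝓘(ℝ, ℝ) ∞ (fun y : O => g i y) ⟨x, hx⟩ :=
      ((f i).contMDiff _).congr_of_eventuallyEq (Eventually.of_forall (hg i))
    exact contMDiffAt_subtype_iff.1 hrestrict
  · rw [← f.sum_finsupport' (⟨x, hx⟩ : O) (mem_univ _) (f.finsupport_subset_fintsupport _)]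
    exact Finset.sum_congr rfl fun i _ => hg i ⟨x, hx⟩

/-- The combination of the connections `c i` with weights `g i`. -/
def gluedConnection (g : ι → M → ℝ)
    (c : ι → (∀ x : M, TangentSpace (𝓡 n) x) →
      ∀ x : M, TangentSpace (𝓡 n) x →L[ℝ] TangentSpace (𝓡 n) x)
    (Y : ∀ x : M, TangentSpace (𝓡 n) x) (x : M) :
    TangentSpace (𝓡 n) x →L[ℝ] TangentSpace (𝓡 n) x :=
  ∑ᶠ i, g i x • c i Y x

section GluedConnection

variable {g : ι → M → ℝ} {W : ι → Set M}
  {c : ι → (∀ x : M, TangentSpace (𝓡 n) x) →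
    ∀ x : M, TangentSpace (𝓡 n) x →L[ℝ] TangentSpace (𝓡 n) x}
  {x : M} {I : Finset ι}

lemma gluedConnection_eq_sum (hI : ∀ i ∉ I, g i x = 0) (Y : ∀ x : M, TangentSpace (𝓡 n) x) :
    gluedConnection g c Y x = ∑ i ∈ I, g i x • c i Y x := by
  refine finsum_eq_sum_of_support_subset _ fun i hi => ?_
  by_contra hiI
  refine hi ?_
  change g i x • c i Y x = 0
  rw [hI i hiI, zero_smul]

lemma gluedConnection_apply (hI : ∀ i ∉ I, g i x = 0) (Y : ∀ x : M, TangentSpace (𝓡 n) x)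
    (ξ : TangentSpace (𝓡 n) x) :
    gluedConnection g c Y x ξ = ∑ i ∈ I, g i x • c i Y x ξ := by
  rw [gluedConnection_eq_sum hI, sum_apply]
  rfl

lemma IsPartitionOfUnityNear.sum_smul (h : IsPartitionOfUnityNear n g W x I) {V : Type*}
    [AddCommGroup V] [Module ℝ V] (v : V) : ∑ i ∈ I, g i x • v = v := by
  rw [← Finset.sum_smul, h.sum_eq_one, one_smul]

lemma isCovariantDerivativeOn_gluedConnection [IsManifold (𝓡 n) ∞ M] {U : Set M}
    (hg : ∀ x ∈ U, ∃ I, IsPartitionOfUnityNear n g W x I)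
    (hc : ∀ i, IsCovariantDerivativeOn (EuclideanSpace ℝ (Fin n)) (c i) (W i)) :
    IsCovariantDerivativeOn (EuclideanSpace ℝ (Fin n)) (gluedConnection g c) U := by
  refine ⟨fun {Y Y' x} hY hY' hx => ?_, fun {Y f x} hY hf hx => ?_⟩
  · obtain ⟨I, hI⟩ := hg x hx
    simp only [gluedConnection_eq_sum hI.eventually_eq_zero.self_of_nhds]
    rw [← Finset.sum_add_distrib]
    exact Finset.sum_congr rfl fun i hi => by rw [(hc i).add hY hY' (hI.mem i hi), smul_add]
  · obtain ⟨I, hI⟩ := hg x hx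
    simp only [gluedConnection_eq_sum hI.eventually_eq_zero.self_of_nhds]
    rw [← hI.sum_smul ((mvfderiv (𝓡 n) f x).smulRight (Y x)), Finset.smul_sum,
      ← Finset.sum_add_distrib]
    exact Finset.sum_congr rfl fun i hi => by
      rw [(hc i).leibniz hY hf (hI.mem i hi), smul_add, smul_comm]

lemma contMDiffCovariantDerivativeOn_gluedConnection [IsManifold (𝓡 n) ∞ M]
    (hW : ∀ i, IsOpen (W i)) (hg : ∀ x ∈ ⋃ i, W i, ∃ I, IsPartitionOfUnityNear n g W x I)
    (hc : ∀ i, ContMDiffCovariantDerivativeOn (EuclideanSpace ℝ (Fin n)) ∞ (c i) (W i)) :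
    ContMDiffCovariantDerivativeOn (EuclideanSpace ℝ (Fin n)) ∞ (gluedConnection g c)
      (⋃ i, W i) := by
  refine ⟨fun {Y} hY x hx => ?_⟩
  obtain ⟨I, hI⟩ := hg x hx
  have hsum : ContMDiffAt (𝓡 n)
      ((𝓡 n).prod 𝓘(ℝ, EuclideanSpace ℝ (Fin n) →L[ℝ] EuclideanSpace ℝ (Fin n))) ∞
      (fun z => (⟨z, ∑ i ∈ I, g i z • c i Y z⟩ :
        Bundle.TotalSpace (EuclideanSpace ℝ (Fin n) →L[ℝ] EuclideanSpace ℝ (Fin n))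
          fun z : M => TangentSpace (𝓡 n) z →L[ℝ] TangentSpace (𝓡 n) z)) x :=
    ContMDiffAt.sum_section
      (V := fun z : M => TangentSpace (𝓡 n) z →L[ℝ] TangentSpace (𝓡 n) z)
      (t := fun i z => g i z • c i Y z) fun i hi => ContMDiffAt.smul_section
        (V := fun z : M => TangentSpace (𝓡 n) z →L[ℝ] TangentSpace (𝓡 n) z) (hI.contMDiffAt i hi)
        (((hc i).contMDiff (hY.mono (subset_iUnion W i))).contMDiffAt
          ((hW i).mem_nhds (hI.mem i hi)))
  refine ContMDiffAt.contMDiffWithinAt (hsum.congr_of_eventuallyEq ?_)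
  filter_upwards [hI.eventually_eq_zero] with y hy
  exact Bundle.TotalSpace.ext rfl (heq_of_eq (gluedConnection_eq_sum hy Y))

end GluedConnection

variable [IsManifold (𝓡 n) ∞ M] [T2Space M] [SecondCountableTopology M] {Θ : Tensor11 n M}

theorem Tensor11.isIntegrableOn_iUnion {W : ι → Set M} (hW : ∀ i, IsOpen (W i))
    (hΘ : ∀ i, Θ.IsIntegrableOn (W i)) : Θ.IsIntegrableOn (⋃ i, W i) := by
  obtain ⟨g, hg⟩ := exists_isPartitionOfUnityNear (n := n) hW
  choose c hcov hsmooth htor hpar using hΘ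
  refine ⟨gluedConnection g c, isCovariantDerivativeOn_gluedConnection hg hcov,
    contMDiffCovariantDerivativeOn_gluedConnection hW hg hsmooth, fun x hx X Y hX hY => ?_,
    fun x hx Y hY ξ => ?_⟩
  · obtain ⟨I, hI⟩ := hg x hx
    simp only [gluedConnection_apply hI.eventually_eq_zero.self_of_nhds]
    rw [← hI.sum_smul (VectorField.mlieBracket (𝓡 n) X Y x), ← Finset.sum_sub_distrib]
    exact Finset.sum_congr rfl fun i hi => by
      rw [← smul_sub, htor i x (hI.mem i hi) X Y hX hY]
  · obtain ⟨I, hI⟩ := hg x hx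
    simp only [gluedConnection_apply hI.eventually_eq_zero.self_of_nhds, map_sum]
    exact Finset.sum_congr rfl fun i hi => by rw [hpar i x (hI.mem i hi) Y hY ξ, map_smul]

theorem Tensor11.isIntegrableOn_of_locally {U : Set M}
    (hΘ : ∀ x ∈ U, ∃ W ⊆ U, IsOpen W ∧ x ∈ W ∧ Θ.IsIntegrableOn W) : Θ.IsIntegrableOn U := by
  choose W hWU hW hxW hΘW using fun x : U => hΘ x x.2
  have hU : ⋃ x, W x = U :=
    (iUnion_subset hWU).antisymm fun x hx => mem_iUnion.2 ⟨⟨x, hx⟩, hxW ⟨x, hx⟩⟩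
  exact hU ▸ isIntegrableOn_iUnion hW hΘW

end Gluing

end

theorem mainTheorem7 {n : ℕ} {M : Type u} [TopologicalSpace M]
    [ChartedSpace (EuclideanSpace ℝ (Fin n)) M] [IsManifold (𝓡 n) ∞ M]
    [T2Space M] [SecondCountableTopology M]
    (Θ : Tensor11 n M) (hconst : Θ.AlgebraicallyConstant)
    (hsq : ∀ (x : M) (ξ : TangentSpace (𝓡 n) x), Θ x (Θ x ξ) = 0)
    (hN : Θ.NijenhuisVanishes) :
    -- `Θ` arises, locally, from the affine-bundle construction
    (∀ x : M, ∃ R : LocalRealization.{u, 0} Θ, x ∈ R.φ.source ∧ IsConnected R.φ.source) ∧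
    -- in every such local realization, the rank of `D` is the codimension of `Im Θ` in `Ker Θ`,
    -- and `Θ` is integrable (where realized) if and only if `D` is
    (∀ R : LocalRealization.{u, v} Θ,
      (∀ (x : M) (y : R.Base), Module.finrank ℝ (R.dist.space y) = Θ.codimImKer x) ∧
      (Θ.IsIntegrableOn R.φ.source ↔ R.dist.IsIntegrable)) ∧
    -- `Θ` is integrable on `M` if and only if all distributions `D` are, for any family of local
    -- realizations over sets covering `M`
    (∀ (ι : Type w) (R : ι → LocalRealization.{u, v} Θ), (⋃ i, (R i).φ.source) = Set.univ →
      (Θ.IsIntegrable ↔ ∀ i, (R i).dist.IsIntegrable)) := by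
  refine ⟨Tensor11.exists_localRealization hconst hsq hN, fun R => ⟨R.finrank_dist hconst hsq,
    fun h => R.isIntegrable_dist h R.φ.open_source subset_rfl,
    fun h => Tensor11.isIntegrableOn_of_locally fun x hx => R.exists_isIntegrableOn h hx⟩,
    fun ι R hR => ⟨fun h i => (R i).isIntegrable_dist h isOpen_univ (Set.subset_univ _),
      fun h => Tensor11.isIntegrableOn_of_locally fun x _ => ?_⟩⟩
  obtain ⟨i, hi⟩ := Set.mem_iUnion.1 (hR ▸ Set.mem_univ x)
  obtain ⟨W, -, hW⟩ := (R i).exists_isIntegrableOn (h i) hi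
  exact ⟨W, Set.subset_univ W, hW⟩
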